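/- Let $n \ge 4$ and let $(M,g)$ be a closed (compact, without boundary) connected smooth $n$-dimensional Riemannian manifold that is Einstein, i.e. $\mathrm{Ric} = c\, g$ for some constant $c \in \mathbb{R}$. Let $\mathrm{Rm}$ be the $(0,4)$-curvature tensor of the Levi-Civita connection $\nabla$, with the sign for which $\mathrm{Rm}(x,y,x,y)$ is the sectional curvature of the plane spanned by orthonormal vectors $x,y$. The curvature operator $\mathfrak{R}$ is the self-adjoint operator on $\Lambda^2 T_pM$ given by $g(\mathfrak{R}(x\wedge y), z\wedge w) = \mathrm{Rm}(x,y,z,w)$, where $\Lambda^2 T_pM$ carries the inner product for which $\{e_i\wedge e_j\}_{i<j}$ is orthonormal whenever $e_1,\dots,e_n$ is an orthonormal basis of $T_pM$; let $\lambda_1 \le \dots \le \lambda_{\binom n2}$ be its eigenvalues at $p$, counted with multiplicity. Suppose that at every point of $M$ $$\lambda_1+\lambda_2 \ge 0 \ \text{ if } n=4, \qquad \lambda_1+\dots+\lambda_{\lfloor (n-1)/2\rfloor} \ge 0 \ \text{ if } n\ge 5 .$$ Then the curvature tensor is parallel, $\nabla \mathrm{Rm} = 0$. Moreover, if the inequality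 is strict at every point of $M$, then $(M,g)$ has constant sectional curvature: there is $\kappa\in\mathbb{R}$ such that every tangent plane at every point has sectional curvature $\kappa$. -/

import Mathlib

open Bundle VectorField
open scoped Manifold ContDiff

noncomputable section

namespace RiemannianGeometry

/-- The curvature operator `𝔯 : Λ² V → Λ² V` of a `(0, 4)` curvature tensor `R` on a Euclidean vector
space `V`, determined by `⟪𝔯 (u ∧ v), z ∧ w⟫ = R(u, v, z, w)`. It is given on the orthonormal basis
`(e_i ∧ e_j)_{i < j}` of `Λ² V` induced by an orthonormal basis `e` of `V`; that basis is indexed by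
the two-element sets `s = {i < j}`, enumerated in increasing order by
`Set.powersetCard.ofFinEmbEquiv.symm s`. -/
def curvatureOperator {V : Type*} [NormedAddCommGroup V] [InnerProductSpace ℝ V]
    [FiniteDimensional ℝ V] (R : V → V → V → V → ℝ) : ⋀[ℝ]^2 V →ₗ[ℝ] ⋀[ℝ]^2 V :=
  let e := stdOrthonormalBasis ℝ V
  (e.exteriorPower 2).toBasis.constr ℝ fun s ↦
    ∑ t, R (e (Set.powersetCard.ofFinEmbEquiv.symm s 0))
        (e (Set.powersetCard.ofFinEmbEquiv.symm s 1))
        (e (Set.powersetCard.ofFinEmbEquiv.symm t 0))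
        (e (Set.powersetCard.ofFinEmbEquiv.symm t 1)) • e.exteriorPower 2 t

set_option linter.unusedSectionVars false

variable {E : Type*} [NormedAddCommGroup E] [NormedSpace ℝ E] [FiniteDimensional ℝ E]
  [CompleteSpace E]
  {H : Type*} [TopologicalSpace H] {I : ModelWithCorners ℝ E H}
  {M : Type*} [TopologicalSpace M] [ChartedSpace H M] [IsManifold I ∞ M]
  [RiemannianBundle (fun x : M ↦ TangentSpace I x)]
  [IsContMDiffRiemannianBundle I ∞ E (fun x : M ↦ TangentSpace I x)]

instance (x : M) : FiniteDimensional ℝ (TangentSpace I x) :=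
  inferInstanceAs (FiniteDimensional ℝ E)

/-- The right-hand side of the Koszul formula for `2 g(∇_X Y, Z)`. -/
def koszul (X Y Z : Π x : M, TangentSpace I x) (x : M) : ℝ :=
  d% (fun y ↦ inner ℝ (Y y) (Z y)) x (X x)
    + d% (fun y ↦ inner ℝ (X y) (Z y)) x (Y x)
    - d% (fun y ↦ inner ℝ (X y) (Y y)) x (Z x)
    + inner ℝ (mlieBracket I X Y x) (Z x)
    - inner ℝ (mlieBracket I X Z x) (Y x)
    - inner ℝ (mlieBracket I Y Z x) (X x)

theorem mdifferentiableAt_inner {X Y : Π x : M, TangentSpace I x} {x : M}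
    (hX : MDiffAt (T% X) x) (hY : MDiffAt (T% Y) x) :
    MDiffAt (fun y ↦ inner ℝ (X y) (Y y)) x :=
  MDifferentiableAt.inner_bundle (F := E) (E := fun x : M ↦ TangentSpace I x) (b := id) hX hY

theorem koszul_tensorial_left {Y Z : Π x : M, TangentSpace I x} {x : M}
    (hY : MDiffAt (T% Y) x) (hZ : MDiffAt (T% Z) x) :
    TensorialAt I E (fun X : Π x : M, TangentSpace I x ↦ koszul X Y Z x) x where
  smul {f X} hf hX := by
    simp [koszul, inner_smul_left, mvfderiv_fun_mul hf (mdifferentiableAt_inner hX hZ),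
      mvfderiv_fun_mul hf (mdifferentiableAt_inner hX hY), mlieBracket_smul_left hf hX, inner_smul_right,
      inner_add_left]
    ring
  add {X X'} hX hX' := by
    simp [koszul, inner_add_left, inner_add_right, mlieBracket_add_left hX hX',
      mvfderiv_fun_add (mdifferentiableAt_inner hX hZ) (mdifferentiableAt_inner hX' hZ),
      mvfderiv_fun_add (mdifferentiableAt_inner hX hY) (mdifferentiableAt_inner hX' hY)]
    ring

theorem koszul_tensorial_right {X Y : Π x : M, TangentSpace I x} {x : M}
    (hX : MDiffAt (T% X) x) (hY : MDiffAt (T% Y) x) :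
    TensorialAt I E (fun Z : Π x : M, TangentSpace I x ↦ koszul X Y Z x) x where
  smul {f Z} hf hZ := by
    simp [koszul, inner_smul_right, mvfderiv_fun_mul hf (mdifferentiableAt_inner hX hZ),
      mvfderiv_fun_mul hf (mdifferentiableAt_inner hY hZ), mlieBracket_smul_right hf hZ, inner_smul_left,
      inner_add_left]
    rw [real_inner_comm (X x) (Z x), real_inner_comm (Y x) (Z x)]
    ring
  add {Z Z'} hZ hZ' := by
    simp [koszul, inner_add_left, inner_add_right, mlieBracket_add_right hZ hZ',
      mvfderiv_fun_add (mdifferentiableAt_inner hX hZ) (mdifferentiableAt_inner hX hZ'),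
      mvfderiv_fun_add (mdifferentiableAt_inner hY hZ) (mdifferentiableAt_inner hY hZ')]
    ring

theorem koszul_add {X Y Y' Z : Π x : M, TangentSpace I x} {x : M}
    (hX : MDiffAt (T% X) x) (hY : MDiffAt (T% Y) x) (hY' : MDiffAt (T% Y') x)
    (hZ : MDiffAt (T% Z) x) :
    koszul X (Y + Y') Z x = koszul X Y Z x + koszul X Y' Z x := by
  simp [koszul, inner_add_left, inner_add_right, mlieBracket_add_right hY hY',
    mlieBracket_add_left hY hY',
    mvfderiv_fun_add (mdifferentiableAt_inner hY hZ) (mdifferentiableAt_inner hY' hZ),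
    mvfderiv_fun_add (mdifferentiableAt_inner hX hY) (mdifferentiableAt_inner hX hY')]
  ring

theorem koszul_smul {f : M → ℝ} {X Y Z : Π x : M, TangentSpace I x} {x : M}
    (hf : MDiffAt f x) (hX : MDiffAt (T% X) x) (hY : MDiffAt (T% Y) x) (hZ : MDiffAt (T% Z) x) :
    koszul X (f • Y) Z x = f x * koszul X Y Z x + 2 * (d% f x (X x) * inner ℝ (Y x) (Z x)) := by
  simp [koszul, inner_smul_left, inner_smul_right, mvfderiv_fun_mul hf (mdifferentiableAt_inner hY hZ),
    mvfderiv_fun_mul hf (mdifferentiableAt_inner hX hY), mlieBracket_smul_left hf hY,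
    mlieBracket_smul_right hf hY, inner_add_left]
  rw [real_inner_comm (Y x) (X x)]
  ring

/-- For a vector field `Y` differentiable at `x`, the bilinear form `(u, w) ↦ 2 g(∇_u Y, w)` on the
tangent space at `x`. -/
def koszulForm (Y : Π x : M, TangentSpace I x) (x : M) (hY : MDiffAt (T% Y) x) :
    TangentSpace I x →L[ℝ] TangentSpace I x →L[ℝ] ℝ :=
  TensorialAt.mkHom₂ (I := I) (F := E) (F' := E) (fun X Z ↦ koszul X Y Z x) x
    (fun _ hZ ↦ koszul_tensorial_left hY hZ) (fun _ hX ↦ koszul_tensorial_right hX hY)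

theorem koszulForm_apply {X Y Z : Π x : M, TangentSpace I x} {x : M}
    (hX : MDiffAt (T% X) x) (hY : MDiffAt (T% Y) x) (hZ : MDiffAt (T% Z) x) :
    koszulForm Y x hY (X x) (Z x) = koszul X Y Z x :=
  TensorialAt.mkHom₂_apply _ _ hX hZ

open scoped Classical in
/-- `leviCivitaFun Y x u = ∇_u Y`, the vector dual to `w ↦ g(∇_u Y, w)`. As for every Mathlib
covariant derivative, the value at a point where `Y` is not differentiable carries no meaning; it
is set to `0`. -/
def leviCivitaFun (Y : Π x : M, TangentSpace I x) (x : M) :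
    TangentSpace I x →L[ℝ] TangentSpace I x :=
  if hY : MDiffAt (T% Y) x then
    (2⁻¹ : ℝ) • ∑ i,
      ((koszulForm Y x hY).flip (stdOrthonormalBasis ℝ (TangentSpace I x) i)).smulRight
        (stdOrthonormalBasis ℝ (TangentSpace I x) i)
  else 0

theorem inner_leviCivitaFun {X Y Z : Π x : M, TangentSpace I x} {x : M}
    (hX : MDiffAt (T% X) x) (hY : MDiffAt (T% Y) x) (hZ : MDiffAt (T% Z) x) :
    inner ℝ (leviCivitaFun Y x (X x)) (Z x) = 2⁻¹ * koszul X Y Z x := by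
  rw [← koszulForm_apply hX hY hZ]
  conv_rhs => rw [← (stdOrthonormalBasis ℝ (TangentSpace I x)).sum_repr (Z x)]
  simp [leviCivitaFun, hY, inner_smul_left, sum_inner, OrthonormalBasis.repr_apply_apply, mul_comm]

theorem isCovariantDerivativeOn_leviCivitaFun :
    IsCovariantDerivativeOn E
      (leviCivitaFun : (Π x : M, TangentSpace I x) →
        Π x : M, TangentSpace I x →L[ℝ] TangentSpace I x) Set.univ where
  add {Y Y' _} hY hY' _ := by
    ext1 v
    refine ext_inner_right ℝ fun w ↦ ?_
    have hv := FiberBundle.mdifferentiableAt_extend I E v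
    have hw := FiberBundle.mdifferentiableAt_extend I E w
    have key := inner_leviCivitaFun hv (mdifferentiableAt_add_section hY hY') hw
    have k1 := inner_leviCivitaFun hv hY hw
    have k2 := inner_leviCivitaFun hv hY' hw
    rw [koszul_add hv hY hY' hw, mul_add, ← k1, ← k2] at key
    simpa [inner_add_left] using key
  leibniz {Y f x} hY hf _ := by
    ext1 v
    refine ext_inner_right ℝ fun w ↦ ?_
    have hv := FiberBundle.mdifferentiableAt_extend I E v
    have hw := FiberBundle.mdifferentiableAt_extend I E w
    have key := inner_leviCivitaFun hv (hf.smul_section hY) hw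
    have k1 := inner_leviCivitaFun hv hY hw
    have k2 := koszul_smul hf hv hY hw
    simp only [FiberBundle.extend_apply_self] at key k1 k2
    simp only [add_apply, smul_apply,
      ContinuousLinearMap.smulRight_apply, inner_add_left, real_inner_smul_left, k1]
    refine key.trans ?_
    erw [k2]
    ring

/-- The Levi-Civita connection of the Riemannian metric; `leviCivita Y x (X x)` is `∇_X Y` at `x`.
It is torsion-free and metric by the two theorems that follow. -/
def leviCivita : CovariantDerivative I E (TangentSpace I : M → Type _) where
  toFun := leviCivitaFun
  isCovariantDerivativeOnUniv := isCovariantDerivativeOn_leviCivitaFun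

theorem torsion_leviCivita :
    (leviCivita : CovariantDerivative I E (TangentSpace I : M → Type _)).torsion = 0 := by
  rw [CovariantDerivative.torsion_eq_zero_iff]
  intro X Y x hX hY
  refine ext_inner_right ℝ fun w ↦ ?_
  have hw := FiberBundle.mdifferentiableAt_extend I E w
  have k1 := inner_leviCivitaFun hX hY hw
  have k2 := inner_leviCivitaFun hY hX hw
  simp only [FiberBundle.extend_apply_self] at k1 k2
  change inner ℝ (leviCivitaFun Y x (X x) - leviCivitaFun X x (Y x)) w = _
  rw [inner_sub_left, k1, k2]
  simp only [koszul, FiberBundle.extend_apply_self, mlieBracket_swap_apply (V := Y) (W := X),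
    inner_neg_left, real_inner_comm (X _) (Y _)]
  ring

theorem isMetric_leviCivita {X Y Z : Π x : M, TangentSpace I x} {x : M}
    (hX : MDiffAt (T% X) x) (hY : MDiffAt (T% Y) x) (hZ : MDiffAt (T% Z) x) :
    d% (fun y ↦ inner ℝ (Y y) (Z y)) x (X x) =
      inner ℝ (leviCivita Y x (X x)) (Z x) + inner ℝ (Y x) (leviCivita Z x (X x)) := by
  have k1 := inner_leviCivitaFun hX hY hZ
  have k2 := inner_leviCivitaFun hX hZ hY
  rw [real_inner_comm (leviCivita Z x (X x)) (Y x)]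
  change _ = inner ℝ (leviCivitaFun Y x (X x)) (Z x) + inner ℝ (leviCivitaFun Z x (X x)) (Y x)
  rw [k1, k2]
  simp only [koszul, mlieBracket_swap_apply (V := Z) (W := Y),
    inner_neg_left, real_inner_comm (Y _) (Z _)]
  ring

/-- `R(X, Y) Z = ∇_X ∇_Y Z - ∇_Y ∇_X Z - ∇_[X, Y] Z` for vector fields. -/
def curvatureField (X Y Z : Π x : M, TangentSpace I x) (x : M) : TangentSpace I x :=
  leviCivita (fun y ↦ leviCivita Z y (Y y)) x (X x)
    - leviCivita (fun y ↦ leviCivita Z y (X y)) x (Y x)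
    - leviCivita Z x (mlieBracket I X Y x)

/-- The `(1, 3)` curvature tensor `R(u, v) w` on tangent vectors at `x`, computed with vector fields
that extend `u`, `v`, `w` and are smooth near `x`; by tensoriality the choice is immaterial. -/
def curvature (x : M) (u v w : TangentSpace I x) : TangentSpace I x :=
  curvatureField (FiberBundle.extend E u) (FiberBundle.extend E v) (FiberBundle.extend E w) x

/-- The `(0, 4)` curvature tensor `Rm(u, v, z, w) = g(R(u, v) w, z)`, with the sign for which
`Rm(u, v, u, v)` is positive on round spheres. -/
def Rm (x : M) (u v z w : TangentSpace I x) : ℝ :=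
  inner ℝ (curvature x u v w) z

/-- The Ricci tensor `Ric(u, v) = ∑ i, Rm(e_i, u, e_i, v)`, for an orthonormal basis `e`. -/
def ricci (x : M) (u v : TangentSpace I x) : ℝ :=
  ∑ i, Rm x (stdOrthonormalBasis ℝ (TangentSpace I x) i) u
    (stdOrthonormalBasis ℝ (TangentSpace I x) i) v

variable (I M) in
/-- The metric is Einstein: `Ric = c g` for a constant `c`. -/
def IsEinstein : Prop :=
  ∃ c : ℝ, ∀ (x : M) (u v : TangentSpace I x), ricci x u v = c * inner ℝ u v

/-- The covariant derivative `(∇_V Rm)(X, Y, Z, W)` of the curvature tensor at `x`. -/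
def covDerivRm (V X Y Z W : Π x : M, TangentSpace I x) (x : M) : ℝ :=
  d% (fun y ↦ Rm y (X y) (Y y) (Z y) (W y)) x (V x)
    - Rm x (leviCivita X x (V x)) (Y x) (Z x) (W x)
    - Rm x (X x) (leviCivita Y x (V x)) (Z x) (W x)
    - Rm x (X x) (Y x) (leviCivita Z x (V x)) (W x)
    - Rm x (X x) (Y x) (Z x) (leviCivita W x (V x))

variable (I M) in
/-- The curvature tensor is parallel: `∇ Rm = 0`. -/
def HasParallelCurvature : Prop :=
  ∀ V X Y Z W : Π x : M, TangentSpace I x,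
    CMDiff ∞ (T% V) → CMDiff ∞ (T% X) → CMDiff ∞ (T% Y) → CMDiff ∞ (T% Z) → CMDiff ∞ (T% W) →
      ∀ x : M, covDerivRm V X Y Z W x = 0

/-- The sectional curvature of the plane spanned by linearly independent vectors `u`, `v`. -/
def sectionalCurvature (x : M) (u v : TangentSpace I x) : ℝ :=
  Rm x u v u v / (inner ℝ u u * inner ℝ v v - inner ℝ u v ^ 2)

variable (I M) in
/-- All sectional curvatures, at all points, are equal to one constant. -/
def HasConstantSectionalCurvature : Prop :=
  ∃ κ : ℝ, ∀ (x : M) (u v : TangentSpace I x), LinearIndependent ℝ ![u, v] →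
    sectionalCurvature x u v = κ

variable (I) in
/-- The eigenvalues `λ₁ ≤ λ₂ ≤ ⋯` of the curvature operator of `M` at `x`, listed in increasing
order with multiplicity. -/
def curvatureEigenvalues (x : M) : List ℝ :=
  (curvatureOperator (Rm (I := I) x)).charpoly.roots.sort (· ≤ ·)

variable (I) in
/-- The sum `λ₁ + ⋯ + λ_k` of the `k` lowest eigenvalues of the curvature operator at `x`. -/
def lowestEigenvalueSum (x : M) (k : ℕ) : ℝ :=
  ((curvatureEigenvalues I x).take k).sum

end RiemannianGeometry

end

/-! The proof is a Bochner argument for the curvature tensor itself. On an Einstein manifold the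
second Bianchi identity makes Rm divergence free, so commuting covariant derivatives turns ΔRm into
a quadratic expression in Rm, and Δ|Rm|² = 2|∇Rm|² + 4Q (`FrameConnection.bochner`,
`inner₄_quadratic`). Let bivectors Ξ_a diagonalize the curvature operator with eigenvalues λ_a, and
let c_abc be the structure constants of so(n) in this basis. Then Q = ∑ λ_a e_a, where e_a = ∑
c_abc² (λ_b - λ_c)² is a quarter of the squared norm of Ξ_a acting on Rm as a derivation.

Everything rests on Q ≥ 0. Let m(n-1) be the Einstein constant and S = ∑ (λ_a - m)². The total ∑ e_a
equals 4(n-1)S (`sum_rotationEnergy`), while each single e_a is at most 8S (`rotationEnergy_le`),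
because antisymmetric matrices satisfy ‖[A, B]‖ ≤ ‖A‖‖B‖ (`commutator_sq_le`). Hence no e_a exceeds
the fraction 2/(n-1) of the total. The worst distribution of these weights loads the lowest
eigenvalues, so if the sum of the ⌊(n-1)/2⌋ lowest ones is nonnegative, Q is bounded below by a
nonnegative multiple of it (`curvatureEnergy_ge`). For n = 4 this would require λ₁ ≥ 0. The weaker
condition λ₁ + λ₂ ≥ 0 suffices by another route: total antisymmetry of c_abc allows Q to be averaged
into ⅓ ∑ c_abc² (λ_a(λ_b - λ_c)² + cyclic), and each such term is nonnegative when pairwise sums are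
(`triple_nonneg`).

Thus |Rm|² is subharmonic, and by the strong maximum principle it is constant on a closed connected
manifold (`eq_of_subharmonic`). Then |∇Rm|² and Q vanish. Under the strict inequality Q = 0 forces
all e_a = 0, hence S = 0, so the curvature operator is m times the identity.

The tensor calculus is carried out algebraically, over a commutative ring with derivations
(`FrameConnection`). A local orthonormal frame provides an instance of it over the functions smooth
on an open set (`toFrameConnection`). -/

noncomputable section

namespace RiemannianGeometry

/-! ### The Frobenius norm of commutators of antisymmetric matrices -/

section Commutator

set_option linter.unusedSectionVars false

open Matrix

variable {ι : Type*} [Fintype ι] [DecidableEq ι]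

theorem sum_normSq_eq_trace (X : Matrix ι ι ℂ) :
    ((∑ i, ∑ j, Complex.normSq (X i j) : ℝ) : ℂ) = (X * Xᴴ).trace := by
  simp [Matrix.trace, Matrix.mul_apply, Complex.mul_conj]

theorem sum_normSq_unitary_mul_mul (X U V : Matrix ι ι ℂ) (hU : Uᴴ * U = 1) (hV : V * Vᴴ = 1) :
    ∑ i, ∑ j, Complex.normSq ((U * X * V) i j) = ∑ i, ∑ j, Complex.normSq (X i j) := by
  have : (((∑ i, ∑ j, Complex.normSq ((U * X * V) i j) : ℝ)) : ℂ)
      = ((∑ i, ∑ j, Complex.normSq (X i j) : ℝ) : ℂ) := by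
    rw [sum_normSq_eq_trace, sum_normSq_eq_trace, conjTranspose_mul, conjTranspose_mul,
      show U * X * V * (Vᴴ * (Xᴴ * Uᴴ)) = U * (X * (V * Vᴴ) * Xᴴ * Uᴴ) by simp only [mul_assoc],
      hV, trace_mul_comm, mul_one, mul_assoc, hU, mul_one]
  exact_mod_cast this

/-- A matrix and its transpose have the same characteristic polynomial. The equality is one of
multisets, so it keeps multiplicities. -/
theorem eigenvalues_multiset_neg {H : Matrix ι ι ℂ} (hH : H.IsHermitian) (hT : Hᵀ = -H) :
    Multiset.map (fun i ↦ -hH.eigenvalues i) Finset.univ.val =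
      Multiset.map hH.eigenvalues Finset.univ.val := by
  have h1 : H.charpoly = (-H).charpoly := by rw [← hT, charpoly_transpose]
  have h2 := hH.charpoly_cfc_eq (fun x ↦ -x)
  rw [show cfc (fun x : ℝ ↦ -x) H = -H from cfc_neg_id (R := ℝ) H hH, ← h1, hH.charpoly_eq] at h2
  have h3 := congrArg Polynomial.roots h2
  have key : ∀ f : ι → ℝ, (∏ i, (Polynomial.X - Polynomial.C ((f i : ℝ) : ℂ))).roots =
      Multiset.map (fun i ↦ ((f i : ℝ) : ℂ)) Finset.univ.val := by
    intro f
    rw [Polynomial.roots_prod _ _ (Finset.prod_ne_zero_iff.2 fun i _ ↦ Polynomial.X_sub_C_ne_zero _)]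
    simp [Multiset.bind_singleton]
  have h4 := (key _).symm.trans (h3.trans (key fun i ↦ -hH.eigenvalues i))
  have h5 := congrArg (Multiset.map Complex.re) h4
  rw [Multiset.map_map, Multiset.map_map] at h5
  exact h5.symm

/-- By the symmetry of the spectrum the positive entries carry exactly half of the sum of squares,
and so do the negative ones. Two entries of equal sign therefore satisfy 2(a_j² + a_k²) ≤ ∑ a_l²;
for opposite signs the cross term 2 a_j a_k is not positive. -/
theorem add_sq_le_sum_sq {a : ι → ℝ}
    (ha : Multiset.map (fun i ↦ -a i) Finset.univ.val = Multiset.map a Finset.univ.val)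
    {j k : ι} (hjk : j ≠ k) : (a j + a k) ^ 2 ≤ ∑ l, a l ^ 2 := by
  have hpm : ∑ l, max (-a l) 0 ^ 2 = ∑ l, max (a l) 0 ^ 2 := by
    have := congrArg (fun s ↦ (Multiset.map (fun x : ℝ ↦ max x 0 ^ 2) s).sum) ha
    simp only [Multiset.map_map] at this
    exact this
  have hsplit : ∑ l, a l ^ 2 = ∑ l, max (a l) 0 ^ 2 + ∑ l, max (-a l) 0 ^ 2 := by
    rw [← Finset.sum_add_distrib]
    refine Finset.sum_congr rfl fun l _ ↦ ?_
    rcases le_total (a l) 0 with h | h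
    · rw [max_eq_right h, max_eq_left (by linarith)]; ring
    · rw [max_eq_left h, max_eq_right (by linarith)]; ring
  have two : ∀ f : ι → ℝ, (∀ i, 0 ≤ f i) → f j + f k ≤ ∑ l, f l := by
    intro f hf
    rw [← Finset.sum_pair hjk]
    exact Finset.sum_le_sum_of_subset_of_nonneg (Finset.subset_univ _) fun i _ _ ↦ hf i
  have t1 := two (fun l ↦ max (a l) 0 ^ 2) fun i ↦ by positivity
  have t2 := two (fun l ↦ max (-a l) 0 ^ 2) fun i ↦ by positivity
  have t3 := two (fun l ↦ a l ^ 2) fun i ↦ by positivity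
  rcases le_total (a j) 0 with hj | hj <;> rcases le_total (a k) 0 with hk | hk
  · rw [max_eq_left (by linarith : 0 ≤ -a j), max_eq_left (by linarith : 0 ≤ -a k)] at t2
    nlinarith [sq_nonneg (a j - a k)]
  · nlinarith [mul_nonneg (neg_nonneg.2 hj) hk]
  · nlinarith [mul_nonneg (neg_nonneg.2 hk) hj]
  · rw [max_eq_left hj, max_eq_left hk] at t1
    nlinarith [sq_nonneg (a j - a k)]

/-- The commutator of two real antisymmetric matrices has Frobenius norm at most the product of
their Frobenius norms. -/
theorem commutator_sq_le {A B : Matrix ι ι ℝ} (hA : Aᵀ = -A) (hB : Bᵀ = -B) :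
    ∑ i, ∑ j, (A * B - B * A) i j ^ 2 ≤ (∑ i, ∑ j, A i j ^ 2) * ∑ i, ∑ j, B i j ^ 2 := by
  let cA : Matrix ι ι ℂ := A.map Complex.ofReal
  let cB : Matrix ι ι ℂ := B.map Complex.ofReal
  -- The matrix iA is Hermitian with spectrum symmetric under negation.
  let H : Matrix ι ι ℂ := Complex.I • cA
  have hcA : cAᵀ = -cA := by
    ext i j; simpa [cA] using congrArg Complex.ofReal (congrFun (congrFun hA i) j)
  have hcB : cBᵀ = -cB := by
    ext i j; simpa [cB] using congrArg Complex.ofReal (congrFun (congrFun hB i) j)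
  have hT : Hᵀ = -H := by simp [H, hcA]
  have hH : H.IsHermitian := by
    ext i j
    have := congrFun (congrFun hcA i) j
    simp only [cA, transpose_apply, map_apply, Matrix.neg_apply] at this
    simp [H, cA, this]
  set a := hH.eigenvalues with ha
  let U : Matrix ι ι ℂ := hH.eigenvectorUnitary
  have hU1 : Uᴴ * U = 1 := Unitary.star_mul_self_of_mem hH.eigenvectorUnitary.2
  have hU2 : U * Uᴴ = 1 := Unitary.mul_star_self_of_mem hH.eigenvectorUnitary.2
  let D : Matrix ι ι ℂ := diagonal fun i ↦ (a i : ℂ)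
  have hspec : H = U * D * Uᴴ := hH.spectral_theorem
  have hspecT : Hᵀ = Uᴴᵀ * D * Uᵀ := by
    conv_lhs => rw [hspec]
    simp [D, transpose_mul, mul_assoc]
  have hU3 : Uᵀ * Uᴴᵀ = 1 := by rw [← transpose_mul, hU1, transpose_one]
  have hU4 : Uᴴᵀ * Uᵀ = 1 := by rw [← transpose_mul, hU2, transpose_one]
  -- `Uᴴᵀ` is the entrywise conjugate of `U`. Moving B by congruence rather than by conjugation
  -- keeps β antisymmetric, and since `Hᵀ = -H` the commutator becomes Dβ + βD, with entries (a_j +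
  -- a_k) β_jk.
  let β : Matrix ι ι ℂ := Uᴴ * cB * Uᴴᵀ
  have hβ : βᵀ = -β := by simp [β, transpose_mul, hcB, mul_assoc]
  have hβd : ∀ j, β j j = 0 := fun j ↦ by
    have := congrFun (congrFun hβ j) j
    simp only [transpose_apply, Matrix.neg_apply] at this
    exact self_eq_neg.1 this
  have hcomm : Uᴴ * (H * cB - cB * H) * Uᴴᵀ = D * β + β * D := by
    have e1 : H * cB - cB * H = H * cB + cB * Hᵀ := by rw [hT]; simp [sub_eq_add_neg]
    rw [e1, hspecT, hspec]
    have e2 : Uᴴ * (U * D * Uᴴ * cB) * Uᴴᵀ = (Uᴴ * U) * D * β := by simp only [β, mul_assoc]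
    have e3 : Uᴴ * (cB * (Uᴴᵀ * D * Uᵀ)) * Uᴴᵀ = β * D * (Uᵀ * Uᴴᵀ) := by simp only [β, mul_assoc]
    rw [mul_add, add_mul, e2, e3, hU1, hU3, one_mul, mul_one]
  have hunit : Uᴴᵀ * Uᴴᵀᴴ = 1 := by
    have : Uᴴᵀᴴ = Uᵀ := by ext i j; simp
    rw [this, hU4]
  have hUh : Uᴴᴴ * Uᴴ = 1 := by rw [conjTranspose_conjTranspose, hU2]
  have n1 : ∑ i, ∑ j, (A * B - B * A) i j ^ 2 =
      ∑ i, ∑ j, Complex.normSq ((D * β + β * D) i j) := by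
    rw [← hcomm, sum_normSq_unitary_mul_mul _ _ _ hUh hunit]
    refine Finset.sum_congr rfl fun i _ ↦ Finset.sum_congr rfl fun j _ ↦ ?_
    have : (H * cB - cB * H) i j = Complex.I * (((A * B - B * A) i j : ℝ) : ℂ) := by
      simp [H, cA, cB, Matrix.mul_apply, Finset.mul_sum, mul_sub]
    rw [this, map_mul, Complex.normSq_I, one_mul, Complex.normSq_ofReal, sq]
  have n2 : ∑ i, ∑ j, B i j ^ 2 = ∑ i, ∑ j, Complex.normSq (β i j) := by
    rw [sum_normSq_unitary_mul_mul _ _ _ hUh hunit]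
    simp [cB, sq]
  have n3 : ∑ i, ∑ j, A i j ^ 2 = ∑ l, a l ^ 2 := by
    have e1 : ∑ i, ∑ j, A i j ^ 2 = ∑ i, ∑ j, Complex.normSq (H i j) := by simp [H, cA, sq]
    rw [e1, hspec, sum_normSq_unitary_mul_mul _ _ _ hU1 (by simpa using hU1)]
    simp [D, diagonal_apply, apply_ite Complex.normSq, sq]
  rw [n1, n2, n3, Finset.mul_sum]
  refine Finset.sum_le_sum fun j _ ↦ ?_
  rw [Finset.mul_sum]
  refine Finset.sum_le_sum fun k _ ↦ ?_
  have e : (D * β + β * D) j k = ((a j + a k : ℝ) : ℂ) * β j k := by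
    simp only [D, Matrix.add_apply, diagonal_mul, mul_diagonal]; push_cast; ring
  rw [e, map_mul, Complex.normSq_ofReal, ← sq]
  -- On the diagonal the bound on (a_j + a_k)² can fail, but there β vanishes.
  by_cases hjk : j = k
  · subst hjk; simp [hβd]
  · exact mul_le_mul_of_nonneg_right
      (add_sq_le_sum_sq (eigenvalues_multiset_neg hH hT) hjk) (Complex.normSq_nonneg _)

end Commutator

end RiemannianGeometry

end

noncomputable section

namespace RiemannianGeometry

/-! ### Reordering of finite sums -/

section SumManipulation

variable {ι κ S : Type*} [Fintype ι] [Fintype κ] [AddCommMonoid S]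

theorem sum_rotate₃ (f : ι → ι → ι → S) :
    ∑ i, ∑ j, ∑ k, f i j k = ∑ i, ∑ j, ∑ k, f k i j := by
  rw [Finset.sum_comm]
  exact Finset.sum_congr rfl fun j _ ↦ Finset.sum_comm

theorem sum_comm₂ (f : ι → ι → κ → S) :
    ∑ i, ∑ j, ∑ a, f i j a = ∑ a, ∑ i, ∑ j, f i j a := by
  rw [Finset.sum_comm (s := Finset.univ (α := κ))]
  exact Finset.sum_congr rfl fun i _ ↦ Finset.sum_comm

theorem sum_comm₄ (f : ι → ι → ι → ι → κ → S) :
    ∑ i, ∑ j, ∑ k, ∑ l, ∑ a, f i j k l a = ∑ a, ∑ i, ∑ j, ∑ k, ∑ l, f i j k l a := by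
  rw [← sum_comm₂ fun i j a ↦ ∑ k, ∑ l, f i j k l a]
  exact Finset.sum_congr rfl fun i _ ↦ Finset.sum_congr rfl fun j _ ↦ sum_comm₂ (f i j)

end SumManipulation

/-! ### The Lie algebra of bivectors in an eigenbasis of the curvature operator -/

section BivectorAlgebra

open Matrix

variable {ι Λ : Type*} [Fintype ι] [DecidableEq ι] [Fintype Λ] [DecidableEq Λ]

/-- The Kronecker symbol. -/
def kron (i j : ι) : ℝ := if i = j then 1 else 0

/-- The family `Ξ` of antisymmetric matrices is an orthonormal basis of the space of bivectors that
diagonalizes the curvature tensor `R`, with eigenvalues `lam`. -/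
structure IsBivectorEigenbasis (R : ι → ι → ι → ι → ℝ) (lam : Λ → ℝ) (Ξ : Λ → Matrix ι ι ℝ) :
    Prop where
  antisymm : ∀ a, (Ξ a)ᵀ = -Ξ a
  complete : ∀ i j k l, ∑ a, Ξ a i j * Ξ a k l = kron i k * kron j l - kron i l * kron j k
  orthonormal : ∀ a b, ∑ i, ∑ j, Ξ a i j * Ξ b i j = if a = b then 2 else 0
  decomp : ∀ i j k l, R i j k l = ∑ a, lam a * (Ξ a i j * Ξ a k l)

/-- The structure constants `⟪[Ξ a, Ξ b], Ξ c⟫` of the Lie algebra of bivectors. -/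
def structureConst (Ξ : Λ → Matrix ι ι ℝ) (a b c : Λ) : ℝ :=
  ∑ i, ∑ j, (Ξ a * Ξ b) i j * Ξ c i j

variable {R : ι → ι → ι → ι → ℝ} {lam : Λ → ℝ} {Ξ : Λ → Matrix ι ι ℝ}

namespace IsBivectorEigenbasis

theorem apply_swap (h : IsBivectorEigenbasis R lam Ξ) (a : Λ) (i j : ι) : Ξ a i j = -Ξ a j i := by
  simpa using congrFun (congrFun (h.antisymm a) j) i

/-- Invariance of the trace under cyclic permutation and transposition then makes the structure
constants totally antisymmetric. -/
theorem structureConst_eq_neg_trace (h : IsBivectorEigenbasis R lam Ξ) (a b c : Λ) :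
    structureConst Ξ a b c = -(Ξ a * Ξ b * Ξ c).trace := by
  rw [structureConst, Matrix.trace, ← Finset.sum_neg_distrib]
  refine Finset.sum_congr rfl fun i _ ↦ ?_
  rw [Matrix.diag_apply, Matrix.mul_apply, ← Finset.sum_neg_distrib]
  refine Finset.sum_congr rfl fun j _ ↦ ?_
  rw [h.apply_swap c i j, mul_neg]

theorem structureConst_cycle (h : IsBivectorEigenbasis R lam Ξ) (a b c : Λ) :
    structureConst Ξ a b c = structureConst Ξ b c a := by
  rw [h.structureConst_eq_neg_trace, h.structureConst_eq_neg_trace, Matrix.trace_mul_comm,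
    ← mul_assoc, Matrix.trace_mul_comm, ← mul_assoc]

theorem structureConst_swap (h : IsBivectorEigenbasis R lam Ξ) (a b c : Λ) :
    structureConst Ξ a b c = -structureConst Ξ b a c := by
  rw [h.structureConst_eq_neg_trace, h.structureConst_eq_neg_trace, ← Matrix.trace_transpose]
  simp only [transpose_mul, h.antisymm]
  rw [Matrix.trace_mul_comm]
  simp

theorem structureConst_swap_right (h : IsBivectorEigenbasis R lam Ξ) (a b c : Λ) :
    structureConst Ξ a b c = -structureConst Ξ a c b := by
  rw [h.structureConst_cycle, h.structureConst_swap, h.structureConst_cycle c b a,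
    h.structureConst_cycle b a c]

/-- Parseval's identity for bivectors, from completeness: pairing with the `Ξ a` sees only the
antisymmetric parts of X and Y. -/
theorem sum_inner_mul (h : IsBivectorEigenbasis R lam Ξ) (X Y : ι → ι → ℝ) :
    ∑ a, (∑ i, ∑ j, X i j * Ξ a i j) * (∑ k, ∑ l, Y k l * Ξ a k l) =
      ∑ i, ∑ j, X i j * Y i j - ∑ i, ∑ j, X i j * Y j i := by
  have e : ∀ a, (∑ i, ∑ j, X i j * Ξ a i j) * (∑ k, ∑ l, Y k l * Ξ a k l) =
      ∑ i, ∑ j, ∑ k, ∑ l, X i j * Y k l * (Ξ a i j * Ξ a k l) := by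
    intro a
    rw [Finset.sum_mul]
    refine Finset.sum_congr rfl fun i _ ↦ ?_
    rw [Finset.sum_mul]
    refine Finset.sum_congr rfl fun j _ ↦ ?_
    rw [Finset.mul_sum]
    refine Finset.sum_congr rfl fun k _ ↦ ?_
    rw [Finset.mul_sum]
    exact Finset.sum_congr rfl fun l _ ↦ by ring
  simp_rw [e]
  rw [← sum_comm₄, ← Finset.sum_sub_distrib]
  refine Finset.sum_congr rfl fun i _ ↦ ?_
  rw [← Finset.sum_sub_distrib]
  refine Finset.sum_congr rfl fun j _ ↦ ?_
  simp_rw [← Finset.mul_sum, h.complete, kron]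
  simp [mul_sub, Finset.sum_sub_distrib]

theorem antisymm_expansion (h : IsBivectorEigenbasis R lam Ξ) (X : ι → ι → ℝ) (k l : ι) :
    ∑ a, (∑ i, ∑ j, X i j * Ξ a i j) * Ξ a k l = X k l - X l k := by
  have := h.sum_inner_mul X (fun i j ↦ kron i k * kron j l)
  simpa [kron, ite_and] using this

theorem commutator_expansion (h : IsBivectorEigenbasis R lam Ξ) (a b : Λ) :
    Ξ a * Ξ b - Ξ b * Ξ a = ∑ c, structureConst Ξ a b c • Ξ c := by
  ext k l
  have h1 := h.antisymm_expansion (fun i j ↦ (Ξ a * Ξ b) i j) k l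
  have h2 : (Ξ b * Ξ a) k l = (Ξ a * Ξ b) l k := by
    have := congrFun (congrFun (transpose_mul (Ξ a) (Ξ b)) k) l
    rw [h.antisymm, h.antisymm] at this
    simpa using this.symm
  simp only [Matrix.sub_apply, Matrix.sum_apply, Matrix.smul_apply, smul_eq_mul, h2]
  exact h1.symm

theorem sum_commutator_sq (h : IsBivectorEigenbasis R lam Ξ) (a b : Λ) :
    ∑ i, ∑ j, (Ξ a * Ξ b - Ξ b * Ξ a) i j ^ 2 = 2 * ∑ c, structureConst Ξ a b c ^ 2 := by
  have e : ∀ i j, (Ξ a * Ξ b - Ξ b * Ξ a) i j ^ 2 =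
      ∑ c, structureConst Ξ a b c * ((Ξ a * Ξ b - Ξ b * Ξ a) i j * Ξ c i j) := by
    intro i j
    have := congrFun (congrFun (h.commutator_expansion a b) i) j
    simp only [Matrix.sum_apply, Matrix.smul_apply, smul_eq_mul] at this
    rw [sq]
    nth_rewrite 2 [this]
    rw [Finset.mul_sum]
    exact Finset.sum_congr rfl fun c _ ↦ by ring
  simp_rw [e]
  rw [sum_comm₂, Finset.mul_sum]
  refine Finset.sum_congr rfl fun c _ ↦ ?_
  simp_rw [← Finset.mul_sum, Matrix.sub_apply, sub_mul, Finset.sum_sub_distrib]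
  change structureConst Ξ a b c * (structureConst Ξ a b c - structureConst Ξ b a c) = _
  rw [h.structureConst_swap b a c]
  ring

/-- Each `Ξ a` has squared Frobenius norm 2, so the commutator estimate bounds twice this sum by 2 ·
2. -/
theorem sum_structureConst_sq_le (h : IsBivectorEigenbasis R lam Ξ) (a b : Λ) :
    ∑ c, structureConst Ξ a b c ^ 2 ≤ 2 := by
  have h1 := commutator_sq_le (h.antisymm a) (h.antisymm b)
  rw [h.sum_commutator_sq] at h1
  have h2 : ∀ a, ∑ i, ∑ j, Ξ a i j ^ 2 = 2 := fun a ↦ by simpa [sq] using h.orthonormal a a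
  rw [h2, h2] at h1
  linarith

/-- The squared norm of the derivative of the curvature tensor in the direction of `Ξ a`. -/
def _root_.RiemannianGeometry.rotationEnergy (Ξ : Λ → Matrix ι ι ℝ) (lam : Λ → ℝ) (a : Λ) : ℝ :=
  ∑ b, ∑ c, structureConst Ξ a b c ^ 2 * (lam b - lam c) ^ 2

theorem sum_sq_swap (h : IsBivectorEigenbasis R lam Ξ) (a : Λ) (f : Λ → Λ → ℝ) :
    ∑ b, ∑ c, structureConst Ξ a b c ^ 2 * f b c =
      ∑ b, ∑ c, structureConst Ξ a b c ^ 2 * f c b := by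
  rw [Finset.sum_comm]
  refine Finset.sum_congr rfl fun b _ ↦ Finset.sum_congr rfl fun c _ ↦ ?_
  rw [h.structureConst_swap_right a b c, neg_sq]

/-- Only differences of eigenvalues enter, so they may be shifted by any m. The constant is 2 · 2 ·
2: from (x - y)² ≤ 2x² + 2y², from the equal contributions of b and c, and from the row bound
`sum_structureConst_sq_le`. -/
theorem rotationEnergy_le (h : IsBivectorEigenbasis R lam Ξ) (a : Λ) (m : ℝ) :
    rotationEnergy Ξ lam a ≤ 8 * ∑ b, (lam b - m) ^ 2 := by
  have h1 : rotationEnergy Ξ lam a ≤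
      ∑ b, ∑ c, structureConst Ξ a b c ^ 2 * (2 * (lam b - m) ^ 2 + 2 * (lam c - m) ^ 2) := by
    refine Finset.sum_le_sum fun b _ ↦ Finset.sum_le_sum fun c _ ↦ ?_
    refine mul_le_mul_of_nonneg_left ?_ (sq_nonneg _)
    nlinarith [sq_nonneg ((lam b - m) + (lam c - m))]
  refine h1.trans ?_
  simp_rw [mul_add, Finset.sum_add_distrib]
  rw [h.sum_sq_swap a (fun b c ↦ 2 * (lam c - m) ^ 2), Finset.mul_sum, ← Finset.sum_add_distrib]
  refine Finset.sum_le_sum fun b _ ↦ ?_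
  rw [← Finset.sum_mul]
  nlinarith [h.sum_structureConst_sq_le a b, sq_nonneg (lam b - m)]

/-- First sum over the Lie algebra: the Killing form of the rotation algebra. -/
theorem sum_structureConst_sq_left (h : IsBivectorEigenbasis R lam Ξ) (b c : Λ) :
    ∑ a, structureConst Ξ a b c ^ 2 =
      ∑ i, ∑ j, ∑ p, ∑ q, (Ξ b i p * Ξ b i q) * (Ξ c p j * Ξ c q j) -
      ∑ i, ∑ j, ∑ p, ∑ q, (Ξ b i p * Ξ b j q) * (Ξ c p j * Ξ c q i) := by
  have h1 := h.sum_inner_mul (fun i j ↦ (Ξ b * Ξ c) i j) (fun i j ↦ (Ξ b * Ξ c) i j)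
  have h2 : ∀ a, structureConst Ξ a b c = ∑ i, ∑ j, (Ξ b * Ξ c) i j * Ξ a i j := fun a ↦
    h.structureConst_cycle a b c
  simp_rw [h2, sq, h1, Matrix.mul_apply, Finset.sum_mul_sum]
  congr 1 <;>
  exact Finset.sum_congr rfl fun i _ ↦ Finset.sum_congr rfl fun j _ ↦
      Finset.sum_congr rfl fun k _ ↦ Finset.sum_congr rfl fun l _ ↦ by ring

/-- This is the Casimir eigenvalue of the adjoint representation of so(n), obtained from
completeness in the index c. -/
theorem sum_sum_structureConst_sq (h : IsBivectorEigenbasis R lam Ξ) (b : Λ) :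
    ∑ a, ∑ c, structureConst Ξ a b c ^ 2 = 2 * ((Fintype.card ι : ℝ) - 2) := by
  rw [Finset.sum_comm]
  simp_rw [h.sum_structureConst_sq_left b]
  rw [Finset.sum_sub_distrib, ← sum_comm₄, ← sum_comm₄]
  simp_rw [← Finset.mul_sum, h.complete, kron]
  have o : ∑ i, ∑ j, Ξ b i j * Ξ b i j = 2 := by simpa using h.orthonormal b b
  have z : ∀ i, Ξ b i i = 0 := fun i ↦ self_eq_neg.1 (h.apply_swap b i i)
  have e1 : ∀ x : ι, ∑ j : ι, ∑ p, Ξ b x p * Ξ b x p = (Fintype.card ι : ℝ) * ∑ p, Ξ b x p * Ξ b x p := by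
    intro x; simp
  simp [mul_sub, Finset.sum_sub_distrib, z, e1, ← Finset.mul_sum, o]
  linarith

theorem tensor_sq_sum (h : IsBivectorEigenbasis R lam Ξ) :
    ∑ i, ∑ j, ∑ k, ∑ l, R i j k l ^ 2 = 4 * ∑ a, lam a ^ 2 := by
  have e : ∀ i j k l, R i j k l ^ 2 = ∑ a, ∑ b,
      lam a * lam b * ((Ξ a i j * Ξ b i j) * (Ξ a k l * Ξ b k l)) := by
    intro i j k l
    rw [sq, h.decomp, Finset.sum_mul_sum]
    exact Finset.sum_congr rfl fun a _ ↦ Finset.sum_congr rfl fun b _ ↦ by ring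
  simp_rw [e]
  rw [sum_comm₄, Finset.mul_sum]
  refine Finset.sum_congr rfl fun a _ ↦ ?_
  rw [sum_comm₄]
  simp_rw [← Finset.mul_sum, ← Finset.sum_mul, h.orthonormal]
  simp
  ring

/-- Inserting the formula for ∑_a c_abc² and absorbing the eigenvalues into R gives two
contractions. The first contains the Ricci tensor and vanishes. The second leaves ∑ R_ijkl R_iljk,
which the first Bianchi identity evaluates as -|R|²/2, and |R|² = 4 ∑ λ_a². -/
theorem sum_mul_structureConst_sq (h : IsBivectorEigenbasis R lam Ξ)
    (hB : ∀ i j k l, R i j k l + R i k l j + R i l j k = 0)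
    (hRic : ∀ j l, ∑ i, R i j i l = 0) :
    ∑ b, ∑ c, ∑ a, structureConst Ξ a b c ^ 2 * (lam b * lam c) = -2 * ∑ a, lam a ^ 2 := by
  have e : ∀ b c, ∑ a, structureConst Ξ a b c ^ 2 * (lam b * lam c) =
      ∑ i, ∑ j, ∑ p, ∑ q, (lam b * (Ξ b i p * Ξ b i q)) * (lam c * (Ξ c p j * Ξ c q j)) -
      ∑ i, ∑ j, ∑ p, ∑ q, (lam b * (Ξ b i p * Ξ b j q)) * (lam c * (Ξ c p j * Ξ c q i)) := by
    intro b c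
    rw [← Finset.sum_mul, h.sum_structureConst_sq_left, sub_mul]
    simp_rw [Finset.sum_mul]
    congr 1 <;>
    exact Finset.sum_congr rfl fun i _ ↦ Finset.sum_congr rfl fun j _ ↦
      Finset.sum_congr rfl fun k _ ↦ Finset.sum_congr rfl fun l _ ↦ by ring
  simp_rw [e, Finset.sum_sub_distrib, ← sum_comm₄]
  simp_rw [← Finset.sum_mul_sum, ← h.decomp]
  have hS := h.tensor_sq_sum
  have h12 : ∀ i j k l, R i j k l = -R j i k l := by
    intro i j k l
    rw [h.decomp, h.decomp, ← Finset.sum_neg_distrib]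
    exact Finset.sum_congr rfl fun a _ ↦ by rw [h.apply_swap a i j]; ring
  have hpair : ∀ i j k l, R i j k l = R k l i j := by
    intro i j k l
    rw [h.decomp, h.decomp]
    exact Finset.sum_congr rfl fun a _ ↦ by ring
  have h1 : ∑ i, ∑ j, ∑ p, ∑ q, R i p i q * R p j q j = 0 := by
    rw [Finset.sum_comm]
    refine Finset.sum_eq_zero fun j _ ↦ ?_
    rw [Finset.sum_comm]
    refine Finset.sum_eq_zero fun p _ ↦ ?_
    rw [Finset.sum_comm]
    refine Finset.sum_eq_zero fun q _ ↦ ?_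
    rw [← Finset.sum_mul, hRic, zero_mul]
  have h2 : ∑ i, ∑ j, ∑ p, ∑ q, R i p j q * R p j q i =
      -∑ i, ∑ j, ∑ k, ∑ l, R i j k l * R i l j k := by
    rw [← Finset.sum_neg_distrib]
    refine Finset.sum_congr rfl fun i _ ↦ ?_
    rw [Finset.sum_comm, ← Finset.sum_neg_distrib]
    refine Finset.sum_congr rfl fun p _ ↦ ?_
    rw [← Finset.sum_neg_distrib]
    refine Finset.sum_congr rfl fun j _ ↦ ?_
    rw [← Finset.sum_neg_distrib]
    refine Finset.sum_congr rfl fun q _ ↦ ?_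
    rw [hpair p j q i, h12 q i p j]
    ring
  have h3 : ∑ i, ∑ j, ∑ k, ∑ l, R i j k l * R i k l j =
      ∑ i, ∑ j, ∑ k, ∑ l, R i j k l * R i l j k := by
    refine Finset.sum_congr rfl fun i _ ↦ ?_
    rw [sum_rotate₃]
    exact Finset.sum_congr rfl fun j _ ↦ Finset.sum_congr rfl fun k _ ↦
      Finset.sum_congr rfl fun l _ ↦ mul_comm _ _
  have h4 : ∑ i, ∑ j, ∑ k, ∑ l, R i j k l ^ 2 + ∑ i, ∑ j, ∑ k, ∑ l, R i j k l * R i k l j +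
      ∑ i, ∑ j, ∑ k, ∑ l, R i j k l * R i l j k = 0 := by
    simp_rw [← Finset.sum_add_distrib]
    refine Finset.sum_eq_zero fun i _ ↦ Finset.sum_eq_zero fun j _ ↦ Finset.sum_eq_zero fun k _ ↦
      Finset.sum_eq_zero fun l _ ↦ ?_
    linear_combination R i j k l * hB i j k l
  rw [h1, h2]
  linarith

/-- Total rotation energy of a Ricci-flat algebraic curvature tensor. -/
theorem sum_rotationEnergy_of_ricci_flat (h : IsBivectorEigenbasis R lam Ξ)
    (hB : ∀ i j k l, R i j k l + R i k l j + R i l j k = 0)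
    (hRic : ∀ j l, ∑ i, R i j i l = 0) :
    ∑ a, rotationEnergy Ξ lam a = 4 * ((Fintype.card ι : ℝ) - 1) * ∑ a, lam a ^ 2 := by
  have e : ∀ a, rotationEnergy Ξ lam a =
      2 * ∑ b, ∑ c, structureConst Ξ a b c ^ 2 * lam b ^ 2 -
      2 * ∑ b, ∑ c, structureConst Ξ a b c ^ 2 * (lam b * lam c) := by
    intro a
    have h1 := h.sum_sq_swap a fun b c ↦ lam c ^ 2
    have h2 : rotationEnergy Ξ lam a = ∑ b, ∑ c, structureConst Ξ a b c ^ 2 * lam b ^ 2 +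
      ∑ b, ∑ c, structureConst Ξ a b c ^ 2 * lam c ^ 2 -
      2 * ∑ b, ∑ c, structureConst Ξ a b c ^ 2 * (lam b * lam c) := by
      simp_rw [rotationEnergy, Finset.mul_sum, ← Finset.sum_add_distrib, ← Finset.sum_sub_distrib]
      exact Finset.sum_congr rfl fun i _ ↦ Finset.sum_congr rfl fun j _ ↦ by ring
    rw [h2, h1]; ring
  simp_rw [e]
  rw [Finset.sum_sub_distrib, ← Finset.mul_sum, ← Finset.mul_sum]
  have h1 : ∑ a, ∑ b, ∑ c, structureConst Ξ a b c ^ 2 * lam b ^ 2 =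
      2 * ((Fintype.card ι : ℝ) - 2) * ∑ a, lam a ^ 2 := by
    rw [Finset.sum_comm, Finset.mul_sum]
    refine Finset.sum_congr rfl fun b _ ↦ ?_
    simp_rw [← Finset.sum_mul, h.sum_sum_structureConst_sq b]
  have h2 := h.sum_mul_structureConst_sq hB hRic
  rw [sum_comm₂] at h2
  rw [h1, h2]; ring

end IsBivectorEigenbasis

end BivectorAlgebra

end RiemannianGeometry

end

noncomputable section

namespace RiemannianGeometry

/-! ### Nonnegativity of the quadratic curvature term -/

section CurvatureEnergy

set_option linter.unusedSectionVars false

open Matrix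

variable {ι Λ : Type*} [Fintype ι] [DecidableEq ι] [Fintype Λ] [DecidableEq Λ]
  {R : ι → ι → ι → ι → ℝ} {lam : Λ → ℝ} {Ξ : Λ → Matrix ι ι ℝ}

theorem rotationEnergy_nonneg (Ξ : Λ → Matrix ι ι ℝ) (lam : Λ → ℝ) (a : Λ) :
    0 ≤ rotationEnergy Ξ lam a :=
  Finset.sum_nonneg fun _ _ ↦ Finset.sum_nonneg fun _ _ ↦ by positivity

/-- The constant curvature tensor with sectional curvature one. -/
def unitCurvature (i j k l : ι) : ℝ := kron i k * kron j l - kron i l * kron j k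

theorem unitCurvature_bianchi (i j k l : ι) :
    unitCurvature i j k l + unitCurvature i k l j + unitCurvature i l j k = 0 := by
  have : ∀ a b : ι, kron a b = kron b a := fun a b ↦ by simp [kron, eq_comm]
  simp only [unitCurvature, this j k, this l j, this l k]
  ring

theorem sum_unitCurvature (j l : ι) :
    ∑ i, unitCurvature i j i l = ((Fintype.card ι : ℝ) - 1) * kron j l := by
  simp [unitCurvature, kron, Finset.sum_sub_distrib, eq_comm]
  split_ifs <;> simp

namespace IsBivectorEigenbasis

/-- By completeness the unit curvature tensor is the identity on bivectors, so subtracting a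
multiple keeps the eigenbasis and shifts the eigenvalues. This reduces the Einstein case to the
Ricci-flat one. -/
theorem sub_smul_unitCurvature (h : IsBivectorEigenbasis R lam Ξ) (m : ℝ) :
    IsBivectorEigenbasis (fun i j k l ↦ R i j k l - m * unitCurvature i j k l)
      (fun a ↦ lam a - m) Ξ where
  antisymm := h.antisymm
  complete := h.complete
  orthonormal := h.orthonormal
  decomp i j k l := by
    simp_rw [sub_mul, Finset.sum_sub_distrib, ← Finset.mul_sum, h.complete, ← h.decomp]
    rfl

theorem sum_rotationEnergy (h : IsBivectorEigenbasis R lam Ξ)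
    (hB : ∀ i j k l, R i j k l + R i k l j + R i l j k = 0) {m : ℝ}
    (hRic : ∀ j l, ∑ i, R i j i l = m * ((Fintype.card ι : ℝ) - 1) * kron j l) :
    ∑ a, rotationEnergy Ξ lam a =
      4 * ((Fintype.card ι : ℝ) - 1) * ∑ a, (lam a - m) ^ 2 := by
  have h1 := (h.sub_smul_unitCurvature m).sum_rotationEnergy_of_ricci_flat
    (fun i j k l ↦ by linear_combination hB i j k l - m * unitCurvature_bianchi i j k l)
    (fun j l ↦ by
      rw [Finset.sum_sub_distrib, ← Finset.mul_sum, sum_unitCurvature, hRic]; ring)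
  rw [← h1]
  exact Finset.sum_congr rfl fun a _ ↦ by simp [rotationEnergy]

theorem eq_unitCurvature (h : IsBivectorEigenbasis R lam Ξ)
    (hB : ∀ i j k l, R i j k l + R i k l j + R i l j k = 0) {m : ℝ}
    (hRic : ∀ j l, ∑ i, R i j i l = m * ((Fintype.card ι : ℝ) - 1) * kron j l)
    (hι : 1 < Fintype.card ι) (h0 : ∑ a, rotationEnergy Ξ lam a = 0) (i j k l : ι) :
    R i j k l = m * unitCurvature i j k l := by
  rw [h.sum_rotationEnergy hB hRic] at h0
  have hι' : (1 : ℝ) < Fintype.card ι := by exact_mod_cast hι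
  have h1 : ∑ a, (lam a - m) ^ 2 = 0 := by
    rcases mul_eq_zero.1 h0 with h2 | h2
    · linarith
    · exact h2
  have h2 : ∀ a, lam a = m := fun a ↦ by
    have := (Finset.sum_eq_zero_iff_of_nonneg fun a _ ↦ sq_nonneg (lam a - m)).1 h1 a
      (Finset.mem_univ a)
    exact sub_eq_zero.1 (pow_eq_zero_iff two_ne_zero |>.1 this)
  rw [h.decomp]
  simp_rw [h2, ← Finset.mul_sum, h.complete]
  rfl

end IsBivectorEigenbasis

/-- A bathtub principle. Write λ = t + (λ - t). Outside S the second part contributes nonnegatively;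
inside S its factor is nonpositive, so the largest admissible weight A/C is the worst case. The
remainder tA(1 - |S|/C) is nonnegative because t ≥ 0 and |S| ≤ C. -/
theorem sum_mul_ge_of_threshold {lam e : Λ → ℝ} {A C t : ℝ} (S : Finset Λ) (hC : 0 < C)
    (hS : (S.card : ℝ) ≤ C) (ht : 0 ≤ t) (hle : ∀ a ∈ S, lam a ≤ t) (hge : ∀ a ∉ S, t ≤ lam a)
    (he0 : ∀ a, 0 ≤ e a) (he : ∀ a, e a ≤ A / C) (hA : ∑ a, e a = A) :
    A / C * ∑ a ∈ S, lam a ≤ ∑ a, lam a * e a := by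
  have hA0 : 0 ≤ A := hA ▸ Finset.sum_nonneg fun a _ ↦ he0 a
  have h1 : ∑ a, lam a * e a = t * A + ∑ a, (lam a - t) * e a := by
    rw [← hA, Finset.mul_sum, ← Finset.sum_add_distrib]
    exact Finset.sum_congr rfl fun a _ ↦ by ring
  have h2 : ∑ a ∈ S, (lam a - t) * e a ≤ ∑ a, (lam a - t) * e a :=
    Finset.sum_le_sum_of_subset_of_nonneg (Finset.subset_univ _) fun a _ ha ↦
      mul_nonneg (sub_nonneg.2 (hge a ha)) (he0 a)
  have h3 : ∑ a ∈ S, (lam a - t) * (A / C) ≤ ∑ a ∈ S, (lam a - t) * e a :=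
    Finset.sum_le_sum fun a ha ↦
      mul_le_mul_of_nonpos_left (he a) (sub_nonpos.2 (hle a ha))
  have h4 : ∑ a ∈ S, (lam a - t) * (A / C) = A / C * ∑ a ∈ S, lam a - S.card * t * (A / C) := by
    rw [← Finset.sum_mul, Finset.sum_sub_distrib, Finset.sum_const, nsmul_eq_mul]
    ring
  have h5 : S.card * t * (A / C) ≤ t * A := by
    have : S.card * t * (A / C) ≤ C * t * (A / C) :=
      mul_le_mul_of_nonneg_right (mul_le_mul_of_nonneg_right hS ht) (by positivity)
    calc _ ≤ _ := this
      _ = t * A := by field_simp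
  linarith

/-- The expression is symmetric, so x ≤ y ≤ z may be assumed. Then y, z ≥ 0 and it equals (x + y)(y
- z)² + z(x - y)² + y(y - x)((z - x) + (z - y)), a sum of nonnegative terms. -/
theorem triple_nonneg {x y z : ℝ} (hxy : 0 ≤ x + y) (hyz : 0 ≤ y + z) (hxz : 0 ≤ x + z) :
    0 ≤ x * (y - z) ^ 2 + y * (z - x) ^ 2 + z * (x - y) ^ 2 := by
  have key : ∀ {x y z : ℝ}, 0 ≤ x + y → x ≤ y → y ≤ z →
      0 ≤ x * (y - z) ^ 2 + y * (z - x) ^ 2 + z * (x - y) ^ 2 := by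
    intro x y z hxy h1 h2
    have hy : 0 ≤ y := by linarith
    have hz : 0 ≤ z := by linarith
    nlinarith [mul_nonneg hxy (sq_nonneg (y - z)), mul_nonneg hz (sq_nonneg (x - y)),
      mul_nonneg hy (mul_nonneg (sub_nonneg.2 h1) (by linarith : 0 ≤ (z - x) + (z - y)))]
  rcases le_total x y with h1 | h1 <;> rcases le_total y z with h2 | h2 <;>
    rcases le_total x z with h3 | h3
  · exact key hxy h1 h2
  · exact key hxy h1 h2
  · linarith [key (x := x) (y := z) (z := y) hxz h3 h2]
  · linarith [key (x := z) (y := x) (z := y) (by linarith) h3 h1]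
  · linarith [key (x := y) (y := x) (z := z) (by linarith) h1 h3]
  · linarith [key (x := y) (y := z) (z := x) hyz h2 h3]
  · linarith [key (x := z) (y := y) (z := x) (by linarith) h2 h1]
  · linarith [key (x := z) (y := y) (z := x) (by linarith) h2 h1]

/-- In the decomposition used for `triple_nonneg` the coefficients x + y and z are now positive, so
both squares vanish and the three numbers coincide. -/
theorem triple_eq_zero {x y z : ℝ} (hxy : 0 < x + y) (hyz : 0 < y + z) (hxz : 0 < x + z)
    (h : x * (y - z) ^ 2 + y * (z - x) ^ 2 + z * (x - y) ^ 2 = 0) : y = z := by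
  have key : ∀ {x y z : ℝ}, 0 < x + y → x ≤ y → y ≤ z →
      x * (y - z) ^ 2 + y * (z - x) ^ 2 + z * (x - y) ^ 2 = 0 → x = y ∧ y = z := by
    intro x y z hxy h1 h2 h
    have hy : 0 < y := by linarith
    have hz : 0 < z := by linarith
    have t1 := mul_nonneg hxy.le (sq_nonneg (y - z))
    have t2 := mul_nonneg hz.le (sq_nonneg (x - y))
    have t3 := mul_nonneg hy.le (mul_nonneg (sub_nonneg.2 h1) (by linarith : 0 ≤ (z - x) + (z - y)))
    have s1 : (x + y) * (y - z) ^ 2 = 0 := by nlinarith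
    have s2 : z * (x - y) ^ 2 = 0 := by nlinarith
    have r1 := (mul_eq_zero.1 s1).resolve_left hxy.ne'
    have r2 := (mul_eq_zero.1 s2).resolve_left hz.ne'
    exact ⟨sub_eq_zero.1 (pow_eq_zero_iff two_ne_zero |>.1 r2),
      sub_eq_zero.1 (pow_eq_zero_iff two_ne_zero |>.1 r1)⟩
  rcases le_total x y with h1 | h1 <;> rcases le_total y z with h2 | h2 <;>
    rcases le_total x z with h3 | h3
  · exact (key hxy h1 h2 h).2
  · exact (key hxy h1 h2 h).2
  · exact (key (x := x) (y := z) (z := y) hxz h3 h2 (by linarith)).2.symm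
  · have := key (x := z) (y := x) (z := y) (by linarith) h3 h1 (by linarith)
    linarith [this.1, this.2]
  · have := key (x := y) (y := x) (z := z) (by linarith) h1 h3 (by linarith)
    linarith [this.1, this.2]
  · exact (key (x := y) (y := z) (z := x) hyz h2 h3 (by linarith)).1
  · exact (key (x := z) (y := y) (z := x) (by linarith) h2 h1 (by linarith)).1.symm
  · exact (key (x := z) (y := y) (z := x) (by linarith) h2 h1 (by linarith)).1.symm

/-- The quadratic curvature term of the Bochner formula for the curvature tensor itself. -/
def curvatureEnergy (Ξ : Λ → Matrix ι ι ℝ) (lam : Λ → ℝ) : ℝ :=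
  ∑ a, lam a * rotationEnergy Ξ lam a

namespace IsBivectorEigenbasis

theorem structureConst_eq_zero (h : IsBivectorEigenbasis R lam Ξ) {a b c : Λ}
    (habc : a = b ∨ b = c ∨ a = c) : structureConst Ξ a b c = 0 := by
  rcases habc with rfl | rfl | rfl
  · exact self_eq_neg.1 (h.structureConst_swap a a c)
  · exact self_eq_neg.1 (h.structureConst_swap_right a b b)
  · rw [h.structureConst_cycle, h.structureConst_cycle]
    exact self_eq_neg.1 (h.structureConst_swap a a b)

/-- Cyclic invariance of the structure constants lets the weight λ sit on any of the three indices;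
the three resulting expressions are added. -/
theorem three_mul_curvatureEnergy (h : IsBivectorEigenbasis R lam Ξ) :
    3 * curvatureEnergy Ξ lam = ∑ a, ∑ b, ∑ c, structureConst Ξ a b c ^ 2 *
      (lam a * (lam b - lam c) ^ 2 + lam b * (lam c - lam a) ^ 2 + lam c * (lam a - lam b) ^ 2) := by
  have e0 : curvatureEnergy Ξ lam =
      ∑ a, ∑ b, ∑ c, structureConst Ξ a b c ^ 2 * (lam a * (lam b - lam c) ^ 2) := by
    simp_rw [curvatureEnergy, rotationEnergy, Finset.mul_sum]
    exact Finset.sum_congr rfl fun i _ ↦ Finset.sum_congr rfl fun j _ ↦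
      Finset.sum_congr rfl fun k _ ↦ by ring
  have e1 : curvatureEnergy Ξ lam =
      ∑ a, ∑ b, ∑ c, structureConst Ξ a b c ^ 2 * (lam c * (lam a - lam b) ^ 2) := by
    rw [e0, sum_rotate₃]
    simp_rw [fun a b c ↦ h.structureConst_cycle c a b]
  have e2 : curvatureEnergy Ξ lam =
      ∑ a, ∑ b, ∑ c, structureConst Ξ a b c ^ 2 * (lam b * (lam c - lam a) ^ 2) := by
    rw [e1, sum_rotate₃]
    simp_rw [fun a b c ↦ h.structureConst_cycle c a b]
  simp_rw [mul_add, Finset.sum_add_distrib]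
  rw [← e0, ← e1, ← e2]
  ring

theorem term_nonneg (h : IsBivectorEigenbasis R lam Ξ) (hl : ∀ a b, a ≠ b → 0 ≤ lam a + lam b)
    (a b c : Λ) : 0 ≤ structureConst Ξ a b c ^ 2 *
      (lam a * (lam b - lam c) ^ 2 + lam b * (lam c - lam a) ^ 2 + lam c * (lam a - lam b) ^ 2) := by
  -- The pair hypothesis speaks only of distinct indices; the other terms carry a vanishing
  -- structure constant.
  by_cases habc : a = b ∨ b = c ∨ a = c
  · simp [h.structureConst_eq_zero habc]
  · push Not at habc
    exact mul_nonneg (sq_nonneg _)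
      (triple_nonneg (hl _ _ habc.1) (hl _ _ habc.2.1) (hl _ _ habc.2.2))

theorem curvatureEnergy_nonneg_of_pair (h : IsBivectorEigenbasis R lam Ξ)
    (hl : ∀ a b, a ≠ b → 0 ≤ lam a + lam b) : 0 ≤ curvatureEnergy Ξ lam := by
  have h1 := h.three_mul_curvatureEnergy
  have h2 := Finset.sum_nonneg fun a (_ : a ∈ Finset.univ) ↦
    Finset.sum_nonneg fun b (_ : b ∈ Finset.univ) ↦
    Finset.sum_nonneg fun c (_ : c ∈ Finset.univ) ↦ h.term_nonneg hl a b c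
  linarith

theorem rotationEnergy_eq_zero_of_pair (h : IsBivectorEigenbasis R lam Ξ)
    (hl : ∀ a b, a ≠ b → 0 < lam a + lam b) (h0 : curvatureEnergy Ξ lam = 0) (a : Λ) :
    rotationEnergy Ξ lam a = 0 := by
  have h1 := h.three_mul_curvatureEnergy
  rw [h0, mul_zero] at h1
  have hnn := h.term_nonneg fun a b hab ↦ (hl a b hab).le
  have h2 := (Finset.sum_eq_zero_iff_of_nonneg fun a _ ↦ Finset.sum_nonneg fun b _ ↦
    Finset.sum_nonneg fun c _ ↦ hnn a b c).1 h1.symm a (Finset.mem_univ a)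
  refine Finset.sum_eq_zero fun b hb ↦ Finset.sum_eq_zero fun c hc ↦ ?_
  have h3 := (Finset.sum_eq_zero_iff_of_nonneg fun b _ ↦
    Finset.sum_nonneg fun c _ ↦ hnn a b c).1 h2 b hb
  have h4 := (Finset.sum_eq_zero_iff_of_nonneg fun c _ ↦ hnn a b c).1 h3 c hc
  by_cases habc : a = b ∨ b = c ∨ a = c
  · simp [h.structureConst_eq_zero habc]
  · push Not at habc
    rcases mul_eq_zero.1 h4 with h5 | h5
    · rw [h5, zero_mul]
    · rw [triple_eq_zero (hl _ _ habc.1) (hl _ _ habc.2.1) (hl _ _ habc.2.2) h5]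
      simp

end IsBivectorEigenbasis

variable {N : ℕ}

/-- The sum of the `k` lowest values of a monotone family. -/
def lowestSum (lam : Fin N → ℝ) (k : ℕ) : ℝ := ∑ a with a.val < k, lam a

theorem lowestSum_two_le {lam : Fin N → ℝ} (hmono : Monotone lam) {a b : Fin N} (hab : a ≠ b) :
    lowestSum lam 2 ≤ lam a + lam b := by
  wlog hlt : a < b generalizing a b
  · rw [add_comm]
    exact this hab.symm (lt_of_le_of_ne (not_lt.1 hlt) hab.symm)
  have hN : 1 < N := by have := b.2; have : a.val < b.val := hlt; omega
  have e : (Finset.univ.filter fun a : Fin N ↦ a.val < 2) = {⟨0, by omega⟩, ⟨1, hN⟩} := by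
    ext x
    simp [Fin.ext_iff]
    omega
  rw [lowestSum, e, Finset.sum_pair (by simp [Fin.ext_iff])]
  have hab' : a.val < b.val := hlt
  exact add_le_add (hmono (Fin.le_def.2 (Nat.zero_le _))) (hmono (Fin.le_def.2 (by simp; omega)))

/-- The rotation energies are weights with total 4(n-1)S, each at most 8S, that is at most the total
divided by C = (n-1)/2. The bathtub principle applies to the k ≤ C lowest eigenvalues, with the
largest of them as threshold. -/
theorem IsBivectorEigenbasis.curvatureEnergy_ge {lam : Fin N → ℝ} {Ξ : Fin N → Matrix ι ι ℝ}
    (h : IsBivectorEigenbasis R lam Ξ) (hmono : Monotone lam)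
    (hB : ∀ i j k l, R i j k l + R i k l j + R i l j k = 0) {m : ℝ}
    (hRic : ∀ j l, ∑ i, R i j i l = m * ((Fintype.card ι : ℝ) - 1) * kron j l)
    (hι : 1 < Fintype.card ι) {k : ℕ} (hk : 2 * k ≤ Fintype.card ι - 1)
    (hl : 0 ≤ lowestSum lam k) (hk0 : 0 < k) :
    (∑ a, rotationEnergy Ξ lam a) / (((Fintype.card ι : ℝ) - 1) / 2) * lowestSum lam k ≤
      curvatureEnergy Ξ lam := by
  have hι' : (1 : ℝ) < Fintype.card ι := by exact_mod_cast hι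
  have hk' : (k : ℝ) ≤ ((Fintype.card ι : ℝ) - 1) / 2 := by
    have : ((2 * k : ℕ) : ℝ) ≤ ((Fintype.card ι - 1 : ℕ) : ℝ) := by exact_mod_cast hk
    rw [Nat.cast_sub hι.le] at this
    push_cast at this
    linarith
  set S : Finset (Fin N) := Finset.univ.filter fun a ↦ a.val < k with hSdef
  have hcard : S.card ≤ k := by
    have : S.card ≤ (Finset.range k).card :=
      Finset.card_le_card_of_injOn (fun a ↦ a.val) (fun a ha ↦ by simpa [S] using ha)
        fun a _ b _ hab ↦ Fin.ext hab
    simpa using this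
  rcases Nat.eq_zero_or_pos N with rfl | hN
  · simp [curvatureEnergy]
  have hne : S.Nonempty := ⟨⟨0, hN⟩, by simp [S, hk0]⟩
  obtain ⟨t, htS, ht⟩ := S.exists_max_image lam hne
  refine sum_mul_ge_of_threshold S (t := lam t) (by linarith)
    (le_trans (by exact_mod_cast hcard) hk') ?_ ht ?_ (rotationEnergy_nonneg Ξ lam) ?_ rfl
  -- The threshold is at least the average of the lowest eigenvalues, hence nonnegative.
  · have h1 : lowestSum lam k ≤ S.card • lam t := Finset.sum_le_card_nsmul _ _ _ ht
    rw [nsmul_eq_mul] at h1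
    have h2 : (0 : ℝ) < S.card := by exact_mod_cast hne.card_pos
    exact nonneg_of_mul_nonneg_right (hl.trans h1) h2
  · intro a ha
    have h1 : t.val < k := by simpa [S] using htS
    have h2 : ¬ a.val < k := by simpa [S] using ha
    exact hmono (Fin.le_def.2 (by omega))
  · intro a
    rw [h.sum_rotationEnergy hB hRic]
    refine (h.rotationEnergy_le a m).trans (le_of_eq ?_)
    have : (Fintype.card ι : ℝ) - 1 ≠ 0 := by linarith
    field_simp
    ring

theorem IsBivectorEigenbasis.curvatureEnergy_nonneg {lam : Fin N → ℝ} {Ξ : Fin N → Matrix ι ι ℝ}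
    (h : IsBivectorEigenbasis R lam Ξ) (hmono : Monotone lam)
    (hB : ∀ i j k l, R i j k l + R i k l j + R i l j k = 0) {m : ℝ}
    (hRic : ∀ j l, ∑ i, R i j i l = m * ((Fintype.card ι : ℝ) - 1) * kron j l)
    (hι : 4 ≤ Fintype.card ι)
    (h4 : Fintype.card ι = 4 → 0 ≤ lowestSum lam 2)
    (h5 : 5 ≤ Fintype.card ι → 0 ≤ lowestSum lam ((Fintype.card ι - 1) / 2)) :
    0 ≤ curvatureEnergy Ξ lam := by
  have hι' : (4 : ℝ) ≤ Fintype.card ι := by exact_mod_cast hι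
  rcases hι.eq_or_lt with h' | h'
  · exact h.curvatureEnergy_nonneg_of_pair fun a b hab ↦
      (h4 h'.symm).trans (lowestSum_two_le hmono hab)
  · refine le_trans ?_ (h.curvatureEnergy_ge hmono hB hRic (by omega)
      (by omega) (h5 h') (by omega))
    have := Finset.sum_nonneg fun a (_ : a ∈ Finset.univ) ↦ rotationEnergy_nonneg Ξ lam a
    exact mul_nonneg (div_nonneg this (by linarith)) (h5 h')

/-- Zero energy kills all rotation energies: for n = 4 term by term in the symmetrized sum, for n ≥
5 because a positive multiple of their total bounds the energy from below. -/
theorem IsBivectorEigenbasis.eq_unitCurvature_of_pos {lam : Fin N → ℝ} {Ξ : Fin N → Matrix ι ι ℝ}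
    (h : IsBivectorEigenbasis R lam Ξ) (hmono : Monotone lam)
    (hB : ∀ i j k l, R i j k l + R i k l j + R i l j k = 0) {m : ℝ}
    (hRic : ∀ j l, ∑ i, R i j i l = m * ((Fintype.card ι : ℝ) - 1) * kron j l)
    (hι : 4 ≤ Fintype.card ι)
    (h4 : Fintype.card ι = 4 → 0 < lowestSum lam 2)
    (h5 : 5 ≤ Fintype.card ι → 0 < lowestSum lam ((Fintype.card ι - 1) / 2))
    (h0 : curvatureEnergy Ξ lam = 0) (i j k l : ι) :
    R i j k l = m * unitCurvature i j k l := by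
  have hι' : (4 : ℝ) ≤ Fintype.card ι := by exact_mod_cast hι
  refine h.eq_unitCurvature hB hRic (by omega) ?_ i j k l
  rcases hι.eq_or_lt with h' | h'
  · exact Finset.sum_eq_zero fun a _ ↦ h.rotationEnergy_eq_zero_of_pair
      (fun a b hab ↦ (h4 h'.symm).trans_le (lowestSum_two_le hmono hab)) h0 a
  · have h1 := h.curvatureEnergy_ge hmono hB hRic (by omega) (k := (Fintype.card ι - 1) / 2)
      (by omega) (h5 h').le (by omega)
    rw [h0] at h1
    have h2 := Finset.sum_nonneg fun a (_ : a ∈ Finset.univ) ↦ rotationEnergy_nonneg Ξ lam a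
    by_contra h3
    exact absurd h1 (not_le.2 (mul_pos (div_pos (lt_of_le_of_ne h2 (Ne.symm h3)) (by linarith))
      (h5 h')))

end CurvatureEnergy

end RiemannianGeometry

end

noncomputable section

namespace RiemannianGeometry

/-! ### The derivation action of matrices on four-tensors -/

section TensorAction

variable {ι A : Type*} [Fintype ι] [CommRing A]

/-- The action of a matrix on a four-tensor by derivations. -/
def act (L : ι → ι → A) (T : ι → ι → ι → ι → A) (i j k l : ι) : A :=
  ∑ p, L i p * T p j k l + ∑ p, L j p * T i p k l + ∑ p, L k p * T i j p l + ∑ p, L l p * T i j k p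

theorem sum_mul_sum_comm (L L' : ι → A) (T : ι → ι → A) :
    ∑ p, L p * ∑ q, L' q * T p q = ∑ q, L' q * ∑ p, L p * T p q := by
  simp only [Finset.mul_sum]
  rw [Finset.sum_comm]
  exact Finset.sum_congr rfl fun _ _ ↦ Finset.sum_congr rfl fun _ _ ↦ by ring

theorem sum_mul_sum_assoc {κ : Type*} [Fintype κ] (L : κ → A) (M : κ → ι → A) (t : ι → A) :
    ∑ p, L p * ∑ q, M p q * t q = ∑ q, (∑ p, L p * M p q) * t q := by
  simp only [Finset.mul_sum, Finset.sum_mul]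
  rw [Finset.sum_comm]
  exact Finset.sum_congr rfl fun _ _ ↦ Finset.sum_congr rfl fun _ _ ↦ by ring

theorem act_sub (L L' : ι → ι → A) (T : ι → ι → ι → ι → A) (i j k l : ι) :
    act (fun i j ↦ L i j - L' i j) T i j k l = act L T i j k l - act L' T i j k l := by
  simp only [act, sub_mul, Finset.sum_sub_distrib]
  ring

theorem act_sub_right (L : ι → ι → A) (T T' : ι → ι → ι → ι → A) (i j k l : ι) :
    act L (fun i j k l ↦ T i j k l - T' i j k l) i j k l = act L T i j k l - act L T' i j k l := by
  simp only [act, mul_sub, Finset.sum_sub_distrib]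
  ring

theorem act_sum {κ : Type*} [Fintype κ] (c : κ → A) (L : κ → ι → ι → A)
    (T : ι → ι → ι → ι → A) (i j k l : ι) :
    act (fun i j ↦ ∑ q, c q * L q i j) T i j k l = ∑ q, c q * act (L q) T i j k l := by
  have e : ∀ (t : ι → A) (x : ι), ∑ p, (∑ q, c q * L q x p) * t p =
      ∑ q, c q * ∑ p, L q x p * t p := fun t x ↦ (sum_mul_sum_assoc c (fun q p ↦ L q x p) t).symm
  simp only [act, mul_add, Finset.sum_add_distrib, e]

/-- Contributions where the two matrices hit different slots cancel, which is the role of the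
`sum_mul_sum_comm` summands; on a common slot they compose to a matrix commutator. -/
theorem act_commutator (L L' : ι → ι → A) (T : ι → ι → ι → ι → A) (i j k l : ι) :
    act L (act L' T) i j k l - act L' (act L T) i j k l =
      act (fun i j ↦ ∑ p, L i p * L' p j - ∑ p, L' i p * L p j) T i j k l := by
  rw [act_sub]
  simp only [act, mul_add, Finset.sum_add_distrib]
  linear_combination
    sum_mul_sum_assoc (L i) L' (fun q ↦ T q j k l) - sum_mul_sum_assoc (L' i) L (fun q ↦ T q j k l)
    + sum_mul_sum_assoc (L j) L' (fun q ↦ T i q k l) - sum_mul_sum_assoc (L' j) L (fun q ↦ T i q k l)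
    + sum_mul_sum_assoc (L k) L' (fun q ↦ T i j q l) - sum_mul_sum_assoc (L' k) L (fun q ↦ T i j q l)
    + sum_mul_sum_assoc (L l) L' (fun q ↦ T i j k q) - sum_mul_sum_assoc (L' l) L (fun q ↦ T i j k q)
    + sum_mul_sum_comm (L i) (L' j) (fun p q ↦ T p q k l)
    + sum_mul_sum_comm (L i) (L' k) (fun p q ↦ T p j q l)
    + sum_mul_sum_comm (L i) (L' l) (fun p q ↦ T p j k q)
    + sum_mul_sum_comm (L j) (L' i) (fun p q ↦ T q p k l)
    + sum_mul_sum_comm (L j) (L' k) (fun p q ↦ T i p q l)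
    + sum_mul_sum_comm (L j) (L' l) (fun p q ↦ T i p k q)
    + sum_mul_sum_comm (L k) (L' i) (fun p q ↦ T q j p l)
    + sum_mul_sum_comm (L k) (L' j) (fun p q ↦ T i q p l)
    + sum_mul_sum_comm (L k) (L' l) (fun p q ↦ T i j p q)
    + sum_mul_sum_comm (L l) (L' i) (fun p q ↦ T q j k p)
    + sum_mul_sum_comm (L l) (L' j) (fun p q ↦ T i q k p)
    + sum_mul_sum_comm (L l) (L' k) (fun p q ↦ T i j q p)

/-- The inner product of two four-tensors. -/
def inner₄ (S T : ι → ι → ι → ι → A) : A := ∑ i, ∑ j, ∑ k, ∑ l, S i j k l * T i j k l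

theorem sum_antisymm_pairing {L : ι → ι → A} (hL : ∀ i j, L i j = -L j i) (S T : ι → A) :
    ∑ i, (∑ p, L i p * S p) * T i = -∑ i, S i * ∑ p, L i p * T p := by
  simp only [Finset.mul_sum, Finset.sum_mul, ← Finset.sum_neg_distrib]
  rw [Finset.sum_comm]
  exact Finset.sum_congr rfl fun i _ ↦ Finset.sum_congr rfl fun p _ ↦ by rw [hL p i]; ring

theorem sum_comm₁₄ {κ κ' : Type*} [Fintype κ] [Fintype κ'] (f : ι → κ → κ → κ' → A) :
    ∑ i, ∑ j, ∑ k, ∑ l, f i j k l = ∑ j, ∑ k, ∑ l, ∑ i, f i j k l := by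
  rw [Finset.sum_comm]
  refine Finset.sum_congr rfl fun j _ ↦ ?_
  rw [Finset.sum_comm]
  refine Finset.sum_congr rfl fun k _ ↦ ?_
  rw [Finset.sum_comm]

/-- Antisymmetric matrices are infinitesimal rotations, hence skew-adjoint on tensors. Each slot is
treated by moving its sum innermost. -/
theorem inner₄_act {L : ι → ι → A} (hL : ∀ i j, L i j = -L j i) (S T : ι → ι → ι → ι → A) :
    inner₄ (act L S) T = -inner₄ S (act L T) := by
  have pair := sum_antisymm_pairing hL
  have s1 : ∑ i, ∑ j, ∑ k, ∑ l, (∑ p, L i p * S p j k l) * T i j k l =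
      -∑ i, ∑ j, ∑ k, ∑ l, S i j k l * ∑ p, L i p * T p j k l := by
    rw [sum_comm₁₄, sum_comm₁₄ (fun i j k l ↦ S i j k l * ∑ p, L i p * T p j k l)]
    simp only [← Finset.sum_neg_distrib]
    refine Finset.sum_congr rfl fun j _ ↦ Finset.sum_congr rfl fun k _ ↦
      Finset.sum_congr rfl fun l _ ↦ ?_
    rw [pair (S · j k l) (T · j k l), Finset.sum_neg_distrib]
  have s2 : ∑ i, ∑ j, ∑ k, ∑ l, (∑ p, L j p * S i p k l) * T i j k l =
      -∑ i, ∑ j, ∑ k, ∑ l, S i j k l * ∑ p, L j p * T i p k l := by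
    rw [← Finset.sum_neg_distrib]
    refine Finset.sum_congr rfl fun i _ ↦ ?_
    rw [sum_rotate₃, sum_rotate₃ (fun j k l ↦ S i j k l * ∑ p, L j p * T i p k l)]
    simp only [← Finset.sum_neg_distrib]
    refine Finset.sum_congr rfl fun j _ ↦ Finset.sum_congr rfl fun k _ ↦ ?_
    rw [pair (S i · j k) (T i · j k), Finset.sum_neg_distrib]
  have s3 : ∑ i, ∑ j, ∑ k, ∑ l, (∑ p, L k p * S i j p l) * T i j k l =
      -∑ i, ∑ j, ∑ k, ∑ l, S i j k l * ∑ p, L k p * T i j p l := by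
    rw [← Finset.sum_neg_distrib]
    refine Finset.sum_congr rfl fun i _ ↦ ?_
    rw [← Finset.sum_neg_distrib]
    refine Finset.sum_congr rfl fun j _ ↦ ?_
    rw [Finset.sum_comm, Finset.sum_comm (f := fun k l ↦ S i j k l * ∑ p, L k p * T i j p l),
      ← Finset.sum_neg_distrib]
    exact Finset.sum_congr rfl fun l _ ↦ pair (S i j · l) (T i j · l)
  have s4 : ∑ i, ∑ j, ∑ k, ∑ l, (∑ p, L l p * S i j k p) * T i j k l =
      -∑ i, ∑ j, ∑ k, ∑ l, S i j k l * ∑ p, L l p * T i j k p := by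
    simp only [← Finset.sum_neg_distrib (f := fun i ↦ ∑ j, _)]
    simp only [← Finset.sum_neg_distrib]
    refine Finset.sum_congr rfl fun i _ ↦ Finset.sum_congr rfl fun j _ ↦
      Finset.sum_congr rfl fun k _ ↦ ?_
    rw [pair (S i j k ·) (T i j k ·), Finset.sum_neg_distrib]
  simp only [inner₄, act, add_mul, mul_add, Finset.sum_add_distrib]
  linear_combination s1 + s2 + s3 + s4

theorem act_derivation [Algebra ℝ A] (D : Derivation ℝ A A) (L : ι → ι → A)
    (T : ι → ι → ι → ι → A) (i j k l : ι) :
    D (act L T i j k l) = act (fun i j ↦ D (L i j)) T i j k l +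
      act L (fun i j k l ↦ D (T i j k l)) i j k l := by
  simp only [act, map_add, map_sum, Derivation.leibniz, smul_eq_mul, Finset.sum_add_distrib]
  simp only [mul_comm (D _)]
  simp only [mul_comm (T _ _ _ _) (D _)]
  ring

end TensorAction

end RiemannianGeometry

end

/-! ### Torsion-free metric connections in a frame: Ricci and Bianchi identities -/

noncomputable section

namespace RiemannianGeometry

/-- The algebra of a torsion-free metric connection in an orthonormal frame: the derivations `D i`
along the frame fields, acting on a ring of functions, and the connection coefficients `Γ i j k`. -/
structure FrameConnection (ι A : Type*) [Fintype ι] [CommRing A] [Algebra ℝ A] where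
  /-- The derivative along the frame fields. -/
  D : ι → Derivation ℝ A A
  /-- The connection coefficients `⟪∇_{E i} (E j), E k⟫`. -/
  Γ : ι → ι → ι → A
  -- Metric compatibility is `antisymm`; vanishing torsion is `commutator`, where [E_i, E_j] has
  -- components Γ_ijk - Γ_jik. The Jacobi identity of the frame fields is a separate axiom, since
  -- nothing forces the `D k` to be linearly independent over `A`.
  antisymm : ∀ i j k, Γ i j k = -Γ i k j
  commutator : ∀ i j f, D i (D j f) - D j (D i f) = ∑ k, (Γ i j k - Γ j i k) * D k f
  jacobi : ∀ m i j p,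
    D m (Γ i j p - Γ j i p) + ∑ q, (Γ i j q - Γ j i q) * (Γ m q p - Γ q m p) +
    (D i (Γ j m p - Γ m j p) + ∑ q, (Γ j m q - Γ m j q) * (Γ i q p - Γ q i p)) +
    (D j (Γ m i p - Γ i m p) + ∑ q, (Γ m i q - Γ i m q) * (Γ j q p - Γ q j p)) = 0

namespace FrameConnection

variable {ι A : Type*} [Fintype ι] [CommRing A] [Algebra ℝ A] (F : FrameConnection ι A)

/-- The structure functions of the frame. -/
def bracket (i j k : ι) : A := F.Γ i j k - F.Γ j i k

/-- The curvature endomorphism of the frame connection, as a matrix. -/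
def curvMatrix (a b i k : ι) : A :=
  F.D a (F.Γ b i k) - F.D b (F.Γ a i k)
    - (∑ q, F.Γ a i q * F.Γ b q k - ∑ q, F.Γ b i q * F.Γ a q k)
    - ∑ q, F.bracket a b q * F.Γ q i k

/-- The components of the `(0, 4)` curvature tensor. -/
def curv (a b k l : ι) : A := F.curvMatrix a b l k

/-- The covariant derivative of a four-tensor in the direction of a frame field. -/
def nabla (m : ι) (T : ι → ι → ι → ι → A) (i j k l : ι) : A :=
  F.D m (T i j k l) - act (F.Γ m) T i j k l

/-- The second covariant derivative of a four-tensor. -/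
def nabla₂ (a b : ι) (T : ι → ι → ι → ι → A) (i j k l : ι) : A :=
  F.nabla a (F.nabla b T) i j k l - ∑ p, F.Γ a b p * F.nabla p T i j k l

theorem bracket_swap (i j k : ι) : F.bracket i j k = -F.bracket j i k := by
  simp [bracket]

/-- The Ricci identity. -/
theorem nabla₂_commutator (a b : ι) (T : ι → ι → ι → ι → A) (i j k l : ι) :
    F.nabla₂ a b T i j k l - F.nabla₂ b a T i j k l =
      -act (F.curvMatrix a b) T i j k l := by
  have h1 : act (F.curvMatrix a b) T i j k l =
      act (fun i k ↦ F.D a (F.Γ b i k)) T i j k l - act (fun i k ↦ F.D b (F.Γ a i k)) T i j k l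
      - (act (F.Γ a) (act (F.Γ b) T) i j k l - act (F.Γ b) (act (F.Γ a) T) i j k l)
      - ∑ q, F.bracket a b q * act (F.Γ q) T i j k l := by
    rw [act_commutator, ← act_sum, ← act_sub, ← act_sub, ← act_sub]
    rfl
  have h2 := F.commutator a b (T i j k l)
  have h3 : ∑ p, F.Γ a b p * F.nabla p T i j k l - ∑ p, F.Γ b a p * F.nabla p T i j k l =
      ∑ p, F.bracket a b p * F.D p (T i j k l) - ∑ q, F.bracket a b q * act (F.Γ q) T i j k l := by
    simp only [← Finset.sum_sub_distrib, nabla, bracket]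
    exact Finset.sum_congr rfl fun p _ ↦ by ring
  -- Antisymmetrized in a and b, the two mixed terms cancel; only the commutator of derivatives, the
  -- derivatives of Γ and the commutator of the Γ-actions survive.
  have h4 : ∀ a b, F.nabla a (F.nabla b T) i j k l = F.D a (F.D b (T i j k l))
      - act (fun i k ↦ F.D a (F.Γ b i k)) T i j k l
      - act (F.Γ b) (fun i j k l ↦ F.D a (T i j k l)) i j k l
      - act (F.Γ a) (fun i j k l ↦ F.D b (T i j k l)) i j k l
      + act (F.Γ a) (act (F.Γ b) T) i j k l := by
    intro a b
    have e : F.nabla b T = fun i j k l ↦ F.D b (T i j k l) - act (F.Γ b) T i j k l := rfl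
    rw [nabla, e, act_sub_right, map_sub, act_derivation]
    ring
  change _ = ∑ p, F.bracket a b p * F.D p (T i j k l) at h2
  rw [nabla₂, nabla₂, h4, h4, h1]
  linear_combination h2 - h3

theorem curv_swap_left (a b k l : ι) : F.curv a b k l = -F.curv b a k l := by
  simp only [curv, curvMatrix, F.bracket_swap a b, neg_mul, Finset.sum_neg_distrib]
  ring

theorem curv_swap_right (a b k l : ι) : F.curv a b k l = -F.curv a b l k := by
  have e1 : ∀ a b, ∑ q, F.Γ a l q * F.Γ b q k = ∑ q, F.Γ b k q * F.Γ a q l := fun a b ↦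
    Finset.sum_congr rfl fun q _ ↦ by rw [F.antisymm a l q, F.antisymm b q k]; ring
  have e2 : ∑ q, F.bracket a b q * F.Γ q l k = -∑ q, F.bracket a b q * F.Γ q k l := by
    rw [← Finset.sum_neg_distrib]
    exact Finset.sum_congr rfl fun q _ ↦ by rw [F.antisymm q l k]; ring
  simp only [curv, curvMatrix, e1, e2, F.antisymm b l k, F.antisymm a l k, map_neg]
  ring

/-- For a torsion-free connection the first Bianchi identity is the Jacobi identity of the frame
fields. -/
theorem curv_bianchi (a b l k : ι) :
    F.curv a b k l + F.curv b l k a + F.curv l a k b = 0 := by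
  have hJ := F.jacobi a b l k
  simp only [map_sub, mul_sub, sub_mul, Finset.sum_sub_distrib] at hJ
  simp only [curv, curvMatrix, bracket, sub_mul, Finset.sum_sub_distrib]
  linear_combination hJ

/-- The octahedron argument: four instances of the first Bianchi identity combined with both
antisymmetries. It yields twice the symmetry; the factor is cancelled once 2 is given as invertible.
-/
theorem curv_pair (i j k l : ι) : 2 * F.curv i j k l = 2 * F.curv k l i j := by
  have s := F.curv_swap_left
  have r := F.curv_swap_right
  have b1 := F.curv_bianchi i j l k
  have b2 := F.curv_bianchi j k l i
  have b3 := F.curv_bianchi k i l j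
  have b4 := F.curv_bianchi i j k l
  have e1 : F.curv l i k j = F.curv i l j k := by rw [s, r, neg_neg]
  have e2 : F.curv l j i k = F.curv j l k i := by rw [s, r, neg_neg]
  have e3 : F.curv l k j i = F.curv k l i j := by rw [s, r, neg_neg]
  rw [e1] at b1
  rw [e2] at b2
  rw [e3] at b3
  rw [r i j l k, r j k l i, r k i l j] at b4
  linear_combination b1 - b2 - b3 - b4

/-- The differential Bianchi sum. -/
def bianchiSum (m i j k l : ι) : A :=
  F.nabla m F.curv i j k l + F.nabla i F.curv j m k l + F.nabla j F.curv m i k l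

/-- Entrywise derivative of a matrix of functions. -/
def matD (m : ι) (X : Matrix ι ι A) : Matrix ι ι A := X.map (F.D m)

theorem matD_mul (m : ι) (X Y : Matrix ι ι A) :
    F.matD m (X * Y) = F.matD m X * Y + X * F.matD m Y := by
  ext i j
  simp only [matD, Matrix.map_apply, Matrix.mul_apply, Matrix.add_apply, map_sum,
    Derivation.leibniz, smul_eq_mul, Finset.sum_add_distrib, mul_comm (F.D m _)]
  simp only [mul_comm _ (F.D m _)]
  ring

theorem matD_sub (m : ι) (X Y : Matrix ι ι A) : F.matD m (X - Y) = F.matD m X - F.matD m Y := by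
  ext i j; simp [matD]

theorem matD_sum_smul (m : ι) (c : ι → A) (X : ι → Matrix ι ι A) :
    F.matD m (∑ q, c q • X q) = ∑ q, F.D m (c q) • X q + ∑ q, c q • F.matD m (X q) := by
  ext i j
  simp only [matD, Matrix.map_apply, Matrix.sum_apply, Matrix.smul_apply, Matrix.add_apply,
    map_sum, Derivation.leibniz, smul_eq_mul, ← Finset.sum_add_distrib]
  exact Finset.sum_congr rfl fun _ _ ↦ by ring

/-- The connection matrix along a frame field. -/
def conn (m : ι) : Matrix ι ι A := Matrix.of (F.Γ m)

/-- The curvature matrix. -/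
def curvM (a b : ι) : Matrix ι ι A := Matrix.of (F.curvMatrix a b)

theorem curvM_eq (a b : ι) : F.curvM a b = F.matD a (F.conn b) - F.matD b (F.conn a)
    - (F.conn a * F.conn b - F.conn b * F.conn a) - ∑ q, F.bracket a b q • F.conn q := by
  ext i k
  simp [curvM, conn, matD, curvMatrix, Matrix.mul_apply, Matrix.sum_apply]

/-- Read as a matrix in the last two indices, the curvature is acted on there by a commutator. This
puts the second Bianchi identity into a matrix ring. -/
theorem nabla_curv (m i j k l : ι) :
    F.nabla m F.curv i j k l =
      (F.matD m (F.curvM i j) - (F.conn m * F.curvM i j - F.curvM i j * F.conn m)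
        - ∑ p, F.Γ m i p • F.curvM p j - ∑ p, F.Γ m j p • F.curvM i p) l k := by
  have e : ∑ p, F.Γ m k p * F.curvMatrix i j l p = -∑ p, F.curvMatrix i j l p * F.Γ m p k := by
    rw [← Finset.sum_neg_distrib]
    exact Finset.sum_congr rfl fun p _ ↦ by rw [F.antisymm m k p]; ring
  simp only [nabla, act, curv, curvM, conn, matD, Matrix.sub_apply, Matrix.map_apply,
    Matrix.mul_apply, Matrix.sum_apply, Matrix.smul_apply, Matrix.of_apply, smul_eq_mul, e]
  ring

theorem matD_commutator (i j : ι) (X : Matrix ι ι A) :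
    F.matD i (F.matD j X) - F.matD j (F.matD i X) = ∑ p, F.bracket i j p • F.matD p X := by
  ext a b
  simpa [matD, Matrix.sum_apply, bracket] using F.commutator i j (X a b)

theorem curvM_swap (i j : ι) : F.curvM i j = -F.curvM j i := by
  ext a b
  exact F.curv_swap_left i j b a

/-- The differential Bianchi identity. -/
theorem bianchiSum_eq_zero (m i j k l : ι) : F.bianchiSum m i j k l = 0 := by
  have hJ : ∀ m i j, ∑ q, F.D m (F.bracket i j q) • F.conn q
      + ∑ p, F.bracket i j p • ∑ q, F.bracket m p q • F.conn q =
      ∑ q, (F.D m (F.bracket i j q) + ∑ p, F.bracket i j p * F.bracket m p q) • F.conn q := by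
    intro m i j
    simp only [Finset.smul_sum, add_smul, Finset.sum_add_distrib, Finset.sum_smul, smul_smul]
    rw [Finset.sum_comm (f := fun p q ↦ (F.bracket i j p * F.bracket m p q) • F.conn q)]
  -- Cyclically summed, the coefficients of the connection matrices form the Jacobi expression.
  have hJ0 : ∑ q, (F.D m (F.bracket i j q) + ∑ p, F.bracket i j p * F.bracket m p q) • F.conn q
      + ∑ q, (F.D i (F.bracket j m q) + ∑ p, F.bracket j m p * F.bracket i p q) • F.conn q
      + ∑ q, (F.D j (F.bracket m i q) + ∑ p, F.bracket m i p * F.bracket j p q) • F.conn q = 0 := by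
    simp only [← Finset.sum_add_distrib, ← add_smul]
    refine Finset.sum_eq_zero fun q _ ↦ ?_
    have := F.jacobi m i j q
    simp only [bracket]
    rw [this, zero_smul]
  have hcomm : ∀ m i j, F.matD m (F.curvM i j) - (F.conn m * F.curvM i j - F.curvM i j * F.conn m) =
      F.matD m (F.matD i (F.conn j)) - F.matD m (F.matD j (F.conn i))
      - (F.matD m (F.conn i) * F.conn j + F.conn i * F.matD m (F.conn j)
        - (F.matD m (F.conn j) * F.conn i + F.conn j * F.matD m (F.conn i)))
      - (F.conn m * (F.matD i (F.conn j) - F.matD j (F.conn i)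
          - (F.conn i * F.conn j - F.conn j * F.conn i))
        - (F.matD i (F.conn j) - F.matD j (F.conn i)
          - (F.conn i * F.conn j - F.conn j * F.conn i)) * F.conn m)
      - (∑ q, F.D m (F.bracket i j q) • F.conn q
        + ∑ p, F.bracket i j p • (F.matD m (F.conn p)
          - (F.conn m * F.conn p - F.conn p * F.conn m))) := by
    intro m i j
    rw [F.curvM_eq i j]
    simp only [matD_sub, matD_mul, matD_sum_smul, mul_sub, sub_mul, Finset.mul_sum,
      Finset.sum_mul, smul_sub, Finset.sum_sub_distrib, Matrix.mul_smul, Matrix.smul_mul]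
    abel
  -- The curvature formula trades the derivative of `conn p` along m for that of `conn m` along p.
  -- The curvature terms so created cancel the Γ-terms of ∇ in the first two slots, the derivatives
  -- along p match the commutators of derivatives, and the double brackets feed the Jacobi sum.
  have hB : ∀ m i j, ∑ p, F.bracket i j p • (F.matD m (F.conn p)
          - (F.conn m * F.conn p - F.conn p * F.conn m)) =
      ∑ p, F.bracket i j p • F.matD p (F.conn m) + ∑ p, F.bracket i j p • F.curvM m p +
      ∑ p, F.bracket i j p • ∑ q, F.bracket m p q • F.conn q := by
    intro m i j
    simp only [← Finset.sum_add_distrib, ← smul_add]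
    refine Finset.sum_congr rfl fun p _ ↦ ?_
    rw [F.curvM_eq m p]
    congr 1
    abel
  have hΓ : ∀ m i j, ∑ p, F.bracket i j p • F.curvM m p =
      ∑ p, F.Γ i j p • F.curvM m p + ∑ p, F.Γ j i p • F.curvM p m := by
    intro m i j
    rw [← Finset.sum_add_distrib]
    refine Finset.sum_congr rfl fun p _ ↦ ?_
    rw [F.curvM_swap p m, bracket, sub_smul, smul_neg, sub_eq_add_neg]
  have key : (F.matD m (F.curvM i j) - (F.conn m * F.curvM i j - F.curvM i j * F.conn m)
        - ∑ p, F.Γ m i p • F.curvM p j - ∑ p, F.Γ m j p • F.curvM i p) +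
      (F.matD i (F.curvM j m) - (F.conn i * F.curvM j m - F.curvM j m * F.conn i)
        - ∑ p, F.Γ i j p • F.curvM p m - ∑ p, F.Γ i m p • F.curvM j p) +
      (F.matD j (F.curvM m i) - (F.conn j * F.curvM m i - F.curvM m i * F.conn j)
        - ∑ p, F.Γ j m p • F.curvM p i - ∑ p, F.Γ j i p • F.curvM m p) = 0 := by
    have hsw : ∀ m i j, ∑ p, F.Γ m i p • F.curvM p j = -∑ p, F.Γ m i p • F.curvM j p := by
      intro m i j
      rw [← Finset.sum_neg_distrib]
      exact Finset.sum_congr rfl fun p _ ↦ by rw [F.curvM_swap p j, smul_neg]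
    rw [hcomm, hcomm, hcomm, hB, hB, hB, hΓ, hΓ, hΓ, ← F.matD_commutator,
      ← F.matD_commutator, ← F.matD_commutator]
    rw [← hJ m i j, ← hJ i j m, ← hJ j m i] at hJ0
    simp only [hsw]
    simp only [mul_sub, sub_mul, mul_assoc]
    rw [← neg_eq_zero] at hJ0
    rw [← hJ0]
    abel
  rw [bianchiSum, nabla_curv, nabla_curv, nabla_curv, ← Matrix.add_apply, ← Matrix.add_apply, key]
  rfl

end FrameConnection

end RiemannianGeometry

end

noncomputable section

namespace RiemannianGeometry

/-! ### The Bochner formula for Einstein connections -/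

namespace FrameConnection

variable {ι A : Type*} [Fintype ι] [CommRing A] [Algebra ℝ A] (F : FrameConnection ι A)

theorem nabla₂_eq (a b : ι) (T : ι → ι → ι → ι → A) (i j k l : ι) :
    F.nabla₂ a b T i j k l = F.D a (F.nabla b T i j k l) - act (F.Γ a) (F.nabla b T) i j k l
      - ∑ p, F.Γ a b p * F.nabla p T i j k l := rfl

/-- The covariant derivative of the second Bianchi identity: every Γ-correction is again a Bianchi
sum. -/
theorem nabla₂_bianchi (a m i j k l : ι) :
    F.nabla₂ a m F.curv i j k l + F.nabla₂ a i F.curv j m k l + F.nabla₂ a j F.curv m i k l = 0 := by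
  have h : F.nabla₂ a m F.curv i j k l + F.nabla₂ a i F.curv j m k l
      + F.nabla₂ a j F.curv m i k l = F.D a (F.bianchiSum m i j k l)
      - ∑ p, F.Γ a m p * F.bianchiSum p i j k l - ∑ p, F.Γ a i p * F.bianchiSum m p j k l
      - ∑ p, F.Γ a j p * F.bianchiSum m i p k l - ∑ p, F.Γ a k p * F.bianchiSum m i j p l
      - ∑ p, F.Γ a l p * F.bianchiSum m i j k p := by
    simp only [nabla₂_eq, act, bianchiSum, map_add, mul_add,
      Finset.sum_add_distrib]
    ring
  rw [h]
  simp [bianchiSum_eq_zero]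

set_option linter.unusedSectionVars false

variable [Invertible (2 : A)]

theorem curv_pair_symm (i j k l : ι) : F.curv i j k l = F.curv k l i j := by
  have := congrArg (fun x ↦ ⅟(2 : A) * x) (F.curv_pair i j k l)
  simpa using this

theorem nabla_curv_pair_symm (m i j k l : ι) :
    F.nabla m F.curv i j k l = F.nabla m F.curv k l i j := by
  simp only [nabla, act, F.curv_pair_symm i j k l]
  simp only [fun p ↦ F.curv_pair_symm p j k l, fun p ↦ F.curv_pair_symm i p k l,
    fun p ↦ F.curv_pair_symm i j p l, fun p ↦ F.curv_pair_symm i j k p]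
  ring

theorem nabla_curv_swap_left (m i j k l : ι) :
    F.nabla m F.curv i j k l = -F.nabla m F.curv j i k l := by
  simp only [nabla, act, F.curv_swap_left i j k l]
  simp only [fun p ↦ F.curv_swap_left p j k l, fun p ↦ F.curv_swap_left i p k l,
    fun p ↦ F.curv_swap_left i j p l, fun p ↦ F.curv_swap_left i j k p, mul_neg,
    Finset.sum_neg_distrib, map_neg]
  ring

/-- An antisymmetric matrix pairs to zero with a symmetric one. Through this, contractions commute
with covariant differentiation. -/
theorem sum_sum_antisymm_eq_zero (a : ι) (X : ι → ι → A) :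
    ∑ m, ∑ p, F.Γ a m p * (X m p + X p m) = 0 := by
  have h : ∑ m, ∑ p, F.Γ a m p * (X m p + X p m) =
      -∑ m, ∑ p, F.Γ a m p * (X m p + X p m) := by
    conv_lhs => rw [Finset.sum_comm]
    simp only [← Finset.sum_neg_distrib]
    exact Finset.sum_congr rfl fun i _ ↦ Finset.sum_congr rfl fun j _ ↦ by
      rw [F.antisymm a j i]; ring
  have h2 : 2 * ∑ m, ∑ p, F.Γ a m p * (X m p + X p m) = 0 := by linear_combination h
  have := congrArg (fun x ↦ ⅟(2 : A) * x) h2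
  simpa using this

variable [DecidableEq ι]

theorem sum_nabla_curv_trace {c : A} (hc : ∀ a, F.D a c = 0)
    (hE : ∀ j l, ∑ i, F.curv i j i l = if j = l then c else 0) (a j l : ι) :
    ∑ m, F.nabla a F.curv m j m l = 0 := by
  have h : ∑ m, F.nabla a F.curv m j m l = F.D a (∑ m, F.curv m j m l)
      - ∑ p, F.Γ a j p * ∑ m, F.curv m p m l - ∑ p, F.Γ a l p * ∑ m, F.curv m j m p
      - ∑ m, ∑ p, F.Γ a m p * (F.curv m j p l + F.curv p j m l) := by
    simp only [nabla, act, Finset.sum_sub_distrib, Finset.sum_add_distrib, map_sum, mul_add,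
      Finset.mul_sum]
    rw [Finset.sum_comm (f := fun m p ↦ F.Γ a j p * F.curv m p m l),
      Finset.sum_comm (f := fun m p ↦ F.Γ a l p * F.curv m j m p)]
    ring
  rw [h, F.sum_sum_antisymm_eq_zero a fun m p ↦ F.curv m j p l]
  simp only [hE]
  have : F.D a (if j = l then c else 0) = 0 := by split_ifs <;> simp [hc]
  rw [this]
  simp [F.antisymm a j l]

/-- Contracted second Bianchi identity: the divergence of the curvature is the antisymmetrized
derivative of the Ricci tensor, which vanishes for an Einstein metric. -/
theorem sum_nabla_curv_div {c : A} (hc : ∀ a, F.D a c = 0)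
    (hE : ∀ j l, ∑ i, F.curv i j i l = if j = l then c else 0) (j k l : ι) :
    ∑ m, F.nabla m F.curv m j k l = 0 := by
  have h : ∀ m, F.nabla m F.curv m j k l =
      F.nabla k F.curv m l m j - F.nabla l F.curv m k m j := by
    intro m
    have := F.bianchiSum_eq_zero m k l m j
    rw [bianchiSum, ← F.nabla_curv_pair_symm, F.nabla_curv_swap_left k l m] at this
    linear_combination this
  simp only [h, Finset.sum_sub_distrib, F.sum_nabla_curv_trace hc hE, sub_zero]

theorem sum_nabla₂_curv_div {c : A} (hc : ∀ a, F.D a c = 0)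
    (hE : ∀ j l, ∑ i, F.curv i j i l = if j = l then c else 0) (a j k l : ι) :
    ∑ m, F.nabla₂ a m F.curv m j k l = 0 := by
  have h : ∑ m, F.nabla₂ a m F.curv m j k l = F.D a (∑ m, F.nabla m F.curv m j k l)
      - ∑ p, F.Γ a j p * ∑ m, F.nabla m F.curv m p k l
      - ∑ p, F.Γ a k p * ∑ m, F.nabla m F.curv m j p l
      - ∑ p, F.Γ a l p * ∑ m, F.nabla m F.curv m j k p
      - ∑ m, ∑ p, F.Γ a m p * (F.nabla m F.curv p j k l + F.nabla p F.curv m j k l) := by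
    simp only [nabla₂_eq, act, Finset.sum_sub_distrib,
      Finset.sum_add_distrib, map_sum, mul_add, Finset.mul_sum]
    rw [Finset.sum_comm (f := fun m p ↦ F.Γ a j p * F.nabla m F.curv m p k l),
      Finset.sum_comm (f := fun m p ↦ F.Γ a k p * F.nabla m F.curv m j p l),
      Finset.sum_comm (f := fun m p ↦ F.Γ a l p * F.nabla m F.curv m j k p)]
    ring
  rw [h, F.sum_sum_antisymm_eq_zero a fun m p ↦ F.nabla m F.curv p j k l]
  simp [F.sum_nabla_curv_div hc hE]

theorem nabla₂_curv_swap_left (a m i j k l : ι) :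
    F.nabla₂ a m F.curv i j k l = -F.nabla₂ a m F.curv j i k l := by
  simp only [nabla₂_eq, act, F.nabla_curv_swap_left _ i j k l]
  simp only [fun p ↦ F.nabla_curv_swap_left m p j k l, fun p ↦ F.nabla_curv_swap_left m i p k l,
    fun p ↦ F.nabla_curv_swap_left m i j p l, fun p ↦ F.nabla_curv_swap_left m i j k p, mul_neg,
    Finset.sum_neg_distrib, map_neg]
  ring

/-- On an Einstein manifold the Laplacian of the curvature tensor is quadratic in curvature. -/
theorem laplacian_curv {c : A} (hc : ∀ a, F.D a c = 0)
    (hE : ∀ j l, ∑ i, F.curv i j i l = if j = l then c else 0) (i j k l : ι) :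
    ∑ m, F.nabla₂ m m F.curv i j k l =
      ∑ m, (act (F.curvMatrix m i) F.curv j m k l + act (F.curvMatrix m j) F.curv m i k l) := by
  -- The Bianchi identity replaces the inner derivative along m by derivatives along i and j; the
  -- Ricci identity then moves these outside, leaving derivatives of the divergence and the
  -- quadratic terms.
  have h : ∀ m, F.nabla₂ m m F.curv i j k l = F.nabla₂ i m F.curv m j k l
      - F.nabla₂ j m F.curv m i k l
      + (act (F.curvMatrix m i) F.curv j m k l + act (F.curvMatrix m j) F.curv m i k l) := by
    intro m
    linear_combination F.nabla₂_bianchi m m i j k l - F.nabla₂_commutator m i F.curv j m k l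
      - F.nabla₂_commutator m j F.curv m i k l - F.nabla₂_curv_swap_left i m m j k l
  simp only [h, Finset.sum_add_distrib, Finset.sum_sub_distrib, F.sum_nabla₂_curv_div hc hE]
  ring

theorem derivation_inner₄ (m : ι) (S T : ι → ι → ι → ι → A) :
    F.D m (inner₄ S T) = inner₄ (F.nabla m S) T + inner₄ S (F.nabla m T) := by
  have h1 := inner₄_act (F.antisymm m) S T
  have h2 : F.D m (inner₄ S T) = inner₄ (fun i j k l ↦ F.D m (S i j k l)) T +
      inner₄ S (fun i j k l ↦ F.D m (T i j k l)) := by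
    simp only [inner₄, map_sum, Derivation.leibniz, smul_eq_mul, ← Finset.sum_add_distrib]
    exact Finset.sum_congr rfl fun i _ ↦ Finset.sum_congr rfl fun j _ ↦
      Finset.sum_congr rfl fun k _ ↦ Finset.sum_congr rfl fun l _ ↦ by ring
  have h3 : inner₄ (F.nabla m S) T = inner₄ (fun i j k l ↦ F.D m (S i j k l)) T -
      inner₄ (act (F.Γ m) S) T := by
    simp only [inner₄, nabla, sub_mul, Finset.sum_sub_distrib]
  have h4 : inner₄ S (F.nabla m T) = inner₄ S (fun i j k l ↦ F.D m (T i j k l)) -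
      inner₄ S (act (F.Γ m) T) := by
    simp only [inner₄, nabla, mul_sub, Finset.sum_sub_distrib]
  rw [h2, h3, h4, h1]
  ring

/-- The Laplacian on functions, in the frame. -/
def laplacian (f : A) : A := ∑ m, (F.D m (F.D m f) - ∑ p, F.Γ m m p * F.D p f)

theorem inner₄_comm (S T : ι → ι → ι → ι → A) : inner₄ S T = inner₄ T S := by
  simp only [inner₄, mul_comm]

theorem inner₄_sub_right (S T T' : ι → ι → ι → ι → A) :
    inner₄ S (fun i j k l ↦ T i j k l - T' i j k l) = inner₄ S T - inner₄ S T' := by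
  simp only [inner₄, mul_sub, Finset.sum_sub_distrib]

theorem inner₄_sum_right {κ : Type*} [Fintype κ] (S : ι → ι → ι → ι → A) (c : κ → A)
    (T : κ → ι → ι → ι → ι → A) :
    inner₄ S (fun i j k l ↦ ∑ p, c p * T p i j k l) = ∑ p, c p * inner₄ S (T p) := by
  simp only [inner₄, Finset.mul_sum]
  rw [sum_comm₄]
  exact Finset.sum_congr rfl fun p _ ↦ Finset.sum_congr rfl fun i _ ↦
    Finset.sum_congr rfl fun j _ ↦ Finset.sum_congr rfl fun k _ ↦
    Finset.sum_congr rfl fun l _ ↦ mul_left_comm _ _ _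

theorem laplacian_inner₄ (T : ι → ι → ι → ι → A) :
    F.laplacian (inner₄ T T) = 2 * ∑ m, inner₄ (F.nabla m T) (F.nabla m T) +
      2 * inner₄ T (fun i j k l ↦ ∑ m, F.nabla₂ m m T i j k l) := by
  have h1 : ∀ m, F.D m (inner₄ T T) = inner₄ T (F.nabla m T) + inner₄ T (F.nabla m T) := fun m ↦ by
    rw [F.derivation_inner₄, inner₄_comm (F.nabla m T)]
  have h2 : inner₄ T (fun i j k l ↦ ∑ m, F.nabla₂ m m T i j k l) =
      ∑ m, inner₄ T (F.nabla₂ m m T) := by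
    have := inner₄_sum_right T (fun _ : ι ↦ (1 : A)) fun m ↦ F.nabla₂ m m T
    simpa only [one_mul] using this
  have h3 : ∀ m, inner₄ T (F.nabla₂ m m T) = inner₄ T (F.nabla m (F.nabla m T)) -
      ∑ p, F.Γ m m p * inner₄ T (F.nabla p T) := by
    intro m
    rw [← inner₄_sum_right, ← inner₄_sub_right]
    rfl
  have h4 : ∀ m, F.D m (F.D m (inner₄ T T)) - ∑ p, F.Γ m m p * F.D p (inner₄ T T) =
      2 * inner₄ (F.nabla m T) (F.nabla m T) + 2 * inner₄ T (F.nabla₂ m m T) := by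
    intro m
    have h5 : ∑ p, F.Γ m m p * F.D p (inner₄ T T) =
        2 * ∑ p, F.Γ m m p * inner₄ T (F.nabla p T) := by
      rw [Finset.mul_sum]
      exact Finset.sum_congr rfl fun p _ ↦ by rw [h1]; ring
    rw [h5, h1, map_add, F.derivation_inner₄, h3]
    ring
  simp only [laplacian, h2, h4, Finset.sum_add_distrib, Finset.mul_sum]

/-- The Bochner formula for the curvature tensor of an Einstein metric. -/
theorem bochner {c : A} (hc : ∀ a, F.D a c = 0)
    (hE : ∀ j l, ∑ i, F.curv i j i l = if j = l then c else 0) :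
    F.laplacian (inner₄ F.curv F.curv) =
      2 * ∑ m, inner₄ (F.nabla m F.curv) (F.nabla m F.curv) +
      2 * inner₄ F.curv (fun i j k l ↦ ∑ m, (act (F.curvMatrix m i) F.curv j m k l
        + act (F.curvMatrix m j) F.curv m i k l)) := by
  simp only [laplacian_inner₄, F.laplacian_curv hc hE]

end FrameConnection

end RiemannianGeometry

end

noncomputable section

namespace RiemannianGeometry

/-! ### The quadratic curvature term in an eigenbasis -/

section Contraction

set_option linter.unusedSectionVars false

open Matrix

variable {ι Λ : Type*} [Fintype ι] [DecidableEq ι] [Fintype Λ] [DecidableEq Λ]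
  {R : ι → ι → ι → ι → ℝ} {lam : Λ → ℝ} {Ξ : Λ → Matrix ι ι ℝ}

namespace IsBivectorEigenbasis

theorem sum_mul_tensor_left (h : IsBivectorEigenbasis R lam Ξ) (X : Matrix ι ι ℝ) (m j k l : ι) :
    ∑ p, X m p * R p j k l = ∑ b, lam b * ((X * Ξ b) m j * Ξ b k l) := by
  simp only [h.decomp, Finset.mul_sum, Matrix.mul_apply, Finset.sum_mul]
  rw [Finset.sum_comm]
  exact Finset.sum_congr rfl fun b _ ↦ Finset.sum_congr rfl fun p _ ↦ by ring

theorem tensor_pair (h : IsBivectorEigenbasis R lam Ξ) (i j k l : ι) : R i j k l = R k l i j := by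
  rw [h.decomp, h.decomp]
  exact Finset.sum_congr rfl fun a _ ↦ by ring

theorem tensor_swap (h : IsBivectorEigenbasis R lam Ξ) (i j k l : ι) : R i j k l = -R j i k l := by
  rw [h.decomp, h.decomp, ← Finset.sum_neg_distrib]
  exact Finset.sum_congr rfl fun a _ ↦ by rw [h.apply_swap a i j]; ring

theorem mul_apply_swap (h : IsBivectorEigenbasis R lam Ξ) (a b : Λ) (i j : ι) :
    (Ξ a * Ξ b) i j = (Ξ b * Ξ a) j i := by
  have := congrFun (congrFun (transpose_mul (Ξ a) (Ξ b)) j) i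
  rw [h.antisymm, h.antisymm] at this
  simpa using this

/-- On R = ∑ λ_b Ξ_b ⊗ Ξ_b the derivation acts through both bivector factors by [Ξ_a, ·].
Antisymmetry of the structure constants in the last two indices merges the two contributions into
the factor λ_b - λ_c. -/
theorem act_eq (h : IsBivectorEigenbasis R lam Ξ) (a : Λ) (m j k l : ι) :
    act (Ξ a) R m j k l = ∑ b, ∑ c,
      structureConst Ξ a b c * (lam b - lam c) * (Ξ c m j * Ξ b k l) := by
  have e2 : ∑ p, Ξ a j p * R m p k l = -∑ b, lam b * ((Ξ a * Ξ b) j m * Ξ b k l) := by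
    rw [← h.sum_mul_tensor_left, ← Finset.sum_neg_distrib]
    exact Finset.sum_congr rfl fun p _ ↦ by rw [h.tensor_swap m p]; ring
  have e3 : ∑ p, Ξ a k p * R m j p l = ∑ b, lam b * ((Ξ a * Ξ b) k l * Ξ b m j) := by
    rw [← h.sum_mul_tensor_left]
    exact Finset.sum_congr rfl fun p _ ↦ by rw [h.tensor_pair m j]
  have e4 : ∑ p, Ξ a l p * R m j k p = -∑ b, lam b * ((Ξ a * Ξ b) l k * Ξ b m j) := by
    rw [← h.sum_mul_tensor_left, ← Finset.sum_neg_distrib]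
    exact Finset.sum_congr rfl fun p _ ↦ by rw [h.tensor_pair m j, h.tensor_swap k p]; ring
  have hc : ∀ b i j, (Ξ a * Ξ b) i j - (Ξ a * Ξ b) j i = ∑ c, structureConst Ξ a b c * Ξ c i j := by
    intro b i j
    have := congrFun (congrFun (h.commutator_expansion a b) i) j
    simp only [Matrix.sub_apply, Matrix.sum_apply, Matrix.smul_apply, smul_eq_mul] at this
    rw [← this, h.mul_apply_swap b a]
  have hsw : ∑ b, ∑ c, structureConst Ξ a b c * lam c * (Ξ c m j * Ξ b k l) =
      -∑ b, lam b * (((Ξ a * Ξ b) k l - (Ξ a * Ξ b) l k) * Ξ b m j) := by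
    rw [Finset.sum_comm, ← Finset.sum_neg_distrib]
    refine Finset.sum_congr rfl fun b _ ↦ ?_
    rw [hc, Finset.sum_mul, Finset.mul_sum, ← Finset.sum_neg_distrib]
    exact Finset.sum_congr rfl fun c _ ↦ by rw [h.structureConst_swap_right a c b]; ring
  have hst : ∑ b, ∑ c, structureConst Ξ a b c * lam b * (Ξ c m j * Ξ b k l) =
      ∑ b, lam b * (((Ξ a * Ξ b) m j - (Ξ a * Ξ b) j m) * Ξ b k l) := by
    refine Finset.sum_congr rfl fun b _ ↦ ?_
    rw [hc, Finset.sum_mul, Finset.mul_sum]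
    exact Finset.sum_congr rfl fun c _ ↦ by ring
  have : ∑ b, ∑ c, structureConst Ξ a b c * (lam b - lam c) * (Ξ c m j * Ξ b k l) =
      ∑ b, ∑ c, structureConst Ξ a b c * lam b * (Ξ c m j * Ξ b k l) -
      ∑ b, ∑ c, structureConst Ξ a b c * lam c * (Ξ c m j * Ξ b k l) := by
    simp only [← Finset.sum_sub_distrib]
    exact Finset.sum_congr rfl fun b _ ↦ Finset.sum_congr rfl fun c _ ↦ by ring
  change ∑ p, Ξ a m p * R p j k l + ∑ p, Ξ a j p * R m p k l + ∑ p, Ξ a k p * R m j p l +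
    ∑ p, Ξ a l p * R m j k p = _
  rw [this, hsw, hst, h.sum_mul_tensor_left, e2, e3, e4]
  simp only [sub_mul, mul_sub, Finset.sum_sub_distrib]
  ring

/-- Orthonormality reduces the left side to ∑ c_abc² · 2λ_b(λ_b - λ_c), and symmetrizing in b and c
produces the square. -/
theorem inner_slot_act (h : IsBivectorEigenbasis R lam Ξ) (a : Λ) :
    ∑ m, ∑ j, ∑ k, ∑ l, (∑ i, Ξ a m i * R i j k l) * act (Ξ a) R m j k l =
      rotationEnergy Ξ lam a := by
  have h1 : ∀ m j k l, (∑ i, Ξ a m i * R i j k l) * act (Ξ a) R m j k l =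
      ∑ d, ∑ b, ∑ c, lam d * (structureConst Ξ a b c * (lam b - lam c)) *
        (((Ξ a * Ξ d) m j * Ξ c m j) * (Ξ d k l * Ξ b k l)) := by
    intro m j k l
    rw [h.sum_mul_tensor_left, h.act_eq, Finset.sum_mul]
    refine Finset.sum_congr rfl fun d _ ↦ ?_
    rw [Finset.mul_sum]
    refine Finset.sum_congr rfl fun b _ ↦ ?_
    rw [Finset.mul_sum]
    exact Finset.sum_congr rfl fun c _ ↦ by ring
  have h2 : ∑ m, ∑ j, ∑ k, ∑ l, (∑ i, Ξ a m i * R i j k l) * act (Ξ a) R m j k l =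
      ∑ b, ∑ c, structureConst Ξ a b c ^ 2 * (2 * lam b * (lam b - lam c)) := by
    simp only [h1]
    rw [sum_comm₄]
    have h3 : ∀ d, ∑ m, ∑ j, ∑ k, ∑ l, ∑ b, ∑ c, lam d * (structureConst Ξ a b c * (lam b - lam c)) *
        (((Ξ a * Ξ d) m j * Ξ c m j) * (Ξ d k l * Ξ b k l)) =
        ∑ b, ∑ c, lam d * (structureConst Ξ a b c * (lam b - lam c)) *
          (structureConst Ξ a d c * if d = b then 2 else 0) := by
      intro d
      rw [sum_comm₄]
      refine Finset.sum_congr rfl fun b _ ↦ ?_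
      rw [sum_comm₄]
      refine Finset.sum_congr rfl fun c _ ↦ ?_
      simp only [← Finset.mul_sum, ← Finset.sum_mul, h.orthonormal]
      rfl
    simp only [h3]
    rw [Finset.sum_comm]
    refine Finset.sum_congr rfl fun b _ ↦ ?_
    rw [Finset.sum_comm]
    refine Finset.sum_congr rfl fun c _ ↦ ?_
    simp only [mul_ite, mul_zero, Finset.sum_ite_eq', Finset.mem_univ, if_true]
    ring
  rw [h2]
  have h4 := h.sum_sq_swap a fun b c ↦ 2 * lam b * (lam b - lam c)
  have h5 : 2 * rotationEnergy Ξ lam a =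
      ∑ b, ∑ c, structureConst Ξ a b c ^ 2 * (2 * lam b * (lam b - lam c)) +
      ∑ b, ∑ c, structureConst Ξ a b c ^ 2 * (2 * lam c * (lam c - lam b)) := by
    simp only [← Finset.sum_add_distrib, rotationEnergy, Finset.mul_sum]
    exact Finset.sum_congr rfl fun b _ ↦ Finset.sum_congr rfl fun c _ ↦ by ring
  linarith

theorem act_swap (h : IsBivectorEigenbasis R lam Ξ) (a : Λ) (i j k l : ι) :
    act (Ξ a) R i j k l = -act (Ξ a) R j i k l := by
  rw [h.act_eq, h.act_eq, ← Finset.sum_neg_distrib]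
  refine Finset.sum_congr rfl fun b _ ↦ ?_
  rw [← Finset.sum_neg_distrib]
  exact Finset.sum_congr rfl fun c _ ↦ by rw [h.apply_swap c i j]; ring

/-- The curvature endomorphism of the plane (m, i) is -∑ λ_a Ξ_a(m, i) Ξ_a, so the contraction
splits over a into λ_a times the single-slot pairings. The two summands agree after exchanging i and
j. -/
theorem inner₄_quadratic (h : IsBivectorEigenbasis R lam Ξ) :
    inner₄ R (fun i j k l ↦ ∑ m, (act (fun x p ↦ R m i p x) R j m k l
        + act (fun x p ↦ R m j p x) R m i k l)) = 2 * curvatureEnergy Ξ lam := by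
  have e : ∀ m i i' j' k l, act (fun x p ↦ R m i p x) R i' j' k l =
      ∑ a, (-(lam a * Ξ a m i)) * act (Ξ a) R i' j' k l := by
    intro m i i' j' k l
    have : (fun x p ↦ R m i p x) = fun x p ↦ ∑ a, (-(lam a * Ξ a m i)) * Ξ a x p := by
      ext x p
      rw [h.decomp]
      exact Finset.sum_congr rfl fun a _ ↦ by rw [h.apply_swap a p x]; ring
    rw [this]
    exact act_sum (fun a ↦ -(lam a * Ξ a m i)) (fun a x p ↦ Ξ a x p) R i' j' k l
  have h1 : ∑ i, ∑ j, ∑ k, ∑ l, R i j k l * ∑ m, act (fun x p ↦ R m j p x) R m i k l =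
      ∑ i, ∑ j, ∑ k, ∑ l, R i j k l * ∑ m, act (fun x p ↦ R m i p x) R j m k l := by
    rw [Finset.sum_comm]
    refine Finset.sum_congr rfl fun i _ ↦ Finset.sum_congr rfl fun j _ ↦
      Finset.sum_congr rfl fun k _ ↦ Finset.sum_congr rfl fun l _ ↦ ?_
    rw [h.tensor_swap, neg_mul, ← mul_neg, ← Finset.sum_neg_distrib]
    congr 1
    refine Finset.sum_congr rfl fun m _ ↦ ?_
    rw [e, e, ← Finset.sum_neg_distrib]
    exact Finset.sum_congr rfl fun a _ ↦ by rw [h.act_swap a m j]; ring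
  have h2 : ∑ i, ∑ j, ∑ k, ∑ l, R i j k l * ∑ m, act (fun x p ↦ R m i p x) R j m k l =
      curvatureEnergy Ξ lam := by
    have h3 : ∀ i j k l, R i j k l * ∑ m, act (fun x p ↦ R m i p x) R j m k l =
        ∑ a, lam a * ∑ m, (Ξ a m i * R i j k l) * act (Ξ a) R m j k l := by
      intro i j k l
      simp only [e, Finset.mul_sum]
      rw [Finset.sum_comm]
      exact Finset.sum_congr rfl fun a _ ↦ Finset.sum_congr rfl fun m _ ↦ by
        rw [h.act_swap a j m]; ring
    simp only [h3]
    rw [sum_comm₄, curvatureEnergy]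
    refine Finset.sum_congr rfl fun a _ ↦ ?_
    rw [← h.inner_slot_act a]
    simp only [← Finset.mul_sum]
    congr 1
    rw [sum_comm₁₄, sum_comm₁₄ (fun m j k l ↦ (∑ i, Ξ a m i * R i j k l) * act (Ξ a) R m j k l)]
    refine Finset.sum_congr rfl fun j _ ↦ Finset.sum_congr rfl fun k _ ↦
      Finset.sum_congr rfl fun l _ ↦ ?_
    rw [Finset.sum_comm]
    exact Finset.sum_congr rfl fun m _ ↦ by rw [Finset.sum_mul]
  simp only [inner₄, Finset.sum_add_distrib, mul_add]
  rw [h1, h2]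
  ring

end IsBivectorEigenbasis

end Contraction

end RiemannianGeometry

end

noncomputable section

namespace RiemannianGeometry

/-! ### The curvature operator on bivectors and its eigenbasis -/

section CurvatureOperator

variable {V : Type*} [NormedAddCommGroup V] [InnerProductSpace ℝ V] [FiniteDimensional ℝ V]
  {ι : Type*} [Fintype ι]

/-- The bivector `u ∧ v`. -/
def wedge (u v : V) : ⋀[ℝ]^2 V := exteriorPower.ιMulti ℝ 2 ![u, v]

theorem inner_wedge (u v z w : V) :
    inner ℝ (wedge u v) (wedge z w) =
      inner ℝ u z * inner ℝ v w - inner ℝ u w * inner ℝ v z := by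
  rw [wedge, wedge, exteriorPower.inner_ιMulti_ιMulti]
  simp [Matrix.det_fin_two]
  ring

theorem wedge_swap (u v : V) : wedge u v = -wedge v u := by
  refine ext_inner_right ℝ fun y ↦ ?_
  have h := (exteriorPower.ιMulti ℝ (M := V) 2).map_swap ![v, u] (i := 0) (j := 1) (by simp)
  have e : (![v, u] ∘ Equiv.swap (0 : Fin 2) 1) = ![u, v] := by
    ext i; fin_cases i <;> simp
  rw [e] at h
  rw [wedge, wedge, h]

theorem exteriorPower_two_apply {κ : Type*} [Fintype κ] [LinearOrder κ]
    (e : OrthonormalBasis κ ℝ V) (s : Set.powersetCard κ 2) :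
    e.exteriorPower 2 s = wedge (e (Set.powersetCard.ofFinEmbEquiv.symm s 0))
      (e (Set.powersetCard.ofFinEmbEquiv.symm s 1)) := by
  rw [← OrthonormalBasis.coe_toBasis, OrthonormalBasis.toBasis_exteriorPower,
    exteriorPower.coe_basis, exteriorPower.ιMulti_family, wedge]
  congr 1
  ext i
  fin_cases i <;> simp

/-- Two bilinear forms on bivectors agree if they agree on decomposable bivectors. -/
theorem linearMap_ext_wedge {S T : ⋀[ℝ]^2 V →ₗ[ℝ] ⋀[ℝ]^2 V}
    (h : ∀ u v z w : V,
      inner ℝ (S (wedge u v)) (wedge z w) = inner ℝ (T (wedge u v)) (wedge z w)) : S = T := by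
  set e := stdOrthonormalBasis ℝ V
  refine (e.exteriorPower 2).toBasis.ext fun s ↦ ?_
  refine InnerProductSpace.ext_inner_right_basis (e.exteriorPower 2).toBasis fun t ↦ ?_
  simp only [OrthonormalBasis.coe_toBasis, exteriorPower_two_apply, h]

theorem inner_curvatureOperator_basis (R : V → V → V → V → ℝ)
    (s t : Set.powersetCard (Fin (Module.finrank ℝ V)) 2) :
    let e := stdOrthonormalBasis ℝ V
    inner ℝ (curvatureOperator R (e.exteriorPower 2 s)) (e.exteriorPower 2 t) =
      R (e (Set.powersetCard.ofFinEmbEquiv.symm s 0))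
        (e (Set.powersetCard.ofFinEmbEquiv.symm s 1))
        (e (Set.powersetCard.ofFinEmbEquiv.symm t 0))
        (e (Set.powersetCard.ofFinEmbEquiv.symm t 1)) := by
  change inner ℝ (curvatureOperator R ((stdOrthonormalBasis ℝ V).exteriorPower 2 s))
    ((stdOrthonormalBasis ℝ V).exteriorPower 2 t) = _
  set e := stdOrthonormalBasis ℝ V with he
  have h : curvatureOperator R (e.exteriorPower 2 s) = _ :=
    (congrArg (curvatureOperator R)
      (congrFun (OrthonormalBasis.coe_toBasis (e.exteriorPower 2)) s).symm).trans
      ((e.exteriorPower 2).toBasis.constr_basis ℝ _ s)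
  rw [h, sum_inner]
  simp only [real_inner_smul_left, ← he, orthonormal_iff_ite.mp (e.exteriorPower 2).orthonormal,
    mul_ite, mul_one, mul_zero, Finset.sum_ite_eq', Finset.mem_univ, if_true]

/-- The operator on bivectors with components `r` in an orthonormal basis. -/
def bivectorOperator (b : OrthonormalBasis ι ℝ V) (r : ι → ι → ι → ι → ℝ) :
    ⋀[ℝ]^2 V →ₗ[ℝ] ⋀[ℝ]^2 V :=
  -- Ordered pairs (i, j) and (k, l) each count every basis bivector twice.
  ∑ i, ∑ j, ∑ k, ∑ l, (4⁻¹ * r i j k l) •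
    (innerₛₗ ℝ (wedge (b i) (b j))).smulRight (wedge (b k) (b l))

theorem inner_bivectorOperator (b : OrthonormalBasis ι ℝ V) (r : ι → ι → ι → ι → ℝ)
    (x y : ⋀[ℝ]^2 V) :
    inner ℝ (bivectorOperator b r x) y = ∑ i, ∑ j, ∑ k, ∑ l, 4⁻¹ * r i j k l *
      (inner ℝ (wedge (b i) (b j)) x * inner ℝ (wedge (b k) (b l)) y) := by
  simp [bivectorOperator, sum_inner, real_inner_smul_left, LinearMap.sum_apply, mul_assoc]

theorem isSymmetric_bivectorOperator (b : OrthonormalBasis ι ℝ V) {r : ι → ι → ι → ι → ℝ}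
    (hpair : ∀ i j k l, r i j k l = r k l i j) : (bivectorOperator b r).IsSymmetric := by
  intro x y
  rw [real_inner_comm _ x, inner_bivectorOperator, inner_bivectorOperator]
  have h : ∀ f : ι → ι → ι → ι → ℝ,
      ∑ i, ∑ j, ∑ k, ∑ l, f i j k l = ∑ k, ∑ l, ∑ i, ∑ j, f i j k l := fun f ↦ by
    rw [sum_comm₂ fun i j k ↦ ∑ l, f i j k l]
    exact Finset.sum_congr rfl fun k _ ↦ sum_comm₂ fun i j l ↦ f i j k l
  rw [h]
  refine Finset.sum_congr rfl fun i _ ↦ Finset.sum_congr rfl fun j _ ↦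
    Finset.sum_congr rfl fun k _ ↦ Finset.sum_congr rfl fun l _ ↦ ?_
  rw [hpair k l i j]
  ring

theorem sum_mul_antisymm {s : ι → ι → ℝ} (hs : ∀ i j, s i j = -s j i) (u v : ι → ℝ) :
    ∑ i, ∑ j, s i j * (u i * v j - v i * u j) = 2 * ∑ i, ∑ j, s i j * (u i * v j) := by
  have h : ∑ i, ∑ j, s i j * (v i * u j) = -∑ i, ∑ j, s i j * (u i * v j) := by
    rw [Finset.sum_comm]
    simp only [← Finset.sum_neg_distrib]
    refine Finset.sum_congr rfl fun i _ ↦ Finset.sum_congr rfl fun j _ ↦ ?_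
    rw [hs j i]; ring
  simp only [mul_sub, Finset.sum_sub_distrib, h]
  ring

theorem inner_bivectorOperator_wedge (b : OrthonormalBasis ι ℝ V) {r : ι → ι → ι → ι → ℝ}
    (hl : ∀ i j k l, r i j k l = -r j i k l) (hr : ∀ i j k l, r i j k l = -r i j l k)
    (u v z w : V) :
    inner ℝ (bivectorOperator b r (wedge u v)) (wedge z w) =
      ∑ i, ∑ j, ∑ k, ∑ l,
        inner ℝ (b i) u * inner ℝ (b j) v * inner ℝ (b k) z * inner ℝ (b l) w * r i j k l := by
  have h1 : ∀ i j, ∑ k, ∑ l, r i j k l * inner ℝ (wedge (b k) (b l)) (wedge z w) =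
      2 * ∑ k, ∑ l, r i j k l * (inner ℝ (b k) z * inner ℝ (b l) w) := fun i j ↦ by
    simp only [inner_wedge]
    exact sum_mul_antisymm (fun k l ↦ hr i j k l) (fun k ↦ inner ℝ (b k) z) fun l ↦ inner ℝ (b l) w
  have h2 := sum_mul_antisymm (s := fun i j ↦
    ∑ k, ∑ l, r i j k l * (inner ℝ (b k) z * inner ℝ (b l) w))
    (fun i j ↦ by
      simp only [← Finset.sum_neg_distrib]
      refine Finset.sum_congr rfl fun k _ ↦ Finset.sum_congr rfl fun l _ ↦ ?_
      rw [hl i j]; ring) (fun i ↦ inner ℝ (b i) u) fun j ↦ inner ℝ (b j) v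
  calc _ = 4⁻¹ * ∑ i, ∑ j, inner ℝ (wedge (b i) (b j)) (wedge u v) *
        ∑ k, ∑ l, r i j k l * inner ℝ (wedge (b k) (b l)) (wedge z w) := by
          rw [inner_bivectorOperator]
          simp only [Finset.mul_sum]
          refine Finset.sum_congr rfl fun i _ ↦ Finset.sum_congr rfl fun j _ ↦
            Finset.sum_congr rfl fun k _ ↦ Finset.sum_congr rfl fun l _ ↦ by ring
    _ = 2⁻¹ * ∑ i, ∑ j, (∑ k, ∑ l, r i j k l * (inner ℝ (b k) z * inner ℝ (b l) w)) *
        (inner ℝ (b i) u * inner ℝ (b j) v - inner ℝ (b i) v * inner ℝ (b j) u) := by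
          simp only [h1]
          simp only [inner_wedge]
          rw [Finset.mul_sum, Finset.mul_sum]
          refine Finset.sum_congr rfl fun i _ ↦ ?_
          rw [Finset.mul_sum, Finset.mul_sum]
          refine Finset.sum_congr rfl fun j _ ↦ by ring
    _ = _ := by
          rw [h2]
          rw [← mul_assoc, inv_mul_cancel₀ two_ne_zero, one_mul]
          simp only [Finset.sum_mul]
          refine Finset.sum_congr rfl fun i _ ↦ Finset.sum_congr rfl fun j _ ↦
            Finset.sum_congr rfl fun k _ ↦ Finset.sum_congr rfl fun l _ ↦ by ring

/-- `curvatureOperator` refers to the standard basis of V, the tensor calculus to a frame b. The two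
operators agree because both reproduce R on decomposable bivectors. -/
theorem curvatureOperator_eq_bivectorOperator (b : OrthonormalBasis ι ℝ V)
    {r : ι → ι → ι → ι → ℝ} {R : V → V → V → V → ℝ}
    (hl : ∀ i j k l, r i j k l = -r j i k l) (hr : ∀ i j k l, r i j k l = -r i j l k)
    (hR : ∀ u v z w, R u v z w = ∑ i, ∑ j, ∑ k, ∑ l,
      inner ℝ (b i) u * inner ℝ (b j) v * inner ℝ (b k) z * inner ℝ (b l) w * r i j k l) :
    curvatureOperator R = bivectorOperator b r := by
  set e := stdOrthonormalBasis ℝ V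
  refine (e.exteriorPower 2).toBasis.ext fun s ↦ ?_
  refine InnerProductSpace.ext_inner_right_basis (e.exteriorPower 2).toBasis fun t ↦ ?_
  rw [OrthonormalBasis.coe_toBasis, inner_curvatureOperator_basis, hR,
    exteriorPower_two_apply, exteriorPower_two_apply, inner_bivectorOperator_wedge b hl hr]

/-- Over ordered pairs the b_i ∧ b_j run, up to sign, twice through an orthonormal basis of Λ²V;
hence the factor 2 in Parseval's identity. -/
theorem sum_inner_wedge_mul (b : OrthonormalBasis ι ℝ V) (x y : ⋀[ℝ]^2 V) :
    ∑ i, ∑ j, inner ℝ x (wedge (b i) (b j)) * inner ℝ y (wedge (b i) (b j)) =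
      2 * inner ℝ x y := by
  let S : ⋀[ℝ]^2 V →ₗ[ℝ] ⋀[ℝ]^2 V :=
    ∑ i, ∑ j, (innerₛₗ ℝ (wedge (b i) (b j))).smulRight (wedge (b i) (b j))
  have hS : ∀ x y, inner ℝ (S x) y =
      ∑ i, ∑ j, inner ℝ x (wedge (b i) (b j)) * inner ℝ y (wedge (b i) (b j)) := fun x y ↦ by
    simp only [S, LinearMap.sum_apply, LinearMap.smulRight_apply, innerₛₗ_apply_apply, sum_inner,
      real_inner_smul_left]
    simp only [real_inner_comm]
  have h : S = (2 : ℝ) • LinearMap.id := linearMap_ext_wedge fun u v z w ↦ by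
    have p : ∀ u v : V, ∑ i, inner ℝ u (b i) * inner ℝ v (b i) = inner ℝ u v := fun u v ↦ by
      rw [← b.sum_inner_mul_inner u v]
      exact Finset.sum_congr rfl fun i _ ↦ by rw [real_inner_comm (b i) v]
    have q : ∀ a a' c c' : V, ∑ i, ∑ j, (inner ℝ a (b i) * inner ℝ a' (b i)) *
        (inner ℝ c (b j) * inner ℝ c' (b j)) = inner ℝ a a' * inner ℝ c c' :=
      fun a a' c c' ↦ by
        rw [← p a a', ← p c c', Finset.sum_mul_sum]
    rw [hS]
    simp only [inner_wedge, LinearMap.smul_apply, LinearMap.id_apply, real_inner_smul_left]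
    calc _ = ∑ i, ∑ j, ((inner ℝ u (b i) * inner ℝ z (b i)) * (inner ℝ v (b j) * inner ℝ w (b j))
          - (inner ℝ u (b i) * inner ℝ w (b i)) * (inner ℝ v (b j) * inner ℝ z (b j))
          - (inner ℝ v (b i) * inner ℝ z (b i)) * (inner ℝ u (b j) * inner ℝ w (b j))
          + (inner ℝ v (b i) * inner ℝ w (b i)) * (inner ℝ u (b j) * inner ℝ z (b j))) :=
          Finset.sum_congr rfl fun i _ ↦ Finset.sum_congr rfl fun j _ ↦ by ring
      _ = _ := by
        simp only [Finset.sum_add_distrib, Finset.sum_sub_distrib, q]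
        ring
  rw [← hS, h, LinearMap.smul_apply, LinearMap.id_apply, real_inner_smul_left]

theorem sum_take_ofFn {N : ℕ} (lam : Fin N → ℝ) (k : ℕ) :
    ((List.ofFn lam).take k).sum = lowestSum lam k :=
  List.sum_take_ofFn lam k

theorem exists_isBivectorEigenbasis [DecidableEq ι] (b : OrthonormalBasis ι ℝ V)
    {r : ι → ι → ι → ι → ℝ} {R : V → V → V → V → ℝ}
    (hl : ∀ i j k l, r i j k l = -r j i k l) (hr : ∀ i j k l, r i j k l = -r i j l k)
    (hpair : ∀ i j k l, r i j k l = r k l i j)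
    (hR : ∀ u v z w, R u v z w = ∑ i, ∑ j, ∑ k, ∑ l,
      inner ℝ (b i) u * inner ℝ (b j) v * inner ℝ (b k) z * inner ℝ (b l) w * r i j k l) :
    ∃ (N : ℕ) (lam : Fin N → ℝ) (Ξ : Fin N → Matrix ι ι ℝ),
      IsBivectorEigenbasis r lam Ξ ∧ Monotone lam ∧
      ∀ k, (((curvatureOperator R).charpoly.roots.sort (· ≤ ·)).take k).sum = lowestSum lam k := by
  have hT : (curvatureOperator R).IsSymmetric := by
    rw [curvatureOperator_eq_bivectorOperator b hl hr hR]
    exact isSymmetric_bivectorOperator b hpair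
  set N := Module.finrank ℝ (⋀[ℝ]^2 V) with hN
  set μ : Fin N → ℝ := hT.eigenvalues hN.symm
  -- The spectral theorem lists eigenvalues in decreasing order, so indices are reversed.
  set u := (hT.eigenvectorBasis hN.symm).reindex Fin.revPerm
  have hu : ∀ a, curvatureOperator R (u a) = μ a.rev • u a := fun a ↦ by
    simp only [u, OrthonormalBasis.reindex_apply]
    exact hT.apply_eigenvectorBasis hN.symm _
  have hmono : Monotone fun a : Fin N ↦ μ a.rev := fun a a' h ↦
    hT.eigenvalues_antitone hN.symm (Fin.rev_le_rev.mpr h)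
  have hb : ∀ i j : ι, inner ℝ (b i) (b j) = kron i j := fun i j ↦
    orthonormal_iff_ite.mp b.orthonormal i j
  refine ⟨N, fun a ↦ μ a.rev, fun a ↦ Matrix.of fun i j ↦ inner ℝ (u a) (wedge (b i) (b j)),
    ⟨fun a ↦ ?_, fun i j k l ↦ ?_, fun a a' ↦ ?_, fun i j k l ↦ ?_⟩, hmono, fun k ↦ ?_⟩
  · ext i j
    simp only [Matrix.transpose_apply, Matrix.neg_apply, Matrix.of_apply]
    rw [wedge_swap, inner_neg_right]
  · simp only [Matrix.of_apply]
    rw [← hb, ← hb, ← hb, ← hb, ← inner_wedge, ← u.sum_inner_mul_inner]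
    exact Finset.sum_congr rfl fun a _ ↦ by rw [real_inner_comm (u a)]
  · simp only [Matrix.of_apply]
    rw [sum_inner_wedge_mul, orthonormal_iff_ite.mp u.orthonormal]
    simp
  · have h1 : r i j k l = inner ℝ (curvatureOperator R (wedge (b i) (b j))) (wedge (b k) (b l)) := by
      rw [curvatureOperator_eq_bivectorOperator b hl hr hR, inner_bivectorOperator_wedge b hl hr]
      simp [hb, kron]
    simp only [Matrix.of_apply]
    rw [h1, ← u.sum_inner_mul_inner]
    refine Finset.sum_congr rfl fun a _ ↦ ?_
    rw [hT, hu, real_inner_smul_right, real_inner_comm (u a)]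
    ring
  · rw [← sum_take_ofFn, hT.roots_charpoly_eq_eigenvalues hN.symm]
    have h1 : Multiset.map (RCLike.ofReal ∘ hT.eigenvalues hN.symm) Finset.univ.val =
        ((List.ofFn fun a ↦ μ a.rev : List ℝ) : Multiset ℝ) := by
      rw [← Fin.univ_val_map]
      have h2 : (Finset.univ : Finset (Fin N)).val = Finset.univ.val.map Fin.revPerm :=
        (congrArg Finset.val (Finset.map_univ_equiv (Fin.revPerm (n := N)))).symm
      conv_lhs => rw [h2]
      rw [Multiset.map_map]
      rfl
    -- The reversed list is already increasing, so sorting the roots returns it unchanged.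
    rw [h1, Multiset.coe_sort, List.mergeSort_of_pairwise]
    simpa [List.sortedLE_iff_pairwise] using hmono.sortedLE_ofFn.pairwise

end CurvatureOperator

end RiemannianGeometry

end

noncomputable section

namespace RiemannianGeometry

/-! ### Smooth functions and vector fields on a set -/

section LocalCalculus

set_option linter.unusedSectionVars false

variable {E : Type*} [NormedAddCommGroup E] [NormedSpace ℝ E]
  [CompleteSpace E]
  {H : Type*} [TopologicalSpace H] {I : ModelWithCorners ℝ E H}
  {M : Type*} [TopologicalSpace M] [ChartedSpace H M] [IsManifold I ∞ M]
  {U : Set M}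

variable (I) in
/-- Smoothness of a function at all points of a set. -/
def SmoothFun (U : Set M) (f : M → ℝ) : Prop := ∀ y ∈ U, CMDiffAt ∞ f y

/-- Smoothness of a vector field at all points of a set. -/
def SmoothField (U : Set M) (X : Π x : M, TangentSpace I x) : Prop := ∀ y ∈ U, CMDiffAt ∞ (T% X) y

theorem SmoothFun.mdiff {f : M → ℝ} (hf : SmoothFun I U f) {y : M} (hy : y ∈ U) : MDiffAt f y :=
  (hf y hy).mdifferentiableAt (by simp)

theorem SmoothField.mdiff {X : Π x : M, TangentSpace I x} (hX : SmoothField U X) {y : M}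
    (hy : y ∈ U) : MDiffAt (T% X) y :=
  (hX y hy).mdifferentiableAt (by simp)

theorem SmoothFun.congr {f g : M → ℝ} (hU : IsOpen U) (hf : SmoothFun I U f)
    (h : ∀ y ∈ U, g y = f y) : SmoothFun I U g := fun y hy ↦
  (hf y hy).congr_of_eventuallyEq (Filter.eventually_of_mem (hU.mem_nhds hy) h)

theorem SmoothField.congr {X Y : Π x : M, TangentSpace I x} (hU : IsOpen U) (hX : SmoothField U X)
    (h : ∀ y ∈ U, Y y = X y) : SmoothField U Y := fun y hy ↦
  (hX y hy).congr_of_eventuallyEq (Filter.eventually_of_mem (hU.mem_nhds hy) fun z hz ↦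
    congrArg (TotalSpace.mk z) (h z hz))

theorem SmoothFun.const (c : ℝ) : SmoothFun I U (fun _ ↦ c) := fun _ _ ↦ contMDiffAt_const

theorem SmoothFun.add {f g : M → ℝ} (hf : SmoothFun I U f) (hg : SmoothFun I U g) :
    SmoothFun I U (fun y ↦ f y + g y) := fun y hy ↦ (hf y hy).add (hg y hy)

theorem SmoothFun.sub {f g : M → ℝ} (hf : SmoothFun I U f) (hg : SmoothFun I U g) :
    SmoothFun I U (fun y ↦ f y - g y) := fun y hy ↦ (hf y hy).sub (hg y hy)

theorem SmoothFun.mul {f g : M → ℝ} (hf : SmoothFun I U f) (hg : SmoothFun I U g) :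
    SmoothFun I U (fun y ↦ f y * g y) := fun y hy ↦ (hf y hy).mul (hg y hy)

theorem SmoothField.smul {f : M → ℝ} {X : Π x : M, TangentSpace I x} (hf : SmoothFun I U f)
    (hX : SmoothField U X) : SmoothField U (f • X) := fun y hy ↦
  (hf y hy).smul_section (hX y hy)

theorem SmoothField.sub {X Y : Π x : M, TangentSpace I x}
    (hX : SmoothField U X) (hY : SmoothField U Y) : SmoothField U (fun y ↦ X y - Y y) := fun y hy ↦
  (hX y hy).sub_section (hY y hy)

theorem SmoothField.sum {ι : Type*} {s : Finset ι} {X : ι → Π x : M, TangentSpace I x}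
    (hX : ∀ i, SmoothField U (X i)) : SmoothField U (fun y ↦ ∑ i ∈ s, X i y) := fun y hy ↦
  .sum_section fun i _ ↦ hX i y hy

theorem SmoothField.mlieBracket {X Y : Π x : M, TangentSpace I x}
    (hX : SmoothField U X) (hY : SmoothField U Y) : SmoothField U (mlieBracket I X Y) := fun y hy ↦ by
  have : IsManifold I (minSmoothness ℝ 2) M := by
    rw [minSmoothness_of_isRCLikeNormedField]
    infer_instance
  have : IsManifold I (((⊤ : ℕ∞) : WithTop ℕ∞) + 1) M := inferInstanceAs (IsManifold I ∞ M)
  exact ContMDiffAt.mlieBracket_vectorField (m := ⊤) (n := ⊤) (hX y hy) (hY y hy) (by simp)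

theorem mlieBracket_jacobi {X Y Z : Π x : M, TangentSpace I x} (hX : SmoothField U X)
    (hY : SmoothField U Y) (hZ : SmoothField U Z) {y : M} (hy : y ∈ U) :
    mlieBracket I X (mlieBracket I Y Z) y =
      mlieBracket I (mlieBracket I X Y) Z y + mlieBracket I Y (mlieBracket I X Z) y := by
  have : IsManifold I (minSmoothness ℝ 3) M := by
    rw [minSmoothness_of_isRCLikeNormedField]
    infer_instance
  have h2 : minSmoothness ℝ 2 ≤ ∞ := by
    rw [minSmoothness_of_isRCLikeNormedField]
    exact WithTop.coe_le_coe.mpr le_top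
  exact leibniz_identity_mlieBracket_apply ((hX y hy).of_le h2) ((hY y hy).of_le h2)
    ((hZ y hy).of_le h2)

end LocalCalculus

/-! ### Smoothness of derivatives and of the Levi-Civita connection -/

section RiemannianCalculus

set_option linter.unusedSectionVars false

variable {E : Type*} [NormedAddCommGroup E] [NormedSpace ℝ E] [FiniteDimensional ℝ E]
  [CompleteSpace E]
  {H : Type*} [TopologicalSpace H] {I : ModelWithCorners ℝ E H}
  {M : Type*} [TopologicalSpace M] [ChartedSpace H M] [IsManifold I ∞ M]
  [RiemannianBundle (fun x : M ↦ TangentSpace I x)]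
  [IsContMDiffRiemannianBundle I ∞ E (fun x : M ↦ TangentSpace I x)]
  {U : Set M}

theorem SmoothField.inner {X Y : Π x : M, TangentSpace I x}
    (hX : SmoothField U X) (hY : SmoothField U Y) :
    SmoothFun I U (fun y ↦ inner ℝ (X y) (Y y)) := fun y hy ↦
  ContMDiffAt.inner_bundle (F := E) (E := fun x : M ↦ TangentSpace I x) (b := id) (hX y hy) (hY y hy)

/-- An orthonormal frame of smooth vector fields on an open set. -/
structure IsOrthonormalFrameOn {ι : Type*} [Fintype ι] (e : ι → Π x : M, TangentSpace I x)
    (U : Set M) : Prop where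
  isOpen : IsOpen U
  smooth : ∀ i, SmoothField U (e i)
  basis : ∀ y ∈ U, ∃ b : OrthonormalBasis ι ℝ (TangentSpace I y), ∀ i, b i = e i y

namespace IsOrthonormalFrameOn

variable {ι : Type*} [Fintype ι] {e : ι → Π x : M, TangentSpace I x}

theorem inner_eq [DecidableEq ι] (h : IsOrthonormalFrameOn e U) {y : M} (hy : y ∈ U) (i j : ι) :
    inner ℝ (e i y) (e j y) = if i = j then 1 else 0 := by
  obtain ⟨b, hb⟩ := h.basis y hy
  rw [← hb, ← hb, orthonormal_iff_ite.mp b.orthonormal]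

theorem sum_inner_smul (h : IsOrthonormalFrameOn e U) {y : M} (hy : y ∈ U)
    (v : TangentSpace I y) : ∑ i, inner ℝ (e i y) v • e i y = v := by
  obtain ⟨b, hb⟩ := h.basis y hy
  simp only [← hb, b.sum_repr']

theorem ext_inner (h : IsOrthonormalFrameOn e U) {y : M} (hy : y ∈ U)
    {v w : TangentSpace I y} (hvw : ∀ i, inner ℝ (e i y) v = inner ℝ (e i y) w) : v = w := by
  rw [← h.sum_inner_smul hy v, ← h.sum_inner_smul hy w]
  simp only [hvw]

theorem smooth_of_inner (h : IsOrthonormalFrameOn e U) {X : Π x : M, TangentSpace I x}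
    (hX : ∀ i, SmoothFun I U fun y ↦ inner ℝ (e i y) (X y)) : SmoothField U X :=
  (SmoothField.sum (s := Finset.univ) fun i ↦ SmoothField.smul (hX i) (h.smooth i)).congr h.isOpen
    fun _ hy ↦ (h.sum_inner_smul hy _).symm

variable [Nonempty ι]

/-- The Leibniz rule [X, f e] = (Xf) e + f [X, e] for a unit frame field e expresses Xf through
inner products of Lie brackets, which are known to be smooth. -/
theorem smooth_dir (h : IsOrthonormalFrameOn e U) {f : M → ℝ} {X : Π x : M, TangentSpace I x}
    (hf : SmoothFun I U f) (hX : SmoothField U X) : SmoothFun I U (fun y ↦ d% f y (X y)) := by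
  classical
  obtain ⟨i⟩ := ‹Nonempty ι›
  have h1 : SmoothFun I U (fun y ↦ inner ℝ (mlieBracket I X (f • e i) y) (e i y)
      - f y * inner ℝ (mlieBracket I X (e i) y) (e i y)) :=
    (SmoothField.inner (hX.mlieBracket (SmoothField.smul hf (h.smooth i))) (h.smooth i)).sub
      (hf.mul ((hX.mlieBracket (h.smooth i)).inner (h.smooth i)))
  refine h1.congr h.isOpen fun y hy ↦ ?_
  rw [mlieBracket_smul_right (hf.mdiff hy) ((h.smooth i).mdiff hy), inner_add_left,
    real_inner_smul_left, real_inner_smul_left, h.inner_eq hy]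
  simp

/-- Expand the Jacobi identity for X, Y and fZ, with Z a frame field. By the Jacobi identity for X,
Y, Z all terms cancel except a multiple of Z whose coefficient is the claim; pairing with the unit
vector Z extracts it. -/
theorem mvfderiv_mlieBracket (h : IsOrthonormalFrameOn e U) {f : M → ℝ}
    {X Y : Π x : M, TangentSpace I x} (hf : SmoothFun I U f) (hX : SmoothField U X)
    (hY : SmoothField U Y) {y : M} (hy : y ∈ U) :
    d% f y (mlieBracket I X Y y) =
      d% (fun z ↦ d% f z (Y z)) y (X y) - d% (fun z ↦ d% f z (X z)) y (Y y) := by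
  classical
  obtain ⟨i⟩ := ‹Nonempty ι›
  have : Nonempty ι := ⟨i⟩
  set Z := e i
  have hZ : SmoothField U Z := h.smooth i
  have key : ∀ {X Y : Π x : M, TangentSpace I x}, SmoothField U X → SmoothField U Y →
      mlieBracket I X (mlieBracket I Y (f • Z)) y =
        d% (fun z ↦ d% f z (Y z)) y (X y) • Z y + d% f y (Y y) • mlieBracket I X Z y
        + (d% f y (X y) • mlieBracket I Y Z y + f y • mlieBracket I X (mlieBracket I Y Z) y) := by
    intro X Y hX hY
    have hd := h.smooth_dir hf hY
    have e1 : mlieBracket I Y (f • Z) =ᶠ[nhds y]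
        (fun z ↦ d% f z (Y z)) • Z + f • mlieBracket I Y Z :=
      Filter.eventually_of_mem (h.isOpen.mem_nhds hy) fun z hz ↦ by
        rw [mlieBracket_smul_right (hf.mdiff hz) (hZ.mdiff hz)]
        rfl
    rw [Filter.EventuallyEq.mlieBracket_vectorField_eq (Filter.EventuallyEq.refl _ X) e1,
      mlieBracket_add_right ((SmoothField.smul hd hZ).mdiff hy)
        ((SmoothField.smul hf (hY.mlieBracket hZ)).mdiff hy),
      mlieBracket_smul_right (hd.mdiff hy) (hZ.mdiff hy),
      mlieBracket_smul_right (hf.mdiff hy) ((hY.mlieBracket hZ).mdiff hy)]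
  have hj := mlieBracket_jacobi hX hY (SmoothField.smul hf hZ) hy
  have hj' := mlieBracket_jacobi hX hY hZ hy
  change mlieBracket I X (mlieBracket I Y (f • Z)) y =
      mlieBracket I (mlieBracket I X Y) (f • Z) y + mlieBracket I Y (mlieBracket I X (f • Z)) y at hj
  rw [key hX hY, key hY hX, mlieBracket_smul_right (hf.mdiff hy) (hZ.mdiff hy), hj'] at hj
  have hz : (d% (fun z ↦ d% f z (Y z)) y (X y)
      - d% (fun z ↦ d% f z (X z)) y (Y y) - d% f y (mlieBracket I X Y y)) • Z y = 0 := by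
    rw [← sub_eq_zero] at hj
    rw [← hj]
    module
  have := congrArg (fun v ↦ inner ℝ v (Z y)) hz
  simp only [real_inner_smul_left, h.inner_eq hy i i, inner_zero_left, Z] at this
  simp only [if_true, mul_one] at this
  linarith

/-- The frame components are given by the Koszul formula, whose terms are smooth by `smooth_dir` and
smoothness of brackets. -/
theorem smooth_leviCivita (h : IsOrthonormalFrameOn e U) {X Y : Π x : M, TangentSpace I x}
    (hX : SmoothField U X) (hY : SmoothField U Y) :
    SmoothField U (fun y ↦ leviCivita Y y (X y)) := by
  refine h.smooth_of_inner fun i ↦ ?_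
  have hk : SmoothFun I U fun y ↦ 2⁻¹ * koszul X Y (e i) y := by
    refine (SmoothFun.const _).mul ?_
    unfold koszul
    have hi := h.smooth i
    exact (((((h.smooth_dir (hY.inner hi) hX).add (h.smooth_dir (hX.inner hi) hY)).sub
      (h.smooth_dir (hX.inner hY) hi)).add ((hX.mlieBracket hY).inner hi)).sub
      ((hX.mlieBracket hi).inner hY)).sub ((hY.mlieBracket hi).inner hX)
  refine hk.congr h.isOpen fun y hy ↦ ?_
  rw [real_inner_comm]
  exact inner_leviCivitaFun (hX.mdiff hy) (hY.mdiff hy) ((h.smooth i).mdiff hy)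

end IsOrthonormalFrameOn

end RiemannianCalculus

end RiemannianGeometry

end

noncomputable section

namespace RiemannianGeometry

/-! ### Existence of local orthonormal frames -/

section ExistsFrame

set_option linter.unusedSectionVars false

variable {E : Type*} [NormedAddCommGroup E] [NormedSpace ℝ E] [FiniteDimensional ℝ E]
  [CompleteSpace E]
  {H : Type*} [TopologicalSpace H] {I : ModelWithCorners ℝ E H}
  {M : Type*} [TopologicalSpace M] [ChartedSpace H M] [IsManifold I ∞ M]
  [RiemannianBundle (fun x : M ↦ TangentSpace I x)]
  [IsContMDiffRiemannianBundle I ∞ E (fun x : M ↦ TangentSpace I x)]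
  {U : Set M}

theorem SmoothFun.inv {f : M → ℝ} (hf : SmoothFun I U f) (h : ∀ y ∈ U, f y ≠ 0) :
    SmoothFun I U (fun y ↦ (f y)⁻¹) := fun y hy ↦ (hf y hy).inv₀ (h y hy)

theorem SmoothFun.sqrt {f : M → ℝ} (hf : SmoothFun I U f) (h : ∀ y ∈ U, f y ≠ 0) :
    SmoothFun I U (fun y ↦ √(f y)) := fun y hy ↦
  (Real.contDiffAt_sqrt (h y hy)).contMDiffAt.comp y (hf y hy)

theorem norm_eq_sqrt_inner_self (y : M) (v : TangentSpace I y) : ‖v‖ = √(inner ℝ v v) := by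
  rw [real_inner_self_eq_norm_sq, Real.sqrt_sq (norm_nonneg _)]

open InnerProductSpace in
-- Each step divides by inner products ⟨g_j, g_j⟩, which are smooth and nonzero by linear
-- independence.
theorem smooth_gramSchmidt {m : ℕ} {s : Fin m → Π x : M, TangentSpace I x} (hU : IsOpen U)
    (hs : ∀ i, SmoothField U (s i)) (hli : ∀ y ∈ U, LinearIndependent ℝ fun i ↦ s i y) (i : Fin m) :
    SmoothField U (fun y ↦ gramSchmidt ℝ (fun i ↦ s i y) i) := by
  induction i using WellFoundedLT.induction with
  | ind i ih =>
    have h : SmoothField U (fun y ↦ s i y - ∑ j ∈ (Finset.Iio i).attach,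
        ((fun y ↦ inner ℝ (gramSchmidt ℝ (fun i ↦ s i y) j) (s i y) *
          (inner ℝ (gramSchmidt ℝ (fun i ↦ s i y) j) (gramSchmidt ℝ (fun i ↦ s i y) j))⁻¹) •
          fun y ↦ gramSchmidt ℝ (fun i ↦ s i y) j) y) := by
      refine (hs i).sub (SmoothField.sum fun j ↦ SmoothField.smul ?_ (ih j (Finset.mem_Iio.mp j.2)))
      have hj := ih j (Finset.mem_Iio.mp j.2)
      exact (hj.inner (hs i)).mul ((hj.inner hj).inv fun y hy ↦
        inner_self_ne_zero.mpr (gramSchmidt_ne_zero (j : Fin m) (hli y hy)))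
    refine h.congr hU fun y hy ↦ ?_
    rw [eq_sub_iff_add_eq]
    conv_rhs => rw [gramSchmidt_def'' ℝ (fun i ↦ s i y) i]
    congr 1
    conv_rhs => rw [← Finset.sum_attach]
    refine Finset.sum_congr rfl fun j _ ↦ ?_
    simp only [Pi.smul_apply', div_eq_mul_inv, real_inner_self_eq_norm_sq]
    rfl

open InnerProductSpace in
variable (I) in
theorem exists_isOrthonormalFrameOn (x : M) :
    ∃ (U : Set M) (e : Fin (Module.finrank ℝ E) → Π x : M, TangentSpace I x),
      x ∈ U ∧ IsOrthonormalFrameOn e U := by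
  set t := trivializationAt E (TangentSpace I : M → Type _) x
  set b := Module.finBasis ℝ E
  have hf := t.isLocalFrameOn_localFrame_baseSet I ∞ b
  set s := t.localFrame b
  have hli : ∀ y ∈ t.baseSet, LinearIndependent ℝ fun i ↦ s i y := fun y hy ↦
    hf.linearIndependent hy
  have hg := smooth_gramSchmidt t.open_baseSet (fun i y hy ↦ hf.contMDiffAt t.open_baseSet hy i) hli
  refine ⟨t.baseSet, fun i y ↦ gramSchmidtNormed ℝ (fun i ↦ s i y) i,
    FiberBundle.mem_baseSet_trivializationAt' x, t.open_baseSet, fun i ↦ ?_, fun y hy ↦ ?_⟩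
  · have h0 : ∀ y ∈ t.baseSet, inner ℝ (gramSchmidt ℝ (fun i ↦ s i y) i)
        (gramSchmidt ℝ (fun i ↦ s i y) i) ≠ 0 := fun y hy ↦
      inner_self_ne_zero.mpr (gramSchmidt_ne_zero i (hli y hy))
    refine (SmoothField.smul ((((hg i).inner (hg i)).sqrt h0).inv fun y hy ↦
      Real.sqrt_ne_zero'.mpr (lt_of_le_of_ne real_inner_self_nonneg (h0 y hy).symm))
      (hg i)).congr t.open_baseSet fun y hy ↦ ?_
    simp only [Pi.smul_apply', gramSchmidtNormed, norm_eq_sqrt_inner_self]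
    rfl
  · refine ⟨gramSchmidtOrthonormalBasis (𝕜 := ℝ) (E := TangentSpace I y)
      (Fintype.card_fin _).symm (fun i ↦ s i y), fun i ↦ gramSchmidtOrthonormalBasis_apply _ ?_⟩
    have := gramSchmidtNormed_unit_length (𝕜 := ℝ) i (hli y hy)
    intro h
    rw [h] at this
    simp at this

theorem IsOrthonormalFrameOn.mono {ι : Type*} [Fintype ι] {e : ι → Π x : M, TangentSpace I x}
    (h : IsOrthonormalFrameOn e U) {U' : Set M} (hU' : IsOpen U') (hs : U' ⊆ U) :
    IsOrthonormalFrameOn e U' where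
  isOpen := hU'
  smooth i y hy := h.smooth i y (hs hy)
  basis y hy := h.basis y (hs hy)

end ExistsFrame

end RiemannianGeometry

end

noncomputable section

namespace RiemannianGeometry

/-! ### Covariant derivatives and evaluation of tensors in components -/

namespace FrameConnection

set_option linter.unusedSectionVars false

variable {ι A : Type*} [Fintype ι] [CommRing A] [Algebra ℝ A] (F : FrameConnection ι A)

/-- The covariant derivative of a vector field, given by its components, along a frame field. -/
def covFrame (j : ι) (c : ι → A) (k : ι) : A := F.D j (c k) + ∑ l, c l * F.Γ j l k

/-- The covariant derivative of a vector field along another, in components. -/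
def cov (a c : ι → A) (k : ι) : A := ∑ j, a j * F.covFrame j c k

theorem covFrame_sum_mul {κ : Type*} [Fintype κ] (i : ι) (f : κ → A) (v : κ → ι → A) (k : ι) :
    F.covFrame i (fun k ↦ ∑ j, f j * v j k) k =
      ∑ j, (F.D i (f j) * v j k + f j * F.covFrame i (v j) k) := by
  simp only [covFrame, map_sum, Derivation.leibniz, smul_eq_mul, Finset.sum_mul, mul_add,
    Finset.mul_sum, Finset.sum_add_distrib]
  rw [Finset.sum_comm]
  have : ∀ j, ∑ l, f j * v j l * F.Γ i l k = ∑ l, f j * (v j l * F.Γ i l k) := fun j ↦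
    Finset.sum_congr rfl fun l _ ↦ mul_assoc _ _ _
  simp only [this, mul_comm (v _ k)]
  ring

theorem covFrame_commutator (i j : ι) (c : ι → A) (k : ι) :
    F.covFrame i (F.covFrame j c) k - F.covFrame j (F.covFrame i c) k
      - ∑ q, F.bracket i j q * F.covFrame q c k = ∑ l, c l * F.curv i j k l := by
  have h1 : ∀ i j, F.covFrame i (F.covFrame j c) k = F.D i (F.D j (c k))
      + ∑ l, (c l * F.D i (F.Γ j l k)) + ∑ l, (F.Γ j l k * F.D i (c l))
      + ∑ l, F.D j (c l) * F.Γ i l k + ∑ l, c l * ∑ q, F.Γ j l q * F.Γ i q k := by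
    intro i j
    simp only [covFrame, map_add, map_sum, Derivation.leibniz, smul_eq_mul, add_mul,
      Finset.sum_add_distrib, Finset.sum_mul, Finset.mul_sum]
    rw [Finset.sum_comm (f := fun x i_1 ↦ c i_1 * F.Γ j i_1 x * F.Γ i x k)]
    simp only [mul_assoc]
    ring
  have h2 : ∑ q, F.bracket i j q * F.covFrame q c k = ∑ q, F.bracket i j q * F.D q (c k)
      + ∑ l, c l * ∑ q, F.bracket i j q * F.Γ q l k := by
    simp only [covFrame, mul_add, Finset.sum_add_distrib, Finset.mul_sum]
    rw [Finset.sum_comm]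
    simp only [mul_left_comm (c _)]
  have h3 := F.commutator i j (c k)
  have h4 : ∑ l, c l * F.curv i j k l = ∑ l, c l * F.D i (F.Γ j l k) - ∑ l, c l * F.D j (F.Γ i l k)
      - (∑ l, c l * ∑ q, F.Γ i l q * F.Γ j q k - ∑ l, c l * ∑ q, F.Γ j l q * F.Γ i q k)
      - ∑ l, c l * ∑ q, F.bracket i j q * F.Γ q l k := by
    simp only [curv, curvMatrix, mul_sub, Finset.sum_sub_distrib]
  have h5 : ∑ l, F.Γ j l k * F.D i (c l) = ∑ l, F.D i (c l) * F.Γ j l k := by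
    simp only [mul_comm]
  have h6 : ∑ l, F.Γ i l k * F.D j (c l) = ∑ l, F.D j (c l) * F.Γ i l k := by
    simp only [mul_comm]
  rw [h4, h1, h1, h2, h5, h6]
  simp only [bracket] at h3 ⊢
  linear_combination h3

/-- The curvature of the connection is tensorial, with components `F.curv`. -/
theorem cov_commutator (a b c : ι → A) (k : ι) :
    F.cov a (F.cov b c) k - F.cov b (F.cov a c) k
      - F.cov (fun q ↦ F.cov a b q - F.cov b a q) c k =
      ∑ i, ∑ j, ∑ l, a i * b j * c l * F.curv i j k l := by
  have h1 : ∀ a b : ι → A, F.cov a (F.cov b c) k = ∑ i, ∑ j, a i * (F.D i (b j) * F.covFrame j c k)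
      + ∑ i, ∑ j, a i * (b j * F.covFrame i (F.covFrame j c) k) := by
    intro a b
    have : ∀ i, F.covFrame i (F.cov b c) k =
        ∑ j, (F.D i (b j) * F.covFrame j c k + b j * F.covFrame i (F.covFrame j c) k) := fun i ↦
      F.covFrame_sum_mul i b (fun j ↦ F.covFrame j c) k
    conv_lhs => rw [cov]
    simp only [this, mul_add, Finset.mul_sum, Finset.sum_add_distrib]
  have h2 : F.cov (fun q ↦ F.cov a b q - F.cov b a q) c k =
      ∑ i, ∑ j, a i * (F.D i (b j) * F.covFrame j c k)
      - ∑ i, ∑ j, b i * (F.D i (a j) * F.covFrame j c k)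
      + ∑ i, ∑ j, a i * (b j * ∑ q, F.bracket i j q * F.covFrame q c k) := by
    have e1 : ∀ a b : ι → A, ∑ q, F.cov a b q * F.covFrame q c k =
        ∑ i, ∑ j, a i * (F.D i (b j) * F.covFrame j c k) +
        ∑ i, ∑ j, a i * (b j * ∑ q, F.Γ i j q * F.covFrame q c k) := by
      intro a b
      set t := fun q ↦ F.covFrame q c k
      have e3 : ∀ i, ∑ q, F.covFrame i b q * t q =
          ∑ q, F.D i (b q) * t q + ∑ j, b j * ∑ q, F.Γ i j q * t q := fun i ↦ by
        rw [sum_mul_sum_assoc b (F.Γ i) t]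
        simp only [covFrame, add_mul, Finset.sum_add_distrib]
      calc _ = ∑ i, a i * ∑ q, F.covFrame i b q * t q :=
            (sum_mul_sum_assoc a (fun i q ↦ F.covFrame i b q) t).symm
        _ = _ := by simp only [e3, mul_add, Finset.sum_add_distrib, Finset.mul_sum, t]
    have e2 : ∑ i, ∑ j, b i * (a j * ∑ q, F.Γ i j q * F.covFrame q c k) =
        ∑ i, ∑ j, a i * (b j * ∑ q, F.Γ j i q * F.covFrame q c k) := by
      rw [Finset.sum_comm]
      simp only [mul_left_comm (b _)]
    rw [cov]
    simp only [sub_mul, Finset.sum_sub_distrib, e1, e2, bracket, mul_sub]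
    ring
  have h3 : ∑ i, ∑ j, b i * (a j * F.covFrame i (F.covFrame j c) k) =
      ∑ i, ∑ j, a i * (b j * F.covFrame j (F.covFrame i c) k) := by
    rw [Finset.sum_comm]
    simp only [mul_left_comm (b _)]
  have h4 : ∑ i, ∑ j, ∑ l, a i * b j * c l * F.curv i j k l =
      ∑ i, ∑ j, a i * (b j * F.covFrame i (F.covFrame j c) k)
      - ∑ i, ∑ j, a i * (b j * F.covFrame j (F.covFrame i c) k)
      - ∑ i, ∑ j, a i * (b j * ∑ q, F.bracket i j q * F.covFrame q c k) := by
    simp only [← Finset.sum_sub_distrib]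
    refine Finset.sum_congr rfl fun i _ ↦ Finset.sum_congr rfl fun j _ ↦ ?_
    rw [← mul_sub, ← mul_sub, ← mul_sub, ← mul_sub, F.covFrame_commutator]
    simp only [Finset.mul_sum, mul_assoc]
  rw [h1, h1, h2, h3, h4]
  ring

/-- The value of a four-tensor on four vectors, in components. -/
def eval₄ (T : ι → ι → ι → ι → A) (x y z w : ι → A) : A :=
  ∑ i, ∑ j, ∑ k, ∑ l, x i * y j * z k * w l * T i j k l

theorem eval₄_swap₁ (T : ι → ι → ι → ι → A) (x y z w : ι → A) :
    eval₄ T x y z w = eval₄ (fun i j k l ↦ T j i k l) y x z w := by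
  rw [eval₄, eval₄, Finset.sum_comm]
  simp only [mul_comm (x _) (y _)]

theorem eval₄_swap₂ (T : ι → ι → ι → ι → A) (x y z w : ι → A) :
    eval₄ T x y z w = eval₄ (fun i j k l ↦ T i k j l) x z y w := by
  refine Finset.sum_congr rfl fun i _ ↦ ?_
  rw [Finset.sum_comm]
  simp only [mul_assoc, mul_left_comm (y _) (z _)]

theorem eval₄_swap₃ (T : ι → ι → ι → ι → A) (x y z w : ι → A) :
    eval₄ T x y z w = eval₄ (fun i j k l ↦ T i j l k) x y w z := by
  refine Finset.sum_congr rfl fun i _ ↦ Finset.sum_congr rfl fun j _ ↦ ?_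
  rw [Finset.sum_comm]
  simp only [mul_assoc, mul_left_comm (z _) (w _)]

/-- A matrix contracted into a slot moves onto the vector occupying it. The other slots follow by
transpositions. -/
theorem eval₄_contract₄ (L : ι → ι → A) (T : ι → ι → ι → ι → A) (x y z w : ι → A) :
    eval₄ (fun i j k l ↦ ∑ p, L l p * T i j k p) x y z w =
      eval₄ T x y z (fun p ↦ ∑ l, w l * L l p) := by
  refine Finset.sum_congr rfl fun i _ ↦ Finset.sum_congr rfl fun j _ ↦
    Finset.sum_congr rfl fun k _ ↦ ?_
  have h := sum_mul_sum_assoc w L (T i j k)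
  simp only [mul_assoc, ← Finset.mul_sum]
  rw [h]

theorem eval₄_contract₃ (L : ι → ι → A) (T : ι → ι → ι → ι → A) (x y z w : ι → A) :
    eval₄ (fun i j k l ↦ ∑ p, L k p * T i j p l) x y z w =
      eval₄ T x y (fun p ↦ ∑ l, z l * L l p) w := by
  rw [eval₄_swap₃, eval₄_contract₄ L fun i j k l ↦ T i j l k, ← eval₄_swap₃]

theorem eval₄_contract₂ (L : ι → ι → A) (T : ι → ι → ι → ι → A) (x y z w : ι → A) :
    eval₄ (fun i j k l ↦ ∑ p, L j p * T i p k l) x y z w =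
      eval₄ T x (fun p ↦ ∑ l, y l * L l p) z w := by
  rw [eval₄_swap₂, eval₄_contract₃ L fun i j k l ↦ T i k j l, ← eval₄_swap₂]

theorem eval₄_contract₁ (L : ι → ι → A) (T : ι → ι → ι → ι → A) (x y z w : ι → A) :
    eval₄ (fun i j k l ↦ ∑ p, L i p * T p j k l) x y z w =
      eval₄ T (fun p ↦ ∑ l, x l * L l p) y z w := by
  rw [eval₄_swap₁, eval₄_contract₂ L fun i j k l ↦ T j i k l, ← eval₄_swap₁]

theorem eval₄_act (L : ι → ι → A) (T : ι → ι → ι → ι → A) (x y z w : ι → A) :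
    eval₄ (act L T) x y z w = eval₄ T (fun p ↦ ∑ l, x l * L l p) y z w
      + eval₄ T x (fun p ↦ ∑ l, y l * L l p) z w + eval₄ T x y (fun p ↦ ∑ l, z l * L l p) w
      + eval₄ T x y z (fun p ↦ ∑ l, w l * L l p) := by
  rw [← eval₄_contract₁, ← eval₄_contract₂, ← eval₄_contract₃, ← eval₄_contract₄]
  simp only [eval₄, act, mul_add, Finset.sum_add_distrib]

/-- The Leibniz rule for ∇: the Γ-terms inside `nabla` cancel against those inside `covFrame`. -/
theorem derivation_eval₄ (m : ι) (T : ι → ι → ι → ι → A) (x y z w : ι → A) :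
    F.D m (eval₄ T x y z w) = eval₄ (F.nabla m T) x y z w + eval₄ T (F.covFrame m x) y z w
      + eval₄ T x (F.covFrame m y) z w + eval₄ T x y (F.covFrame m z) w
      + eval₄ T x y z (F.covFrame m w) := by
  have h1 : F.D m (eval₄ T x y z w) = eval₄ (fun i j k l ↦ F.D m (T i j k l)) x y z w
      + eval₄ T (fun i ↦ F.D m (x i)) y z w + eval₄ T x (fun i ↦ F.D m (y i)) z w
      + eval₄ T x y (fun i ↦ F.D m (z i)) w + eval₄ T x y z (fun i ↦ F.D m (w i)) := by
    simp only [eval₄, map_sum, Derivation.leibniz, smul_eq_mul, ← Finset.sum_add_distrib]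
    exact Finset.sum_congr rfl fun i _ ↦ Finset.sum_congr rfl fun j _ ↦
      Finset.sum_congr rfl fun k _ ↦ Finset.sum_congr rfl fun l _ ↦ by ring
  have h2 : eval₄ (F.nabla m T) x y z w = eval₄ (fun i j k l ↦ F.D m (T i j k l)) x y z w
      - eval₄ (act (F.Γ m) T) x y z w := by
    simp only [eval₄, nabla, mul_sub, Finset.sum_sub_distrib]
  rw [h1, h2, eval₄_act]
  have e1 : ∀ x x', eval₄ T (fun p ↦ x p + x' p) y z w = eval₄ T x y z w + eval₄ T x' y z w := by
    intro x x'; simp only [eval₄, add_mul, Finset.sum_add_distrib]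
  have e2 : ∀ y y', eval₄ T x (fun p ↦ y p + y' p) z w = eval₄ T x y z w + eval₄ T x y' z w := by
    intro y y'; simp only [eval₄, mul_add, add_mul, Finset.sum_add_distrib]
  have e3 : ∀ z z', eval₄ T x y (fun p ↦ z p + z' p) w = eval₄ T x y z w + eval₄ T x y z' w := by
    intro z z'; simp only [eval₄, mul_add, add_mul, Finset.sum_add_distrib]
  have e4 : ∀ w w', eval₄ T x y z (fun p ↦ w p + w' p) = eval₄ T x y z w + eval₄ T x y z w' := by
    intro w w'; simp only [eval₄, mul_add, add_mul, Finset.sum_add_distrib]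
  unfold covFrame
  rw [e1, e2, e3, e4]
  ring

theorem eval₄_sum₄ (v : ι → A) (T : ι → ι → ι → ι → A) (x y z : ι → A) (w : ι → ι → A) :
    eval₄ T x y z (fun l ↦ ∑ m, v m * w m l) = ∑ m, v m * eval₄ T x y z (w m) := by
  simp only [eval₄, Finset.mul_sum, Finset.sum_mul]
  rw [← sum_comm₄ fun i j k l m ↦ v m * (x i * y j * z k * w m l * T i j k l)]
  exact Finset.sum_congr rfl fun i _ ↦ Finset.sum_congr rfl fun j _ ↦
      Finset.sum_congr rfl fun k _ ↦ Finset.sum_congr rfl fun l _ ↦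
      Finset.sum_congr rfl fun m _ ↦ by ring

theorem eval₄_sum₃ (v : ι → A) (T : ι → ι → ι → ι → A) (x y w : ι → A) (z : ι → ι → A) :
    eval₄ T x y (fun l ↦ ∑ m, v m * z m l) w = ∑ m, v m * eval₄ T x y (z m) w := by
  rw [eval₄_swap₃, eval₄_sum₄]
  simp only [← eval₄_swap₃]

theorem eval₄_sum₂ (v : ι → A) (T : ι → ι → ι → ι → A) (x z w : ι → A) (y : ι → ι → A) :
    eval₄ T x (fun l ↦ ∑ m, v m * y m l) z w = ∑ m, v m * eval₄ T x (y m) z w := by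
  rw [eval₄_swap₂, eval₄_sum₃]
  simp only [← eval₄_swap₂]

theorem eval₄_sum₁ (v : ι → A) (T : ι → ι → ι → ι → A) (y z w : ι → A) (x : ι → ι → A) :
    eval₄ T (fun l ↦ ∑ m, v m * x m l) y z w = ∑ m, v m * eval₄ T (x m) y z w := by
  rw [eval₄_swap₁, eval₄_sum₂]
  simp only [← eval₄_swap₁]

theorem cov_eval₄ (v x y z w : ι → A) (T : ι → ι → ι → ι → A) :
    ∑ m, v m * F.D m (eval₄ T x y z w) = ∑ m, v m * eval₄ (F.nabla m T) x y z w
      + eval₄ T (F.cov v x) y z w + eval₄ T x (F.cov v y) z w + eval₄ T x y (F.cov v z) w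
      + eval₄ T x y z (F.cov v w) := by
  unfold cov
  rw [eval₄_sum₁, eval₄_sum₂, eval₄_sum₃, eval₄_sum₄]
  simp only [derivation_eval₄, mul_add, Finset.sum_add_distrib]

end FrameConnection

end RiemannianGeometry

end

noncomputable section

namespace RiemannianGeometry

/-! ### The connection algebra of an orthonormal frame -/

section FrameAlgebra

set_option linter.unusedSectionVars false

variable {E : Type*} [NormedAddCommGroup E] [NormedSpace ℝ E] [FiniteDimensional ℝ E]
  [CompleteSpace E]
  {H : Type*} [TopologicalSpace H] {I : ModelWithCorners ℝ E H}
  {M : Type*} [TopologicalSpace M] [ChartedSpace H M] [IsManifold I ∞ M]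
  [RiemannianBundle (fun x : M ↦ TangentSpace I x)]
  [IsContMDiffRiemannianBundle I ∞ E (fun x : M ↦ TangentSpace I x)]
  {U : Set M}

variable (I) in
/-- The algebra of functions that are smooth on `U`. -/
def smoothAlgebra (U : Set M) : Subalgebra ℝ (M → ℝ) where
  carrier := {f | SmoothFun I U f}
  mul_mem' hf hg := hf.mul hg
  add_mem' hf hg := hf.add hg
  algebraMap_mem' c := SmoothFun.const c

instance : Invertible (2 : smoothAlgebra I U) :=
  (invertibleOfNonzero (two_ne_zero (α := ℝ))).map (algebraMap ℝ (smoothAlgebra I U))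

/-- Evaluation of functions at a point. -/
def ev (y : M) : smoothAlgebra I U →ₐ[ℝ] ℝ :=
  (Pi.evalAlgHom ℝ (fun _ : M ↦ ℝ) y).comp (smoothAlgebra I U).val

/-- Elements are functions on all of M, restricted only on U. Identities must therefore also be
checked off U, where derivatives and components are cut off to zero. -/
theorem smoothAlgebra_ext {f g : smoothAlgebra I U} (h : ∀ y ∈ U, ev y f = ev y g)
    (h' : ∀ y ∉ U, ev y f = ev y g) : f = g :=
  Subtype.ext (funext fun y ↦ by by_cases hy : y ∈ U; exacts [h y hy, h' y hy])

/-- Restriction of a function to `U`, extended by zero. -/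
def restr (hU : IsOpen U) (f : M → ℝ) (hf : SmoothFun I U f) : smoothAlgebra I U :=
  ⟨U.indicator f, hf.congr hU fun _ hy ↦ Set.indicator_of_mem hy f⟩

theorem ev_restr (hU : IsOpen U) {f : M → ℝ} (hf : SmoothFun I U f) {y : M} (hy : y ∈ U) :
    ev y (restr hU f hf) = f y := Set.indicator_of_mem hy f

theorem ev_restr_notMem (hU : IsOpen U) {f : M → ℝ} (hf : SmoothFun I U f) {y : M} (hy : y ∉ U) :
    ev y (restr hU f hf) = 0 := Set.indicator_of_notMem hy f

theorem mvfderiv_congr_on (hU : IsOpen U) {f g : M → ℝ} (h : ∀ z ∈ U, f z = g z) {y : M}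
    (hy : y ∈ U) (v : TangentSpace I y) : d% f y v = d% g y v := by
  have he : f =ᶠ[nhds y] g := Filter.eventually_of_mem (hU.mem_nhds hy) h
  have h1 : (mfderiv I 𝓘(ℝ, ℝ) f y v : ℝ) = mfderiv I 𝓘(ℝ, ℝ) g y v := by
    rw [he.mfderiv_eq]
    rfl
  exact h1

namespace IsOrthonormalFrameOn

variable {ι : Type*} [Fintype ι] [Nonempty ι] {e : ι → Π x : M, TangentSpace I x}

/-- The derivative of a function along a frame field. -/
def dirDeriv (h : IsOrthonormalFrameOn e U) (i : ι) (f : smoothAlgebra I U) : smoothAlgebra I U :=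
  restr h.isOpen (fun y ↦ d% f.1 y (e i y)) (h.smooth_dir f.2 (h.smooth i))

theorem ev_dirDeriv (h : IsOrthonormalFrameOn e U) (i : ι) (f : smoothAlgebra I U) {y : M}
    (hy : y ∈ U) : ev y (h.dirDeriv i f) = d% f.1 y (e i y) := ev_restr h.isOpen _ hy

theorem ev_dirDeriv_notMem (h : IsOrthonormalFrameOn e U) (i : ι) (f : smoothAlgebra I U) {y : M}
    (hy : y ∉ U) : ev y (h.dirDeriv i f) = 0 := ev_restr_notMem h.isOpen _ hy

/-- The derivation of functions along a frame field. -/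
def deriv (h : IsOrthonormalFrameOn e U) (i : ι) :
    Derivation ℝ (smoothAlgebra I U) (smoothAlgebra I U) :=
  Derivation.mk'
    { toFun f := h.dirDeriv i f
      map_add' f g := smoothAlgebra_ext
        (fun y hy ↦ by
          rw [map_add, h.ev_dirDeriv i _ hy, h.ev_dirDeriv i _ hy, h.ev_dirDeriv i _ hy]
          have := mvfderiv_add (f.2.mdiff hy) (g.2.mdiff hy)
          exact congrArg (fun L ↦ L (e i y)) this)
        (fun y hy ↦ by
          simp only [map_add, h.ev_dirDeriv_notMem i _ hy, add_zero])
      map_smul' c f := smoothAlgebra_ext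
        (fun y hy ↦ by
          rw [map_smul, h.ev_dirDeriv i _ hy, RingHom.id_apply, h.ev_dirDeriv i _ hy]
          have := mvfderiv_mul (SmoothFun.mdiff (SmoothFun.const c) hy) (f.2.mdiff hy)
          rw [mvfderiv_const, smul_zero, add_zero] at this
          exact congrArg (fun L ↦ L (e i y)) this)
        (fun y hy ↦ by
          simp only [map_smul, h.ev_dirDeriv_notMem i _ hy, smul_zero]) }
    fun f g ↦ smoothAlgebra_ext
        (fun y hy ↦ by
          change ev y (h.dirDeriv i (f * g)) =
            f.1 y * ev y (h.dirDeriv i g) + g.1 y * ev y (h.dirDeriv i f)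
          rw [h.ev_dirDeriv i _ hy, h.ev_dirDeriv i _ hy, h.ev_dirDeriv i _ hy]
          have := mvfderiv_mul (f.2.mdiff hy) (g.2.mdiff hy)
          exact congrArg (fun L ↦ L (e i y)) this)
        (fun y hy ↦ by
          change ev y (h.dirDeriv i (f * g)) =
            f.1 y * ev y (h.dirDeriv i g) + g.1 y * ev y (h.dirDeriv i f)
          simp only [h.ev_dirDeriv_notMem i _ hy, mul_zero, add_zero])

theorem ev_deriv (h : IsOrthonormalFrameOn e U) (i : ι) (f : smoothAlgebra I U) {y : M}
    (hy : y ∈ U) : ev y (h.deriv i f) = d% f.1 y (e i y) := h.ev_dirDeriv i f hy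

theorem ev_deriv_notMem (h : IsOrthonormalFrameOn e U) (i : ι) (f : smoothAlgebra I U) {y : M}
    (hy : y ∉ U) : ev y (h.deriv i f) = 0 := h.ev_dirDeriv_notMem i f hy

theorem ev_deriv_restr (h : IsOrthonormalFrameOn e U) (i : ι) {f : M → ℝ} (hf : SmoothFun I U f)
    {y : M} (hy : y ∈ U) : ev y (h.deriv i (restr h.isOpen f hf)) = d% f y (e i y) := by
  rw [h.ev_deriv i _ hy]
  exact mvfderiv_congr_on h.isOpen (fun z hz ↦ Set.indicator_of_mem hz f) hy _

/-- The components of a vector field in a frame. -/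
def coeff (h : IsOrthonormalFrameOn e U) {X : Π x : M, TangentSpace I x} (hX : SmoothField U X)
    (k : ι) : smoothAlgebra I U :=
  restr h.isOpen (fun y ↦ inner ℝ (e k y) (X y)) ((h.smooth k).inner hX)

theorem ev_coeff (h : IsOrthonormalFrameOn e U) {X : Π x : M, TangentSpace I x}
    (hX : SmoothField U X) (k : ι) {y : M} (hy : y ∈ U) :
    ev y (h.coeff hX k) = inner ℝ (e k y) (X y) := ev_restr h.isOpen _ hy

theorem ev_coeff_notMem (h : IsOrthonormalFrameOn e U) {X : Π x : M, TangentSpace I x}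
    (hX : SmoothField U X) (k : ι) {y : M} (hy : y ∉ U) :
    ev y (h.coeff hX k) = 0 := ev_restr_notMem h.isOpen _ hy

/-- The connection coefficients `⟪∇_{e i} (e j), e k⟫`. -/
def connCoeff (h : IsOrthonormalFrameOn e U) (i j k : ι) : smoothAlgebra I U :=
  h.coeff (h.smooth_leviCivita (h.smooth i) (h.smooth j)) k

theorem ev_connCoeff (h : IsOrthonormalFrameOn e U) (i j k : ι) {y : M} (hy : y ∈ U) :
    ev y (h.connCoeff i j k) = inner ℝ (e k y) (leviCivita (e j) y (e i y)) := h.ev_coeff _ _ hy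

theorem ev_connCoeff_notMem (h : IsOrthonormalFrameOn e U) (i j k : ι) {y : M} (hy : y ∉ U) :
    ev y (h.connCoeff i j k) = 0 := h.ev_coeff_notMem _ _ hy

/-- Differentiate the constant functions ⟨e_j, e_k⟩ with the metric connection. -/
theorem connCoeff_antisymm (h : IsOrthonormalFrameOn e U) (i j k : ι) :
    h.connCoeff i j k = -h.connCoeff i k j := by
  classical
  refine smoothAlgebra_ext (fun y hy ↦ ?_) fun y hy ↦ ?_
  · rw [map_neg, h.ev_connCoeff _ _ _ hy, h.ev_connCoeff _ _ _ hy]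
    have h1 := isMetric_leviCivita ((h.smooth i).mdiff hy) ((h.smooth j).mdiff hy)
      ((h.smooth k).mdiff hy)
    rw [mvfderiv_congr_on h.isOpen (g := fun _ ↦ if j = k then 1 else 0)
      (fun z hz ↦ h.inner_eq hz j k) hy, mvfderiv_const] at h1
    rw [real_inner_comm (leviCivita (e j) y (e i y)) (e k y)]
    simp only [zero_apply] at h1
    linarith
  · rw [map_neg, h.ev_connCoeff_notMem _ _ _ hy, h.ev_connCoeff_notMem _ _ _ hy, neg_zero]

theorem mvfderiv_apply_eq_sum (h : IsOrthonormalFrameOn e U) {y : M} (hy : y ∈ U) (f : M → ℝ)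
    (v : TangentSpace I y) : d% f y v = ∑ i, inner ℝ (e i y) v * d% f y (e i y) := by
  conv_lhs => rw [← h.sum_inner_smul hy v]
  simp only [map_sum, map_smul, smul_eq_mul]

theorem leviCivita_apply_eq_sum (h : IsOrthonormalFrameOn e U) {y : M} (hy : y ∈ U)
    (Y : Π x : M, TangentSpace I x) (v : TangentSpace I y) :
    leviCivita Y y v = ∑ i, inner ℝ (e i y) v • leviCivita Y y (e i y) := by
  conv_lhs => rw [← h.sum_inner_smul hy v]
  simp only [map_sum, map_smul]

theorem sum_inner_mul (h : IsOrthonormalFrameOn e U) {y : M} (hy : y ∈ U)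
    (v w : TangentSpace I y) : inner ℝ v w = ∑ i, inner ℝ (e i y) v * inner ℝ (e i y) w := by
  conv_lhs => rw [← h.sum_inner_smul hy v]
  simp only [sum_inner, real_inner_smul_left]

theorem inner_leviCivita (h : IsOrthonormalFrameOn e U) {Y : Π x : M, TangentSpace I x}
    (hY : SmoothField U Y) {y : M} (hy : y ∈ U) (j k : ι) :
    inner ℝ (e k y) (leviCivita Y y (e j y)) = d% (fun z ↦ inner ℝ (e k z) (Y z)) y (e j y)
      + ∑ l, inner ℝ (e l y) (Y y) * ev y (h.connCoeff j l k) := by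
  rw [isMetric_leviCivita ((h.smooth j).mdiff hy) ((h.smooth k).mdiff hy) (hY.mdiff hy),
    h.sum_inner_mul hy (leviCivita (e k) y (e j y))]
  have : ∀ l, ev y (h.connCoeff j l k) = -inner ℝ (e l y) (leviCivita (e k) y (e j y)) := fun l ↦ by
    rw [h.connCoeff_antisymm, map_neg, ← h.ev_connCoeff _ _ _ hy]
  simp only [this, mul_neg, Finset.sum_neg_distrib]
  simp only [mul_comm (inner ℝ (e _ y) (Y y))]
  ring

theorem inner_leviCivita_apply (h : IsOrthonormalFrameOn e U) {Y : Π x : M, TangentSpace I x}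
    (hY : SmoothField U Y) {y : M} (hy : y ∈ U) (v : TangentSpace I y) (k : ι) :
    inner ℝ (e k y) (leviCivita Y y v) =
      ∑ j, inner ℝ (e j y) v * ev y (h.deriv j (h.coeff hY k)
        + ∑ l, h.coeff hY l * h.connCoeff j l k) := by
  rw [h.leviCivita_apply_eq_sum hy, inner_sum]
  refine Finset.sum_congr rfl fun j _ ↦ ?_
  rw [real_inner_smul_right, h.inner_leviCivita hY hy, map_add, map_sum, coeff,
    h.ev_deriv_restr j _ hy]
  simp only [map_mul, h.ev_coeff hY _ hy]

theorem coeff_leviCivita (h : IsOrthonormalFrameOn e U) {X Y : Π x : M, TangentSpace I x}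
    (hX : SmoothField U X) (hY : SmoothField U Y) (k : ι) :
    h.coeff (h.smooth_leviCivita hX hY) k =
      ∑ j, h.coeff hX j * (h.deriv j (h.coeff hY k)
        + ∑ l, h.coeff hY l * h.connCoeff j l k) := by
  refine smoothAlgebra_ext (fun y hy ↦ ?_) fun y hy ↦ ?_
  · rw [h.ev_coeff _ k hy, h.inner_leviCivita_apply hY hy, map_sum]
    simp only [map_mul, h.ev_coeff hX _ hy]
  · rw [h.ev_coeff_notMem _ k hy, map_sum]
    simp only [map_mul, h.ev_coeff_notMem hX _ hy, zero_mul, Finset.sum_const_zero]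

theorem mlieBracket_eq {X Y : Π x : M, TangentSpace I x} {y : M}
    (hX : MDiffAt (T% X) y) (hY : MDiffAt (T% Y) y) :
    mlieBracket I X Y y = leviCivita Y y (X y) - leviCivita X y (Y y) :=
  (((CovariantDerivative.torsion_eq_zero_iff _).mp torsion_leviCivita) hX hY).symm

theorem coeff_mlieBracket (h : IsOrthonormalFrameOn e U) {X Y : Π x : M, TangentSpace I x}
    (hX : SmoothField U X) (hY : SmoothField U Y) (k : ι) :
    h.coeff (hX.mlieBracket hY) k =
      h.coeff (h.smooth_leviCivita hX hY) k - h.coeff (h.smooth_leviCivita hY hX) k := by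
  refine smoothAlgebra_ext (fun y hy ↦ ?_) fun y hy ↦ ?_
  · rw [map_sub, h.ev_coeff _ k hy, h.ev_coeff _ k hy, h.ev_coeff _ k hy,
      mlieBracket_eq (hX.mdiff hy) (hY.mdiff hy), inner_sub_right]
  · simp only [map_sub, h.ev_coeff_notMem _ k hy, sub_zero]

theorem deriv_commutator (h : IsOrthonormalFrameOn e U) (i j : ι) (f : smoothAlgebra I U) :
    h.deriv i (h.deriv j f) - h.deriv j (h.deriv i f) =
      ∑ k, (h.connCoeff i j k - h.connCoeff j i k) * h.deriv k f := by
  refine smoothAlgebra_ext (fun y hy ↦ ?_) fun y hy ↦ ?_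
  · have h1 : ∀ i j, ev y (h.deriv i (h.deriv j f)) = d% (fun z ↦ d% f.1 z (e j z)) y (e i y) :=
      fun i j ↦ h.ev_deriv_restr i (h.smooth_dir f.2 (h.smooth j)) hy
    rw [map_sub, h1, h1, ← h.mvfderiv_mlieBracket f.2 (h.smooth i) (h.smooth j) hy,
      h.mvfderiv_apply_eq_sum hy, map_sum]
    refine Finset.sum_congr rfl fun k _ ↦ ?_
    rw [map_mul, map_sub, h.ev_deriv k f hy, h.ev_connCoeff _ _ _ hy, h.ev_connCoeff _ _ _ hy,
      mlieBracket_eq ((h.smooth i).mdiff hy) ((h.smooth j).mdiff hy), inner_sub_right]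
  · simp only [map_sub, map_sum, map_mul, h.ev_deriv_notMem _ _ hy, mul_zero, Finset.sum_const_zero,
      sub_zero]

theorem coeff_frame_mlieBracket (h : IsOrthonormalFrameOn e U) {Y : Π x : M, TangentSpace I x}
    (hY : SmoothField U Y) (m p : ι) :
    h.coeff ((h.smooth m).mlieBracket hY) p = h.deriv m (h.coeff hY p)
      + ∑ q, h.coeff hY q * (h.connCoeff m q p - h.connCoeff q m p) := by
  classical
  refine smoothAlgebra_ext (fun y hy ↦ ?_) fun y hy ↦ ?_
  · rw [h.ev_coeff _ p hy, mlieBracket_eq ((h.smooth m).mdiff hy) (hY.mdiff hy), inner_sub_right,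
      h.inner_leviCivita hY hy, h.leviCivita_apply_eq_sum hy (e m), inner_sum, map_add, map_sum,
      coeff, h.ev_deriv_restr m _ hy, add_sub_assoc, ← Finset.sum_sub_distrib]
    congr 1
    refine Finset.sum_congr rfl fun q _ ↦ ?_
    rw [map_mul, map_sub, h.ev_coeff hY q hy, real_inner_smul_right, h.ev_connCoeff q m p hy]
    ring
  · simp only [map_add, map_sum, map_mul, h.ev_deriv_notMem _ _ hy, h.ev_coeff_notMem _ _ hy,
      zero_mul, Finset.sum_const_zero, add_zero]

theorem jacobi (h : IsOrthonormalFrameOn e U) (m i j p : ι) :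
    h.coeff ((h.smooth m).mlieBracket ((h.smooth i).mlieBracket (h.smooth j))) p
      + h.coeff ((h.smooth i).mlieBracket ((h.smooth j).mlieBracket (h.smooth m))) p
      + h.coeff ((h.smooth j).mlieBracket ((h.smooth m).mlieBracket (h.smooth i))) p = 0 := by
  refine smoothAlgebra_ext (fun y hy ↦ ?_) fun y hy ↦ ?_
  · simp only [map_add, map_zero, h.ev_coeff _ _ hy, ← inner_add_right]
    have h1 := mlieBracket_jacobi (h.smooth m) (h.smooth i) (h.smooth j) hy
    have h2 : mlieBracket I (e j) (mlieBracket I (e m) (e i)) y =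
        -mlieBracket I (mlieBracket I (e m) (e i)) (e j) y := mlieBracket_swap_apply
    have h3 : mlieBracket I (e i) (mlieBracket I (e j) (e m)) y =
        -mlieBracket I (e i) (mlieBracket I (e m) (e j)) y := by
      rw [mlieBracket_swap (V := e j) (W := e m), ← neg_one_smul ℝ (mlieBracket I (e m) (e j)),
        mlieBracket_const_smul_right (((h.smooth m).mlieBracket (h.smooth j)).mdiff hy),
        neg_one_smul]
    rw [h1, h2, h3]
    simp
  · simp only [map_add, map_zero, h.ev_coeff_notMem _ _ hy, add_zero]

/-- The algebraic data of the Levi-Civita connection in an orthonormal frame. -/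
def toFrameConnection (h : IsOrthonormalFrameOn e U) : FrameConnection ι (smoothAlgebra I U) where
  D := h.deriv
  Γ := h.connCoeff
  antisymm := h.connCoeff_antisymm
  commutator := h.deriv_commutator
  jacobi m i j p := by
    have := h.jacobi m i j p
    rw [h.coeff_frame_mlieBracket ((h.smooth i).mlieBracket (h.smooth j)),
      h.coeff_frame_mlieBracket ((h.smooth j).mlieBracket (h.smooth m)),
      h.coeff_frame_mlieBracket ((h.smooth m).mlieBracket (h.smooth i))] at this
    simp only [h.coeff_mlieBracket (h.smooth _) (h.smooth _)] at this
    exact this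

end IsOrthonormalFrameOn

end FrameAlgebra

end RiemannianGeometry

end

noncomputable section

namespace RiemannianGeometry

/-! ### The curvature of M in frame components -/

section FrameCurvature

set_option linter.unusedSectionVars false

variable {E : Type*} [NormedAddCommGroup E] [NormedSpace ℝ E] [FiniteDimensional ℝ E]
  [CompleteSpace E]
  {H : Type*} [TopologicalSpace H] {I : ModelWithCorners ℝ E H}
  {M : Type*} [TopologicalSpace M] [ChartedSpace H M] [IsManifold I ∞ M]
  [RiemannianBundle (fun x : M ↦ TangentSpace I x)]
  [IsContMDiffRiemannianBundle I ∞ E (fun x : M ↦ TangentSpace I x)]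
  {U : Set M}

variable (I) in
theorem exists_smoothField_extend (y : M) (v : TangentSpace I y) :
    ∃ s : Set M, IsOpen s ∧ y ∈ s ∧ SmoothField s (FiberBundle.extend E v : Π x : M, TangentSpace I x) := by
  obtain ⟨s, hs, h⟩ := FiberBundle.exists_contMDiffOn_extend (k := ∞) I E v
  exact ⟨interior s, isOpen_interior, mem_interior_iff_mem_nhds.mpr hs, fun z hz ↦
    h.contMDiffAt (mem_interior_iff_mem_nhds.mp hz)⟩

theorem SmoothField.mono {X : Π x : M, TangentSpace I x} (hX : SmoothField U X) {U' : Set M}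
    (h : U' ⊆ U) : SmoothField U' X := fun y hy ↦ hX y (h hy)

namespace IsOrthonormalFrameOn

variable {ι : Type*} [Fintype ι] [Nonempty ι] {e : ι → Π x : M, TangentSpace I x}

theorem coeff_leviCivita_eq_cov (h : IsOrthonormalFrameOn e U) {X Y : Π x : M, TangentSpace I x}
    (hX : SmoothField U X) (hY : SmoothField U Y) :
    h.coeff (h.smooth_leviCivita hX hY) = h.toFrameConnection.cov (h.coeff hX) (h.coeff hY) :=
  funext fun k ↦ h.coeff_leviCivita hX hY k

/-- This is `cov_commutator` evaluated at y: as torsion vanishes, [X, Y] has components `cov a b -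
cov b a`. -/
theorem inner_curvatureField (h : IsOrthonormalFrameOn e U) {X Y Z : Π x : M, TangentSpace I x}
    (hX : SmoothField U X) (hY : SmoothField U Y) (hZ : SmoothField U Z) {y : M} (hy : y ∈ U)
    (k : ι) :
    inner ℝ (e k y) (curvatureField X Y Z y) = ∑ i, ∑ j, ∑ l, inner ℝ (e i y) (X y) *
      inner ℝ (e j y) (Y y) * inner ℝ (e l y) (Z y) * ev y (h.toFrameConnection.curv i j k l) := by
  have h1 := congrArg (ev y) (h.toFrameConnection.cov_commutator (h.coeff hX) (h.coeff hY)
    (h.coeff hZ) k)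
  have h2 : (fun q ↦ h.toFrameConnection.cov (h.coeff hX) (h.coeff hY) q
      - h.toFrameConnection.cov (h.coeff hY) (h.coeff hX) q) = h.coeff (hX.mlieBracket hY) := by
    rw [← h.coeff_leviCivita_eq_cov hX hY, ← h.coeff_leviCivita_eq_cov hY hX]
    exact funext fun q ↦ (h.coeff_mlieBracket hX hY q).symm
  rw [h2, ← h.coeff_leviCivita_eq_cov hX hZ, ← h.coeff_leviCivita_eq_cov hY hZ,
    ← h.coeff_leviCivita_eq_cov, ← h.coeff_leviCivita_eq_cov, ← h.coeff_leviCivita_eq_cov] at h1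
  simp only [map_sub, map_sum, map_mul, h.ev_coeff _ _ hy] at h1
  rw [curvatureField, inner_sub_right, inner_sub_right]
  exact h1

theorem smoothField_sum (h : IsOrthonormalFrameOn e U) (a : ι → ℝ) :
    SmoothField U (fun y ↦ ∑ i, a i • e i y) :=
  SmoothField.sum fun i ↦ SmoothField.smul (f := fun _ ↦ a i) (SmoothFun.const _) (h.smooth i)

theorem Rm_eq (h : IsOrthonormalFrameOn e U) {y : M} (hy : y ∈ U) (u v z w : TangentSpace I y) :
    Rm y u v z w = ∑ i, ∑ j, ∑ k, ∑ l, inner ℝ (e i y) u * inner ℝ (e j y) v *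
      inner ℝ (e k y) z * inner ℝ (e l y) w * ev y (h.toFrameConnection.curv i j k l) := by
  -- Tensoriality allows the extensions chosen in `curvature` to be replaced by constant
  -- combinations of frame fields. The comparison takes place on a smaller open set on which all
  -- extensions are smooth.
  have key : curvature y u v w = curvatureField (fun x ↦ ∑ i, inner ℝ (e i y) u • e i x)
      (fun x ↦ ∑ i, inner ℝ (e i y) v • e i x) (fun x ↦ ∑ i, inner ℝ (e i y) w • e i x) y := by
    obtain ⟨s₁, o₁, m₁, h₁⟩ := exists_smoothField_extend I y u
    obtain ⟨s₂, o₂, m₂, h₂⟩ := exists_smoothField_extend I y v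
    obtain ⟨s₃, o₃, m₃, h₃⟩ := exists_smoothField_extend I y w
    have hU' : IsOpen (U ∩ (s₁ ∩ (s₂ ∩ s₃))) :=
      h.isOpen.inter (o₁.inter (o₂.inter o₃))
    have h' := h.mono hU' Set.inter_subset_left
    have hy' : y ∈ U ∩ (s₁ ∩ (s₂ ∩ s₃)) := ⟨hy, m₁, m₂, m₃⟩
    refine h'.ext_inner hy' fun k ↦ ?_
    rw [curvature, h'.inner_curvatureField (h₁.mono fun z hz ↦ hz.2.1)
      (h₂.mono fun z hz ↦ hz.2.2.1) (h₃.mono fun z hz ↦ hz.2.2.2) hy' k,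
      h'.inner_curvatureField ((h.smoothField_sum _).mono Set.inter_subset_left)
        ((h.smoothField_sum _).mono Set.inter_subset_left)
        ((h.smoothField_sum _).mono Set.inter_subset_left) hy' k]
    simp only [FiberBundle.extend_apply_self, h.sum_inner_smul hy]
  rw [Rm, key, real_inner_comm, h.sum_inner_mul hy z]
  simp only [h.inner_curvatureField (h.smoothField_sum _) (h.smoothField_sum _)
    (h.smoothField_sum _) hy, h.sum_inner_smul hy, Finset.mul_sum]
  rw [← sum_comm₂ fun i j k ↦ ∑ l, inner ℝ (e k y) z * (inner ℝ (e i y) u *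
      inner ℝ (e j y) v * inner ℝ (e l y) w * ev y (h.toFrameConnection.curv i j k l))]
  exact Finset.sum_congr rfl fun i _ ↦ Finset.sum_congr rfl fun j _ ↦
      Finset.sum_congr rfl fun k _ ↦ Finset.sum_congr rfl fun l _ ↦ by ring

theorem Rm_eq_eval₄ (h : IsOrthonormalFrameOn e U) {X Y Z W : Π x : M, TangentSpace I x}
    (hX : SmoothField U X) (hY : SmoothField U Y) (hZ : SmoothField U Z) (hW : SmoothField U W)
    {y : M} (hy : y ∈ U) :
    Rm y (X y) (Y y) (Z y) (W y) = ev y (FrameConnection.eval₄ h.toFrameConnection.curv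
      (h.coeff hX) (h.coeff hY) (h.coeff hZ) (h.coeff hW)) := by
  rw [h.Rm_eq hy]
  simp only [FrameConnection.eval₄, map_sum, map_mul, h.ev_coeff _ _ hy]

theorem covDerivRm_eq (h : IsOrthonormalFrameOn e U) {V X Y Z W : Π x : M, TangentSpace I x}
    (hV : SmoothField U V) (hX : SmoothField U X) (hY : SmoothField U Y) (hZ : SmoothField U Z)
    (hW : SmoothField U W) {y : M} (hy : y ∈ U) :
    covDerivRm V X Y Z W y = ∑ m, inner ℝ (e m y) (V y) *
      ev y (FrameConnection.eval₄ (h.toFrameConnection.nabla m h.toFrameConnection.curv)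
      (h.coeff hX) (h.coeff hY) (h.coeff hZ) (h.coeff hW)) := by
  have h1 := congrArg (ev y) (h.toFrameConnection.cov_eval₄ (h.coeff hV) (h.coeff hX) (h.coeff hY)
    (h.coeff hZ) (h.coeff hW) h.toFrameConnection.curv)
  rw [← h.coeff_leviCivita_eq_cov hV hX, ← h.coeff_leviCivita_eq_cov hV hY,
    ← h.coeff_leviCivita_eq_cov hV hZ, ← h.coeff_leviCivita_eq_cov hV hW] at h1
  simp only [map_add] at h1
  rw [← h.Rm_eq_eval₄ _ _ _ _ hy, ← h.Rm_eq_eval₄ _ _ _ _ hy, ← h.Rm_eq_eval₄ _ _ _ _ hy,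
    ← h.Rm_eq_eval₄ _ _ _ _ hy, map_sum, map_sum] at h1
  simp only [map_mul, h.ev_coeff _ _ hy] at h1
  have h2 : d% (fun y ↦ Rm y (X y) (Y y) (Z y) (W y)) y (V y) = ∑ m, inner ℝ (e m y) (V y) *
      ev y (h.toFrameConnection.D m (FrameConnection.eval₄ h.toFrameConnection.curv
      (h.coeff hX) (h.coeff hY) (h.coeff hZ) (h.coeff hW))) := by
    rw [mvfderiv_congr_on h.isOpen (fun z hz ↦ h.Rm_eq_eval₄ hX hY hZ hW hz) hy,
      h.mvfderiv_apply_eq_sum hy]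
    exact Finset.sum_congr rfl fun m _ ↦ congrArg _ (h.ev_deriv m _ hy).symm
  rw [covDerivRm, h2, h1]
  ring

end IsOrthonormalFrameOn

/-! ### Basis independence of the tensor norm -/

section Parseval

variable {V : Type*} [NormedAddCommGroup V] [InnerProductSpace ℝ V] {ι κ : Type*} [Fintype ι]
  [Fintype κ]

theorem sum_sum_inner_mul_sq (b : OrthonormalBasis κ ℝ V) (e : OrthonormalBasis ι ℝ V)
    (t : ι → ℝ) : ∑ a, (∑ i, inner ℝ (e i) (b a) * t i) ^ 2 = ∑ i, t i ^ 2 := by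
  have h1 : ∀ a, ∑ i, inner ℝ (e i) (b a) * t i = inner ℝ (∑ i, t i • e i) (b a) := fun a ↦ by
    simp only [sum_inner, real_inner_smul_left, mul_comm]
  have h2 : ∑ a, inner ℝ (∑ i, t i • e i) (b a) ^ 2 = ‖∑ i, t i • e i‖ ^ 2 := by
    rw [← b.sum_sq_norm_inner_left]
    simp
  simp only [h1, h2]
  rw [← e.sum_sq_norm_inner_right]
  classical
  simp [inner_sum, real_inner_smul_right, orthonormal_iff_ite.mp e.orthonormal]

theorem sum_sum_sum_inner_mul_sq {β : Type*} [Fintype β] (b : OrthonormalBasis κ ℝ V)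
    (e : OrthonormalBasis ι ℝ V) (t : ι → β → ℝ) :
    ∑ a, ∑ c, (∑ i, inner ℝ (e i) (b a) * t i c) ^ 2 = ∑ i, ∑ c, t i c ^ 2 := by
  rw [Finset.sum_comm]
  simp only [sum_sum_inner_mul_sq b e]
  rw [Finset.sum_comm]

/-- The norm of a four-tensor does not depend on the orthonormal basis. -/
theorem sum_sq_eq_of_expansion (b : OrthonormalBasis κ ℝ V) (e : OrthonormalBasis ι ℝ V)
    {R : V → V → V → V → ℝ} {r : ι → ι → ι → ι → ℝ}
    (hR : ∀ u v z w, R u v z w = ∑ i, ∑ j, ∑ k, ∑ l,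
      inner ℝ (e i) u * inner ℝ (e j) v * inner ℝ (e k) z * inner ℝ (e l) w * r i j k l) :
    ∑ a₁, ∑ a₂, ∑ a₃, ∑ a₄, R (b a₁) (b a₂) (b a₃) (b a₄) ^ 2 =
      ∑ i, ∑ j, ∑ k, ∑ l, r i j k l ^ 2 := by
  have parseval₃ : ∀ f : ι → κ → κ → κ → ℝ, ∑ a, ∑ b₁, ∑ b₂, ∑ b₃,
      (∑ i, inner ℝ (e i) (b a) * f i b₁ b₂ b₃) ^ 2 = ∑ i, ∑ b₁, ∑ b₂, ∑ b₃, f i b₁ b₂ b₃ ^ 2 :=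
    fun f ↦ by
      have := sum_sum_sum_inner_mul_sq b e fun i (p : κ × κ × κ) ↦ f i p.1 p.2.1 p.2.2
      simpa only [Fintype.sum_prod_type] using this
  have parseval₂ : ∀ f : ι → κ → κ → ℝ, ∑ a, ∑ b₁, ∑ b₂,
      (∑ i, inner ℝ (e i) (b a) * f i b₁ b₂) ^ 2 = ∑ i, ∑ b₁, ∑ b₂, f i b₁ b₂ ^ 2 :=
    fun f ↦ by
      have := sum_sum_sum_inner_mul_sq b e fun i (p : κ × κ) ↦ f i p.1 p.2
      simpa only [Fintype.sum_prod_type] using this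
  have parseval₁ := sum_sum_sum_inner_mul_sq (β := κ) b e
  simp only [hR, mul_assoc, ← Finset.mul_sum]
  simp only [parseval₃, parseval₂, parseval₁, sum_sum_inner_mul_sq b e]

end Parseval

end FrameCurvature

end RiemannianGeometry

end

noncomputable section

namespace RiemannianGeometry

/-! ### The Laplacian of the squared curvature norm -/

section LaplacianEstimate

set_option linter.unusedSectionVars false

variable {E : Type*} [NormedAddCommGroup E] [NormedSpace ℝ E] [FiniteDimensional ℝ E]
  [CompleteSpace E]
  {H : Type*} [TopologicalSpace H] {I : ModelWithCorners ℝ E H}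
  {M : Type*} [TopologicalSpace M] [ChartedSpace H M] [IsManifold I ∞ M]
  [RiemannianBundle (fun x : M ↦ TangentSpace I x)]
  [IsContMDiffRiemannianBundle I ∞ E (fun x : M ↦ TangentSpace I x)]
  {U : Set M}

variable (I) in
/-- The squared norm of the curvature tensor. -/
def curvNormSq (x : M) : ℝ :=
  ∑ a₁, ∑ a₂, ∑ a₃, ∑ a₄, Rm x (stdOrthonormalBasis ℝ (TangentSpace I x) a₁)
    (stdOrthonormalBasis ℝ (TangentSpace I x) a₂) (stdOrthonormalBasis ℝ (TangentSpace I x) a₃)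
    (stdOrthonormalBasis ℝ (TangentSpace I x) a₄) ^ 2

theorem map_act {ι A B : Type*} [Fintype ι] [CommRing A] [CommRing B] [Algebra ℝ A] [Algebra ℝ B]
    (φ : A →ₐ[ℝ] B) (L : ι → ι → A) (T : ι → ι → ι → ι → A) (i j k l : ι) :
    φ (act L T i j k l) = act (fun i j ↦ φ (L i j)) (fun i j k l ↦ φ (T i j k l)) i j k l := by
  simp only [act, map_add, map_sum, map_mul]

theorem map_inner₄ {ι A B : Type*} [Fintype ι] [CommRing A] [CommRing B] [Algebra ℝ A]
    [Algebra ℝ B] (φ : A →ₐ[ℝ] B) (S T : ι → ι → ι → ι → A) :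
    φ (inner₄ S T) = inner₄ (fun i j k l ↦ φ (S i j k l)) (fun i j k l ↦ φ (T i j k l)) := by
  simp only [inner₄, map_sum, map_mul]

namespace IsOrthonormalFrameOn

variable {ι : Type*} [Fintype ι] [Nonempty ι] {e : ι → Π x : M, TangentSpace I x}

/-- The components of the curvature tensor at a point. -/
def curvAt (h : IsOrthonormalFrameOn e U) (y : M) (i j k l : ι) : ℝ :=
  ev y (h.toFrameConnection.curv i j k l)

theorem ev_curv_notMem (h : IsOrthonormalFrameOn e U) (i j k l : ι) {y : M} (hy : y ∉ U) :
    ev y (h.toFrameConnection.curv i j k l) = 0 := by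
  have h1 : ∀ i (f : smoothAlgebra I U), ev y (h.toFrameConnection.D i f) = 0 := fun i f ↦
    h.ev_deriv_notMem i f hy
  have h2 : ∀ i j k, ev y (h.toFrameConnection.Γ i j k) = 0 := fun i j k ↦
    h.ev_connCoeff_notMem i j k hy
  simp [FrameConnection.curv, FrameConnection.curvMatrix, map_sub, map_sum, h1, h2]

/-- The standard bases of the tangent spaces need not vary smoothly with the point. Basis
independence moves the sum to the smooth frame. -/
theorem curvNormSq_eq (h : IsOrthonormalFrameOn e U) {y : M} (hy : y ∈ U) :
    curvNormSq I y = ev y (inner₄ h.toFrameConnection.curv h.toFrameConnection.curv) := by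
  obtain ⟨b, hb⟩ := h.basis y hy
  rw [curvNormSq, sum_sq_eq_of_expansion (stdOrthonormalBasis ℝ (TangentSpace I y)) b
    (r := h.curvAt y) (fun u v z w ↦ by simp only [hb]; exact h.Rm_eq hy u v z w)]
  simp only [inner₄, sq, map_sum, map_mul]
  rfl

theorem smooth_curvNormSq (h : IsOrthonormalFrameOn e U) : SmoothFun I U (curvNormSq I) :=
  SmoothFun.congr h.isOpen (inner₄ h.toFrameConnection.curv h.toFrameConnection.curv).2
    fun _ hy ↦ h.curvNormSq_eq hy

theorem ricci_frame (h : IsOrthonormalFrameOn e U) {y : M} (hy : y ∈ U) (j l : ι) :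
    ricci y (e j y) (e l y) = ∑ i, ev y (h.toFrameConnection.curv i j i l) := by
  classical
  have h1 : ∀ a : TangentSpace I y, Rm y a (e j y) a (e l y) = ∑ i, ∑ k,
      (inner ℝ (e i y) a * inner ℝ a (e k y)) * ev y (h.toFrameConnection.curv i j k l) := fun a ↦ by
    rw [h.Rm_eq hy]
    simp [h.inner_eq hy, real_inner_comm]
  simp only [ricci, h1]
  rw [← sum_comm₂]
  simp only [← Finset.sum_mul, OrthonormalBasis.sum_inner_mul_inner, h.inner_eq hy]
  simp

/-- The constant function with value `c` on `U`. -/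
def constOn (h : IsOrthonormalFrameOn e U) (c : ℝ) : smoothAlgebra I U :=
  restr h.isOpen (fun _ ↦ c) (SmoothFun.const c)

theorem deriv_congr (h : IsOrthonormalFrameOn e U) {f g : smoothAlgebra I U}
    (hfg : ∀ y ∈ U, f.1 y = g.1 y) (i : ι) : h.deriv i f = h.deriv i g :=
  smoothAlgebra_ext (fun y hy ↦ by
      rw [h.ev_deriv i _ hy, h.ev_deriv i _ hy, mvfderiv_congr_on h.isOpen hfg hy])
    fun y hy ↦ by rw [h.ev_deriv_notMem i _ hy, h.ev_deriv_notMem i _ hy]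

theorem deriv_constOn (h : IsOrthonormalFrameOn e U) (c : ℝ) (i : ι) :
    h.deriv i (h.constOn c) = 0 := by
  rw [h.deriv_congr (g := algebraMap ℝ _ c) (fun y hy ↦
    (ev_restr h.isOpen (SmoothFun.const c) hy : ev y (h.constOn c) = c))]
  exact Derivation.map_algebraMap _ _

theorem laplacian_congr (h : IsOrthonormalFrameOn e U) {f g : smoothAlgebra I U}
    (hfg : ∀ y ∈ U, f.1 y = g.1 y) :
    h.toFrameConnection.laplacian f = h.toFrameConnection.laplacian g := by
  have h1 : ∀ i, h.toFrameConnection.D i f = h.toFrameConnection.D i g := h.deriv_congr hfg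
  simp only [FrameConnection.laplacian, h1]

/-- For the identity to hold in the whole algebra, the constant is cut off outside U, where the
curvature components are zero as well; its frame derivatives still vanish. -/
theorem einstein_curv [DecidableEq ι] (h : IsOrthonormalFrameOn e U) {c : ℝ}
    (hE : ∀ (x : M) (u v : TangentSpace I x), ricci x u v = c * inner ℝ u v) (j l : ι) :
    ∑ i, h.toFrameConnection.curv i j i l = if j = l then h.constOn c else 0 := by
  refine smoothAlgebra_ext (fun y hy ↦ ?_) fun y hy ↦ ?_
  · rw [map_sum, ← h.ricci_frame hy, hE, h.inner_eq hy]
    split_ifs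
    · rw [constOn, ev_restr h.isOpen _ hy, mul_one]
    · simp
  · rw [map_sum]
    simp only [h.ev_curv_notMem _ _ _ _ hy, Finset.sum_const_zero]
    split_ifs
    · rw [constOn, ev_restr_notMem h.isOpen _ hy]
    · simp

theorem laplacian_curvNormSq [DecidableEq ι] (h : IsOrthonormalFrameOn e U) {c : ℝ}
    (hE : ∀ (x : M) (u v : TangentSpace I x), ricci x u v = c * inner ℝ u v) {y : M} (hy : y ∈ U) :
    ∃ (N : ℕ) (lam : Fin N → ℝ) (Ξ : Fin N → Matrix ι ι ℝ),
      IsBivectorEigenbasis (h.curvAt y) lam Ξ ∧ Monotone lam ∧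
      (∀ k, lowestEigenvalueSum I y k = lowestSum lam k) ∧
      ev y (h.toFrameConnection.laplacian ⟨curvNormSq I, h.smooth_curvNormSq⟩) =
        2 * ∑ m, inner₄ (fun i j k l ↦
          ev y (h.toFrameConnection.nabla m h.toFrameConnection.curv i j k l))
          (fun i j k l ↦ ev y (h.toFrameConnection.nabla m h.toFrameConnection.curv i j k l))
        + 4 * curvatureEnergy Ξ lam := by
  obtain ⟨b, hb⟩ := h.basis y hy
  obtain ⟨N, lam, Ξ, hΞ, hmono, hlow⟩ := exists_isBivectorEigenbasis b (r := h.curvAt y)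
    (R := Rm (I := I) y)
    (fun i j k l ↦ by
      rw [curvAt, FrameConnection.curv_swap_left, map_neg]; rfl)
    (fun i j k l ↦ by
      rw [curvAt, FrameConnection.curv_swap_right, map_neg]; rfl)
    (fun i j k l ↦ by
      rw [curvAt, FrameConnection.curv_pair_symm]; rfl)
    (fun u v z w ↦ by simp only [hb]; exact h.Rm_eq hy u v z w)
  refine ⟨N, lam, Ξ, hΞ, hmono, hlow, ?_⟩
  rw [h.laplacian_congr (g := inner₄ h.toFrameConnection.curv h.toFrameConnection.curv)
    fun y hy ↦ h.curvNormSq_eq hy, h.toFrameConnection.bochner (h.deriv_constOn c)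
    (h.einstein_curv hE)]
  have hq := hΞ.inner₄_quadratic
  simp only [map_add, map_mul, map_ofNat, map_sum, map_inner₄, map_act]
  have : ∀ x : ℝ, 4 * x = 2 * (2 * x) := fun x ↦ by ring
  rw [this, ← hq]
  rfl

end IsOrthonormalFrameOn

end LaplacianEstimate

end RiemannianGeometry

end

noncomputable section

namespace RiemannianGeometry

/-! ### Derivative tests at a local maximum -/

section LocalMaximum

set_option linter.unusedSectionVars false

variable {E : Type*} [NormedAddCommGroup E] [NormedSpace ℝ E] [FiniteDimensional ℝ E]
  [CompleteSpace E]
  {H : Type*} [TopologicalSpace H] {I : ModelWithCorners ℝ E H}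
  {M : Type*} [TopologicalSpace M] [ChartedSpace H M] [IsManifold I ∞ M]
  [RiemannianBundle (fun x : M ↦ TangentSpace I x)]
  [IsContMDiffRiemannianBundle I ∞ E (fun x : M ↦ TangentSpace I x)]
  {U : Set M}

theorem hasDerivAt_comp_curve {γ : ℝ → M} {t : ℝ} {v : TangentSpace I (γ t)} {f : M → ℝ}
    (hf : MDiffAt f (γ t))
    (hγ : HasMFDerivAt 𝓘(ℝ, ℝ) I γ t ((1 : ℝ →L[ℝ] ℝ).smulRight v)) :
    HasDerivAt (f ∘ γ) (d% f (γ t) v) t := by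
  let L : ℝ →L[ℝ] ℝ := (mfderiv I 𝓘(ℝ, ℝ) f (γ t)).comp ((1 : ℝ →L[ℝ] ℝ).smulRight v)
  have h : HasFDerivAt (f ∘ γ) L t := hasMFDerivAt_iff_hasFDerivAt.mp (hf.hasMFDerivAt.comp t hγ)
  have hL : ContinuousLinearMap.toSpanSingleton ℝ (d% f (γ t) v) = L := by
    ext
    change (1 : ℝ) * (d% f (γ t) v) = (mfderiv I 𝓘(ℝ, ℝ) f (γ t) ((1 : ℝ) • v) : ℝ)
    rw [one_smul, one_mul]
    rfl
  rw [hasDerivAt_iff_hasFDerivAt, hL]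
  exact h

/-- A positive second derivative at the critical point would make it a local minimum as well, so φ
would be locally constant with second derivative zero. -/
theorem nonpos_of_isLocalMax {φ : ℝ → ℝ} {t : ℝ} (hmax : IsLocalMax φ t) (hc : ContinuousAt φ t) :
    deriv (deriv φ) t ≤ 0 := by
  by_contra! h
  have hmin := isLocalMin_of_deriv_deriv_pos h hmax.deriv_eq_zero hc
  have he : φ =ᶠ[nhds t] fun _ ↦ φ t := by
    filter_upwards [hmax, hmin] with s h1 h2
    exact le_antisymm h1 h2
  have h2 : deriv (deriv φ) t = 0 := by
    rw [he.deriv.deriv_eq]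
    simp
  exact h.ne' h2

namespace IsOrthonormalFrameOn

variable {ι : Type*} [Fintype ι] [Nonempty ι] {e : ι → Π x : M, TangentSpace I x}

/-- Along an integral curve of the frame field the derivation becomes d/dt, so the one-variable
tests apply. At such a critical point the connection terms of the Laplacian drop out. -/
theorem ev_deriv_of_isLocalMax [T2Space M] [BoundarylessManifold I M]
    (h : IsOrthonormalFrameOn e U) {g : smoothAlgebra I U}
    {y : M} (hy : y ∈ U) (hmax : IsLocalMax g.1 y) (i : ι) :
    ev y (h.deriv i g) = 0 ∧ ev y (h.deriv i (h.deriv i g)) ≤ 0 := by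
  obtain ⟨γ, hγ0, hγ⟩ := exists_isMIntegralCurveAt_of_contMDiffAt_boundaryless (I := I) (t₀ := 0)
    ((h.smooth i y hy).of_le (by simp : (1 : WithTop ℕ∞) ≤ ∞))
  subst hγ0
  have hcont : ContinuousAt γ 0 := hγ.continuousAt
  have hU : ∀ᶠ t in nhds (0 : ℝ), γ t ∈ U := hcont.eventually_mem (h.isOpen.mem_nhds hy)
  have key : ∀ f : smoothAlgebra I U, ∀ᶠ t in nhds (0 : ℝ),
      HasDerivAt (f.1 ∘ γ) (ev (γ t) (h.deriv i f)) t := fun f ↦ by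
    filter_upwards [hU, hγ] with t ht hd
    rw [h.ev_deriv i f ht]
    exact hasDerivAt_comp_curve (f.2.mdiff ht) hd
  have hd : _root_.deriv (g.1 ∘ γ) =ᶠ[nhds 0] (h.deriv i g).1 ∘ γ := by
    filter_upwards [key g] with t ht
    exact ht.deriv
  have hmax' : IsLocalMax (g.1 ∘ γ) 0 := hcont.eventually hmax
  constructor
  · rw [← (key g).self_of_nhds.deriv]
    exact hmax'.deriv_eq_zero
  · rw [← (key (h.deriv i g)).self_of_nhds.deriv, ← hd.deriv_eq]
    exact nonpos_of_isLocalMax hmax' (key g).self_of_nhds.continuousAt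

theorem ev_laplacian_of_isLocalMax [T2Space M] [BoundarylessManifold I M]
    (h : IsOrthonormalFrameOn e U) {g : smoothAlgebra I U}
    {y : M} (hy : y ∈ U) (hmax : IsLocalMax g.1 y) :
    ev y (h.toFrameConnection.laplacian g) ≤ 0 := by
  have h1 : ∀ i, ev y (h.toFrameConnection.D i g) = 0 := fun i ↦
    (h.ev_deriv_of_isLocalMax hy hmax i).1
  have h2 : ∀ i, ev y (h.toFrameConnection.D i (h.toFrameConnection.D i g)) ≤ 0 := fun i ↦
    (h.ev_deriv_of_isLocalMax hy hmax i).2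
  simp only [FrameConnection.laplacian, map_sum, map_sub, map_mul, h1, mul_zero,
    Finset.sum_const_zero, sub_zero]
  exact Finset.sum_nonpos fun i _ ↦ h2 i

/-- The exponential of a smooth function. -/
def expFun (p : smoothAlgebra I U) : smoothAlgebra I U :=
  ⟨fun y ↦ Real.exp (p.1 y), fun y hy ↦
    Real.contDiff_exp.contDiffAt.contMDiffAt.comp y (p.2 y hy)⟩

theorem deriv_expFun (h : IsOrthonormalFrameOn e U) (p : smoothAlgebra I U) (i : ι) :
    h.deriv i (expFun p) = expFun p * h.deriv i p := by
  refine smoothAlgebra_ext (fun y hy ↦ ?_) fun y hy ↦ ?_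
  · rw [map_mul, h.ev_deriv i _ hy, h.ev_deriv i _ hy]
    have h1 := ((Real.hasDerivAt_exp (p.1 y)).hasFDerivAt.hasMFDerivAt).comp y
      (p.2.mdiff hy).hasMFDerivAt
    have h2 : (mfderiv I 𝓘(ℝ, ℝ) (Real.exp ∘ p.1) y (e i y) : ℝ) = _ :=
      congrArg (fun L ↦ L (e i y)) h1.mfderiv
    refine h2.trans ?_
    change @HMul.hMul ℝ ℝ ℝ _ (mfderiv I 𝓘(ℝ, ℝ) p.1 y (e i y)) (Real.exp (p.1 y)) = _
    rw [mul_comm]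
    rfl
  · rw [map_mul, h.ev_deriv_notMem i _ hy, h.ev_deriv_notMem i _ hy, mul_zero]

theorem laplacian_expFun (h : IsOrthonormalFrameOn e U) (p : smoothAlgebra I U) :
    h.toFrameConnection.laplacian (expFun p) = expFun p *
      (∑ m, h.deriv m p * h.deriv m p + h.toFrameConnection.laplacian p) := by
  have h1 : ∀ i, h.toFrameConnection.D i (expFun p) = expFun p * h.toFrameConnection.D i p :=
    h.deriv_expFun p
  change _ = expFun p * (∑ m, h.toFrameConnection.D m p * h.toFrameConnection.D m p + _)
  simp only [FrameConnection.laplacian, h1, Derivation.leibniz, smul_eq_mul]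
  rw [← Finset.sum_add_distrib, Finset.mul_sum]
  refine Finset.sum_congr rfl fun m _ ↦ ?_
  simp only [mul_left_comm _ (expFun p), ← Finset.mul_sum]
  ring

end IsOrthonormalFrameOn

end LocalMaximum

end RiemannianGeometry

end

noncomputable section

namespace RiemannianGeometry

/-! ### Barriers and the Hopf argument -/

section MaximumPrinciple

set_option linter.unusedSectionVars false

variable {E : Type*} [NormedAddCommGroup E] [InnerProductSpace ℝ E] [FiniteDimensional ℝ E]
  [CompleteSpace E]
  {H : Type*} [TopologicalSpace H] {I : ModelWithCorners ℝ E H}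
  {M : Type*} [TopologicalSpace M] [ChartedSpace H M] [IsManifold I ∞ M]
  [RiemannianBundle (fun x : M ↦ TangentSpace I x)]
  [IsContMDiffRiemannianBundle I ∞ E (fun x : M ↦ TangentSpace I x)]
  {U : Set M}

theorem continuousOn_smoothAlgebra (f : smoothAlgebra I U) {K : Set M} (hK : K ⊆ U) :
    ContinuousOn f.1 K := fun y hy ↦ (f.2 y (hK hy)).continuousAt.continuousWithinAt

namespace IsOrthonormalFrameOn

variable {ι : Type*} [Fintype ι] [Nonempty ι] {e : ι → Π x : M, TangentSpace I x}

theorem laplacian_add (h : IsOrthonormalFrameOn e U) (f g : smoothAlgebra I U) :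
    h.toFrameConnection.laplacian (f + g) =
      h.toFrameConnection.laplacian f + h.toFrameConnection.laplacian g := by
  simp only [FrameConnection.laplacian, map_add, mul_add, Finset.sum_add_distrib,
    Finset.sum_sub_distrib]
  ring

theorem laplacian_smul (h : IsOrthonormalFrameOn e U) (c : ℝ) (f : smoothAlgebra I U) :
    h.toFrameConnection.laplacian (c • f) = c • h.toFrameConnection.laplacian f := by
  simp only [FrameConnection.laplacian, Derivation.map_smul, mul_smul_comm, ← Finset.smul_sum,
    ← smul_sub]

/-- Δe^(-αq) = e^(-αq)(α²|∇q|² - αΔq). On the compact K the gradient term has a positive minimum and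
Δq is bounded above, so a large α suffices. -/
theorem exists_barrier (h : IsOrthonormalFrameOn e U) (q : smoothAlgebra I U) {K : Set M}
    (hK : IsCompact K) (hKU : K ⊆ U) (hq : ∀ y ∈ K, ∃ i, ev y (h.deriv i q) ≠ 0) :
    ∃ α : ℝ, 0 < α ∧ ∀ y ∈ K, 0 < ev y (h.toFrameConnection.laplacian (expFun ((-α) • q))) := by
  rcases K.eq_empty_or_nonempty with rfl | hne
  · exact ⟨1, one_pos, by simp⟩
  set P : smoothAlgebra I U := ∑ m, h.deriv m q * h.deriv m q
  set Q : smoothAlgebra I U := h.toFrameConnection.laplacian q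
  have hP : ∀ y ∈ K, 0 < ev y P := fun y hy ↦ by
    obtain ⟨i, hi⟩ := hq y hy
    simp only [P, map_sum, map_mul]
    exact Finset.sum_pos' (fun m _ ↦ mul_self_nonneg _) ⟨i, Finset.mem_univ i, mul_self_pos.mpr hi⟩
  obtain ⟨y₁, hy₁, hmin⟩ := hK.exists_isMinOn hne (continuousOn_smoothAlgebra P hKU)
  obtain ⟨y₂, hy₂, hmax⟩ := hK.exists_isMaxOn hne (continuousOn_smoothAlgebra Q hKU)
  set P₀ : ℝ := ev y₁ P
  set Q₀ : ℝ := ev y₂ Q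
  have hP₀ : 0 < P₀ := hP y₁ hy₁
  -- This α gives αP₀ = |Q₀| + 1 > Q₀.
  refine ⟨(|Q₀| + 1) / P₀, by positivity, fun y hy ↦ ?_⟩
  set α : ℝ := (|Q₀| + 1) / P₀ with hα
  have hαpos : 0 < α := by positivity
  have h1 : P₀ ≤ ev y P := hmin hy
  have h2 : ev y Q ≤ Q₀ := hmax hy
  have h3 : h.toFrameConnection.laplacian (expFun ((-α) • q)) =
      expFun ((-α) • q) * ((α * α) • P - α • Q) := by
    rw [laplacian_expFun, laplacian_smul]
    congr 1
    have : ∀ m, h.deriv m ((-α) • q) * h.deriv m ((-α) • q) =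
        (α * α) • (h.deriv m q * h.deriv m q) := fun m ↦ by
      rw [Derivation.map_smul, smul_mul_smul_comm, neg_mul_neg]
    simp only [this, ← Finset.smul_sum]
    rw [neg_smul, ← sub_eq_add_neg]
  rw [h3, map_mul, map_sub, map_smul, map_smul]
  have h4 : α * P₀ = |Q₀| + 1 := by rw [hα]; field_simp
  refine mul_pos (Real.exp_pos _) ?_
  simp only [smul_eq_mul]
  have h5 : ev y Q < α * ev y P := by
    have := mul_le_mul_of_nonneg_left h1 hαpos.le
    have := le_abs_self Q₀
    linarith
  have := mul_lt_mul_of_pos_left h5 hαpos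
  linarith

/-- In the application K is a small closed ball around z and S its boundary. Perturb f by a small
multiple of the barrier w = e^(-αq). On S, either f stays a definite amount below m, or q exceeds
q(z) and w is smaller than at z; so f + εw does not reach its maximum over K on S. At an interior
maximum its Laplacian would be at most 0, yet it is positive. -/
theorem hopf [T2Space M] [BoundarylessManifold I M] (h : IsOrthonormalFrameOn e U)
    (f q : smoothAlgebra I U) {K S : Set M} (hK : IsCompact K) (hKU : K ⊆ U)
    (hS : IsCompact S) (hSK : S ⊆ K) (hnhds : ∀ y ∈ K, y ∉ S → K ∈ nhds y)
    (hq : ∀ y ∈ K, ∃ i, ev y (h.deriv i q) ≠ 0)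
    (hf : ∀ y ∈ K, 0 ≤ ev y (h.toFrameConnection.laplacian f)) {m : ℝ}
    (hm : ∀ y ∈ K, f.1 y ≤ m) {z : M} (hz : z ∈ K) (hzm : f.1 z = m)
    (hSm : ∀ y ∈ S, q.1 y ≤ q.1 z → f.1 y < m) : False := by
  obtain ⟨α, hα, hbar⟩ := h.exists_barrier q hK hKU hq
  set w : smoothAlgebra I U := expFun ((-α) • q) with hw
  have hwv : ∀ y, w.1 y = Real.exp (-α * q.1 y) := fun y ↦ rfl
  obtain ⟨y₁, hy₁, hW⟩ := hK.exists_isMaxOn ⟨z, hz⟩ (continuousOn_smoothAlgebra w hKU)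
  have hW₀ : 0 < w.1 y₁ := Real.exp_pos _
  obtain ⟨δ, hδ, hSδ⟩ : ∃ δ : ℝ, 0 < δ ∧ ∀ y ∈ S, q.1 y ≤ q.1 z → f.1 y ≤ m - δ := by
    have hS₁ : IsCompact (S ∩ q.1 ⁻¹' Set.Iic (q.1 z)) :=
      hS.of_isClosed_subset ((continuousOn_smoothAlgebra q
        (hSK.trans hKU)).preimage_isClosed_of_isClosed hS.isClosed isClosed_Iic) Set.inter_subset_left
    rcases (S ∩ q.1 ⁻¹' Set.Iic (q.1 z)).eq_empty_or_nonempty with he | hne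
    · exact ⟨1, one_pos, fun y hy hqy ↦ absurd (he ▸ ⟨hy, hqy⟩ : y ∈ (∅ : Set M)) (by simp)⟩
    · obtain ⟨y₂, hy₂, hmax⟩ := hS₁.exists_isMaxOn hne (continuousOn_smoothAlgebra f
        (Set.inter_subset_left.trans (hSK.trans hKU)))
      refine ⟨m - f.1 y₂, sub_pos.mpr (hSm y₂ hy₂.1 hy₂.2), fun y hy hqy ↦ ?_⟩
      have : f.1 y ≤ f.1 y₂ := hmax ⟨hy, hqy⟩
      linarith
  -- With this ε the perturbation is at most δ/2 on K.
  set ε : ℝ := δ / (2 * w.1 y₁) with hε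
  have hεpos : 0 < ε := by positivity
  have hεW : ε * w.1 y₁ = δ / 2 := by rw [hε]; field_simp
  set g : smoothAlgebra I U := f + ε • w with hg
  have hgv : ∀ y, g.1 y = f.1 y + ε * w.1 y := fun y ↦ rfl
  obtain ⟨y, hy, hmax⟩ := hK.exists_isMaxOn ⟨z, hz⟩ (continuousOn_smoothAlgebra g hKU)
  have hyS : y ∉ S := by
    intro hyS
    have h1 : g.1 z ≤ g.1 y := hmax hz
    have hwz : 0 < w.1 z := Real.exp_pos _
    rw [hgv, hgv, hzm] at h1
    rcases le_or_gt (q.1 y) (q.1 z) with hle | hlt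
    · have h2 := hSδ y hyS hle
      have h3 : w.1 y ≤ w.1 y₁ := hW hy
      have h4 := mul_le_mul_of_nonneg_left h3 hεpos.le
      have h5 := mul_pos hεpos hwz
      linarith
    · have h2 := hm y hy
      have h3 : w.1 y < w.1 z := by
        rw [hwv, hwv]
        exact Real.exp_lt_exp.mpr (by nlinarith)
      have h4 := mul_lt_mul_of_pos_left h3 hεpos
      linarith
  have hloc : IsLocalMax g.1 y := Filter.eventually_of_mem (hnhds y hy hyS) fun y' hy' ↦ hmax hy'
  have h1 := h.ev_laplacian_of_isLocalMax (hKU hy) hloc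
  rw [hg, laplacian_add, laplacian_smul, map_add, map_smul, smul_eq_mul] at h1
  have h2 := hf y hy
  have h3 := mul_pos hεpos (hbar y hy)
  linarith

theorem exists_ev_deriv_ne_zero (h : IsOrthonormalFrameOn e U) {y : M} (hy : y ∈ U)
    (q : smoothAlgebra I U) {v : TangentSpace I y} (hv : d% q.1 y v ≠ 0) :
    ∃ i, ev y (h.deriv i q) ≠ 0 := by
  by_contra! h0
  refine hv ?_
  rw [h.mvfderiv_apply_eq_sum hy]
  exact Finset.sum_eq_zero fun i _ ↦ by rw [← h.ev_deriv i q hy, h0 i, mul_zero]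

end IsOrthonormalFrameOn

theorem smoothFun_normSq_chart (x₀ : M) (c : E) (hU : U ⊆ (chartAt H x₀).source) :
    SmoothFun I U (fun y ↦ ‖extChartAt I x₀ y - c‖ ^ 2) := fun y hy ↦ by
  have h1 : ContDiff ℝ ∞ fun z : E ↦ ‖z - c‖ ^ 2 := (contDiff_id.sub contDiff_const).norm_sq ℝ
  exact h1.contDiffAt.contMDiffAt.comp y (contMDiffAt_extChartAt' (hU hy))

theorem exists_mvfderiv_normSq_chart_ne_zero (x₀ : M) (c : E) {y : M}
    (hy : y ∈ (chartAt H x₀).source) (hc : extChartAt I x₀ y ≠ c) :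
    ∃ v : TangentSpace I y, d% (fun y ↦ ‖extChartAt I x₀ y - c‖ ^ 2) y v ≠ 0 := by
  have hφ : MDifferentiableAt I 𝓘(ℝ, E) (extChartAt I x₀) y :=
    (contMDiffAt_extChartAt' (n := ∞) hy).mdifferentiableAt (by simp)
  have hinv := isInvertible_mfderiv_extChartAt (I := I) (x := x₀) (y := y) (by simpa using hy)
  obtain ⟨A, hA⟩ := hinv
  refine ⟨A.symm (extChartAt I x₀ y - c), ?_⟩
  have h1 : HasFDerivAt (fun z : E ↦ ‖z - c‖ ^ 2)
      ((2 : ℝ) • innerSL ℝ (extChartAt I x₀ y - c)) (extChartAt I x₀ y) := by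
    have := ((hasFDerivAt_id (𝕜 := ℝ) (extChartAt I x₀ y)).sub_const c).norm_sq
    refine this.congr_fderiv ?_
    ext w
    simp [two_smul]
  have h2 := (h1.hasMFDerivAt.comp y hφ.hasMFDerivAt).mfderiv
  have h3 : (mfderiv I 𝓘(ℝ, ℝ) ((fun z : E ↦ ‖z - c‖ ^ 2) ∘ extChartAt I x₀) y
      (A.symm (extChartAt I x₀ y - c)) : ℝ) = 2 * ‖extChartAt I x₀ y - c‖ ^ 2 := by
    rw [h2, ← hA]
    change (2 : ℝ) * inner ℝ (extChartAt I x₀ y - c) (A (A.symm (extChartAt I x₀ y - c))) = _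
    have hA' : A (A.symm (extChartAt I x₀ y - c)) = extChartAt I x₀ y - c := A.apply_symm_apply _
    refine (congrArg (fun t : E ↦ 2 * inner ℝ (extChartAt I x₀ y - c) t) hA').trans ?_
    rw [real_inner_self_eq_norm_sq]
    rfl
  refine fun h0 ↦ ?_
  have h4 : 2 * ‖extChartAt I x₀ y - c‖ ^ 2 = 0 := h3.symm.trans h0
  have h5 : ‖extChartAt I x₀ y - c‖ ≠ 0 := norm_ne_zero_iff.mpr (sub_ne_zero.mpr hc)
  exact h5 (by simpa using h4)

end MaximumPrinciple

end RiemannianGeometry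

end

noncomputable section

namespace RiemannianGeometry

/-! ### The strong maximum principle -/

section StrongMaximumPrinciple

set_option linter.unusedSectionVars false

/-- A point of the closed ball with diameter `[p, z]` that is at least as far from `p` as `z` is
equal to `z`. -/
theorem eq_of_mem_closedBall_midpoint {E : Type*} [NormedAddCommGroup E] [InnerProductSpace ℝ E]
    {p z c b : E} (hc : z - c = c - p) (hb : ‖b - c‖ ≤ ‖z - c‖) (hd : ‖z - p‖ ≤ ‖b - p‖) :
    b = z := by
  have h1 : z - p = (2 : ℝ) • (z - c) := by rw [two_smul]; nth_rewrite 2 [hc]; abel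
  have h2 : b - p = (b - c) + (z - c) := by rw [hc]; abel
  have h3 := parallelogram_law_with_norm ℝ (b - c) (z - c)
  rw [h1, h2, norm_smul, Real.norm_ofNat] at hd
  have h4 : ‖b - c - (z - c)‖ = 0 := by
    have := norm_nonneg (b - c - (z - c))
    have := norm_nonneg (b - c)
    have := norm_nonneg (z - c)
    by_contra h0
    have : 0 < ‖b - c - (z - c)‖ * ‖b - c - (z - c)‖ := by positivity
    nlinarith
  have h5 := norm_eq_zero.mp h4
  rwa [sub_sub_sub_cancel_right, sub_eq_zero] at h5

variable {E : Type*} [NormedAddCommGroup E] [InnerProductSpace ℝ E] [FiniteDimensional ℝ E]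
  [CompleteSpace E]
  {H : Type*} [TopologicalSpace H] {I : ModelWithCorners ℝ E H}
  {M : Type*} [TopologicalSpace M] [ChartedSpace H M] [IsManifold I ∞ M]
  [RiemannianBundle (fun x : M ↦ TangentSpace I x)]
  [IsContMDiffRiemannianBundle I ∞ E (fun x : M ↦ TangentSpace I x)]
  {U : Set M}

/-- If f < m at some p near x₀ in the chart, let z be a point of the maximum set nearest to p. The
ball with diameter [p, z] touches that set only at z, so the Hopf argument on a small ball around z,
with q the squared distance to the midpoint, gives a contradiction. -/
theorem IsOrthonormalFrameOn.eventually_eq_of_subharmonic [T2Space M] [I.Boundaryless]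
    {ι : Type*} [Fintype ι] [Nonempty ι] {e : ι → Π x : M, TangentSpace I x}
    (h : IsOrthonormalFrameOn e U) {x₀ : M} (hx₀ : x₀ ∈ U)
    (hU : U ⊆ (chartAt H x₀).source) (f : smoothAlgebra I U)
    (hf : ∀ y ∈ U, 0 ≤ ev y (h.toFrameConnection.laplacian f))
    {m : ℝ} (hm : ∀ y ∈ U, f.1 y ≤ m) (hfx₀ : f.1 x₀ = m) : ∀ᶠ y in nhds x₀, f.1 y = m := by
  set φ := extChartAt I x₀ with hφ
  have hsrc : U ⊆ φ.source := by rwa [hφ, extChartAt_source]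
  have hVopen : IsOpen (φ.target ∩ φ.symm ⁻¹' U) :=
    (continuousOn_extChartAt_symm x₀).isOpen_inter_preimage (isOpen_extChartAt_target x₀) h.isOpen
  have hV₀ : φ x₀ ∈ φ.target ∩ φ.symm ⁻¹' U :=
    ⟨mem_extChartAt_target x₀, by simpa [hφ] using hx₀⟩
  obtain ⟨r₀, hr₀, hball⟩ := Metric.isOpen_iff.mp hVopen _ hV₀
  -- With p within r of x₀ and z within r of p, a ball of radius less than r around z stays in the
  -- 3r-ball, hence in the chart image of U.
  set r : ℝ := r₀ / 4 with hr
  have hrpos : 0 < r := by positivity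
  have hsub : Metric.closedBall (φ x₀) (3 * r) ⊆ φ.target ∩ φ.symm ⁻¹' U :=
    (Metric.closedBall_subset_ball (by rw [hr]; linarith)).trans hball
  set u : E → ℝ := fun p ↦ f.1 (φ.symm p) with hu
  have hucont : ContinuousOn u (Metric.closedBall (φ x₀) (3 * r)) :=
    (continuousOn_smoothAlgebra f subset_rfl).comp
      ((continuousOn_extChartAt_symm x₀).mono fun p hp ↦ (hsub hp).1) fun p hp ↦ (hsub hp).2
  suffices hmain : ∀ p ∈ Metric.ball (φ x₀) r, u p = m by
    have h1 : ∀ᶠ y in nhds x₀, φ y ∈ Metric.ball (φ x₀) r :=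
      (continuousAt_extChartAt x₀).eventually_mem (Metric.ball_mem_nhds _ hrpos)
    filter_upwards [h1, extChartAt_source_mem_nhds (I := I) x₀] with y hy1 hy2
    have := hmain _ hy1
    simpa [hu, φ.left_inv hy2] using this
  by_contra! hcon
  obtain ⟨p, hp, hpm⟩ := hcon
  have hcomp : IsCompact (Metric.closedBall (φ x₀) (3 * r) ∩ u ⁻¹' {m}) :=
    (isCompact_closedBall _ _).of_isClosed_subset
      (hucont.preimage_isClosed_of_isClosed Metric.isClosed_closedBall isClosed_singleton)
      Set.inter_subset_left
  have hux₀ : u (φ x₀) = m := by simpa [hu, hφ] using hfx₀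
  obtain ⟨z, ⟨hz3, hzm⟩, hzmin⟩ := hcomp.exists_isMinOn (f := fun b ↦ ‖b - p‖)
    ⟨φ x₀, Metric.mem_closedBall_self (by positivity), hux₀⟩ (by fun_prop)
  have hzm : u z = m := hzm
  have hpr : ‖p - φ x₀‖ < r := mem_ball_iff_norm.mp hp
  have hdr : ‖z - p‖ < r := by
    have : ‖z - p‖ ≤ ‖φ x₀ - p‖ := hzmin ⟨Metric.mem_closedBall_self (by positivity), hux₀⟩
    rw [norm_sub_rev (φ x₀)] at this
    linarith
  have hzp : z - p ≠ 0 := fun h0 ↦ hpm (by rw [← sub_eq_zero.mp h0, hzm])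
  have hd : 0 < ‖z - p‖ := norm_pos_iff.mpr hzp
  -- Centring at the midpoint rather than at p excludes contact points other than z.
  set c : E := p + (1 / 2 : ℝ) • (z - p) with hc
  have hzc : z - c = (1 / 2 : ℝ) • (z - p) := by rw [hc]; module
  have hcp : c - p = (1 / 2 : ℝ) • (z - p) := by rw [hc]; module
  have hzcn : ‖z - c‖ = ‖z - p‖ / 2 := by
    rw [hzc, norm_smul, Real.norm_of_nonneg (by norm_num)]; ring
  -- The midpoint c lies at distance ‖z - p‖/2 from z, so this ball avoids it and the gradient of q
  -- has no zero there.
  set s : ℝ := ‖z - p‖ / 4 with hs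
  have hspos : 0 < s := by positivity
  have hzx : ‖z - φ x₀‖ < 2 * r := by
    have := norm_add_le (z - p) (p - φ x₀)
    rw [sub_add_sub_cancel] at this
    linarith
  have hBsub : Metric.closedBall z s ⊆ Metric.closedBall (φ x₀) (3 * r) := fun b hb ↦ by
    rw [mem_closedBall_iff_norm] at hb ⊢
    have := norm_add_le (b - z) (z - φ x₀)
    rw [sub_add_sub_cancel] at this
    linarith
  have hBV := hBsub.trans hsub
  have hright : ∀ b ∈ Metric.closedBall z s, φ (φ.symm b) = b := fun b hb ↦
    φ.right_inv (hBV hb).1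
  have hcontB : ContinuousOn φ.symm (Metric.closedBall z s) :=
    (continuousOn_extChartAt_symm x₀).mono fun b hb ↦ (hBV hb).1
  have hzB : z ∈ Metric.closedBall z s := Metric.mem_closedBall_self hspos.le
  set q : smoothAlgebra I U := ⟨fun y ↦ ‖φ y - c‖ ^ 2, smoothFun_normSq_chart x₀ c hU⟩ with hq
  have hqv : ∀ b ∈ Metric.closedBall z s, q.1 (φ.symm b) = ‖b - c‖ ^ 2 := fun b hb ↦ by
    change ‖φ (φ.symm b) - c‖ ^ 2 = _
    rw [hright b hb]
  refine h.hopf f q (K := φ.symm '' Metric.closedBall z s) (S := φ.symm '' Metric.sphere z s)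
    (m := m) (z := φ.symm z) ((isCompact_closedBall z s).image_of_continuousOn hcontB) ?_
    ((isCompact_sphere z s).image_of_continuousOn (hcontB.mono Metric.sphere_subset_closedBall))
    (Set.image_mono Metric.sphere_subset_closedBall) ?_ ?_ ?_ ?_ ⟨z, hzB, rfl⟩ hzm ?_
  · rintro _ ⟨b, hb, rfl⟩
    exact (hBV hb).2
  · rintro _ ⟨b, hb, rfl⟩ hbS
    have hb' : b ∈ Metric.ball z s := by
      rw [Metric.mem_ball]
      refine lt_of_le_of_ne hb fun h0 ↦ hbS ⟨b, h0, rfl⟩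
    have h1 : ContinuousAt φ (φ.symm b) :=
      continuousAt_extChartAt' (φ.map_target (hBV hb).1)
    have h2 : ∀ᶠ y in nhds (φ.symm b), φ y ∈ Metric.ball z s :=
      h1.eventually_mem (by rw [hright b hb]; exact Metric.isOpen_ball.mem_nhds hb')
    filter_upwards [h2, (isOpen_extChartAt_source (I := I) x₀).mem_nhds (φ.map_target (hBV hb).1)]
      with y hy1 hy2
    exact ⟨φ y, Metric.ball_subset_closedBall hy1, φ.left_inv hy2⟩
  · rintro _ ⟨b, hb, rfl⟩
    have hbc : φ (φ.symm b) ≠ c := by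
      rw [hright b hb]
      rintro rfl
      rw [mem_closedBall_iff_norm, norm_sub_rev, hzcn, hs] at hb
      linarith
    obtain ⟨v, hv⟩ := exists_mvfderiv_normSq_chart_ne_zero x₀ c (hU (hBV hb).2) hbc
    exact h.exists_ev_deriv_ne_zero (hBV hb).2 q hv
  · rintro _ ⟨b, hb, rfl⟩
    exact hf _ (hBV hb).2
  · rintro _ ⟨b, hb, rfl⟩
    exact hm _ (hBV hb).2
  · rintro _ ⟨b, hb, rfl⟩ hqb
    have hbB := Metric.sphere_subset_closedBall hb
    rw [hqv b hbB, hqv z hzB] at hqb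
    refine lt_of_le_of_ne (hm _ (hBV hbB).2) fun h0 ↦ ?_
    have hdist : ‖z - p‖ ≤ ‖b - p‖ := hzmin ⟨hBsub hbB, h0⟩
    have hbz : b = z := eq_of_mem_closedBall_midpoint (hzc.trans hcp.symm)
      ((pow_le_pow_iff_left₀ (norm_nonneg _) (norm_nonneg _) two_ne_zero).mp hqb) hdist
    rw [hbz, Metric.mem_sphere, dist_self] at hb
    exact hspos.ne hb

/-- A continuous function on a closed connected Riemannian manifold that is smooth and subharmonic
in every local orthonormal frame is constant. -/
theorem eq_of_subharmonic [T2Space M] [CompactSpace M] [ConnectedSpace M] [I.Boundaryless]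
    [Nonempty (Fin (Module.finrank ℝ E))] {f : M → ℝ} (hf : ContMDiff I 𝓘(ℝ, ℝ) ∞ f)
    (hsub : ∀ {U : Set M} {e : Fin (Module.finrank ℝ E) → Π x : M, TangentSpace I x}
      (h : IsOrthonormalFrameOn e U), ∀ y ∈ U,
        0 ≤ ev y (h.toFrameConnection.laplacian ⟨f, fun y _ ↦ hf y⟩)) (x y : M) : f x = f y := by
  obtain ⟨x₁, -, hx₁⟩ := isCompact_univ.exists_isMaxOn Set.univ_nonempty hf.continuous.continuousOn
  have hmax : ∀ y, f y ≤ f x₁ := fun y ↦ hx₁ (Set.mem_univ y)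
  -- The maximum set is closed by continuity and open by the local statement; connectedness
  -- finishes.
  have hclopen : IsClopen (f ⁻¹' {f x₁}) := by
    refine ⟨isClosed_singleton.preimage hf.continuous, isOpen_iff_mem_nhds.mpr fun x₀ hx₀ ↦ ?_⟩
    obtain ⟨U, e, hxU, h⟩ := exists_isOrthonormalFrameOn I x₀
    have h' := h.mono (h.isOpen.inter (chartAt H x₀).open_source) Set.inter_subset_left
    exact h'.eventually_eq_of_subharmonic ⟨hxU, mem_chart_source H x₀⟩ Set.inter_subset_right
      ⟨f, fun y _ ↦ hf y⟩ (fun y hy ↦ hsub h' y hy) (fun y _ ↦ hmax y) hx₀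
  have huniv := hclopen.eq_univ ⟨x₁, rfl⟩
  have key : ∀ y, f y = f x₁ := fun y ↦ (huniv ▸ Set.mem_univ y : y ∈ f ⁻¹' {f x₁})
  rw [key x, key y]

end StrongMaximumPrinciple

end RiemannianGeometry

end

noncomputable section

namespace RiemannianGeometry

/-! ### Consequences of a vanishing Laplacian -/

section Rigidity

set_option linter.unusedSectionVars false

theorem inner₄_self_nonneg {ι : Type*} [Fintype ι] (T : ι → ι → ι → ι → ℝ) : 0 ≤ inner₄ T T :=
  Finset.sum_nonneg fun _ _ ↦ Finset.sum_nonneg fun _ _ ↦ Finset.sum_nonneg fun _ _ ↦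
    Finset.sum_nonneg fun _ _ ↦ mul_self_nonneg _

theorem eq_zero_of_inner₄_self_eq_zero {ι : Type*} [Fintype ι] {T : ι → ι → ι → ι → ℝ}
    (h : inner₄ T T = 0) (i j k l : ι) : T i j k l = 0 := by
  have h₄ : ∀ i j k, 0 ≤ ∑ l, T i j k l * T i j k l := fun i j k ↦
    Finset.sum_nonneg fun l _ ↦ mul_self_nonneg _
  have h₃ : ∀ i j, 0 ≤ ∑ k, ∑ l, T i j k l * T i j k l := fun i j ↦
    Finset.sum_nonneg fun k _ ↦ h₄ i j k
  have h₂ : ∀ i, 0 ≤ ∑ j, ∑ k, ∑ l, T i j k l * T i j k l := fun i ↦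
    Finset.sum_nonneg fun j _ ↦ h₃ i j
  have e₁ := (Finset.sum_eq_zero_iff_of_nonneg fun i _ ↦ h₂ i).mp h i (Finset.mem_univ i)
  have e₂ := (Finset.sum_eq_zero_iff_of_nonneg fun j _ ↦ h₃ i j).mp e₁ j (Finset.mem_univ j)
  have e₃ := (Finset.sum_eq_zero_iff_of_nonneg fun k _ ↦ h₄ i j k).mp e₂ k (Finset.mem_univ k)
  exact mul_self_eq_zero.mp ((Finset.sum_eq_zero_iff_of_nonneg fun l _ ↦
    mul_self_nonneg (T i j k l)).mp e₃ l (Finset.mem_univ l))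

variable {E : Type*} [NormedAddCommGroup E] [NormedSpace ℝ E] [FiniteDimensional ℝ E]
  [CompleteSpace E]
  {H : Type*} [TopologicalSpace H] {I : ModelWithCorners ℝ E H}
  {M : Type*} [TopologicalSpace M] [ChartedSpace H M] [IsManifold I ∞ M]
  [RiemannianBundle (fun x : M ↦ TangentSpace I x)]
  [IsContMDiffRiemannianBundle I ∞ E (fun x : M ↦ TangentSpace I x)]
  {U : Set M}

theorem contMDiff_curvNormSq [Nonempty (Fin (Module.finrank ℝ E))] :
    ContMDiff I 𝓘(ℝ, ℝ) ∞ (curvNormSq I : M → ℝ) := fun x ↦ by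
  obtain ⟨U, e, hx, h⟩ := exists_isOrthonormalFrameOn I x
  exact h.smooth_curvNormSq x hx

namespace IsOrthonormalFrameOn

variable {ι : Type*} [Fintype ι] [Nonempty ι] {e : ι → Π x : M, TangentSpace I x}

/-- `curv_bianchi` keeps the third index fixed; pair symmetry turns it into the form with the first
index fixed. -/
theorem curvAt_bianchi (h : IsOrthonormalFrameOn e U) (y : M) (i j k l : ι) :
    h.curvAt y i j k l + h.curvAt y i k l j + h.curvAt y i l j k = 0 := by
  have := congrArg (ev y) (h.toFrameConnection.curv_bianchi k l j i)
  rw [h.toFrameConnection.curv_pair_symm k l, h.toFrameConnection.curv_pair_symm l j,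
    h.toFrameConnection.curv_pair_symm j k, map_add, map_add, map_zero] at this
  simp only [curvAt]
  linarith

theorem sum_curvAt [DecidableEq ι] (h : IsOrthonormalFrameOn e U) {c : ℝ}
    (hE : ∀ (x : M) (u v : TangentSpace I x), ricci x u v = c * inner ℝ u v) {y : M} (hy : y ∈ U)
    (j l : ι) : ∑ i, h.curvAt y i j i l = c * kron j l :=
  (h.ricci_frame hy j l).symm.trans (by rw [hE, h.inner_eq hy, kron])

theorem sectionalCurvature_eq [DecidableEq ι] (h : IsOrthonormalFrameOn e U) {y : M} (hy : y ∈ U)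
    {m : ℝ} (hm : ∀ i j k l, h.curvAt y i j k l = m * unitCurvature i j k l)
    {u v : TangentSpace I y} (huv : LinearIndependent ℝ ![u, v]) :
    sectionalCurvature y u v = m := by
  have h1 : Rm y u v u v = m * (inner ℝ u u * inner ℝ v v - inner ℝ u v ^ 2) := by
    rw [h.Rm_eq hy]
    have h2 : ∀ i j k l, ev y (h.toFrameConnection.curv i j k l) =
        m * ((if i = k then 1 else 0) * (if j = l then 1 else 0)
          - (if i = l then 1 else 0) * (if j = k then 1 else 0)) := hm
    have h3 : ∀ a b : TangentSpace I y, inner ℝ a b = ∑ i, inner ℝ (e i y) a * inner ℝ (e i y) b :=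
      fun a b ↦ by
        rw [real_inner_comm, h.sum_inner_mul hy]
        exact Finset.sum_congr rfl fun i _ ↦ by ring
    rw [h3 u u, h3 v v, h3 u v, sq, Finset.sum_mul_sum, Finset.sum_mul_sum]
    simp only [h2, mul_sub, Finset.sum_sub_distrib, Finset.mul_sum]
    congr 1
    · simp
      exact Finset.sum_congr rfl fun i _ ↦ Finset.sum_congr rfl fun j _ ↦ by ring
    · simp
      exact Finset.sum_congr rfl fun i _ ↦ Finset.sum_congr rfl fun j _ ↦ by ring
  -- Equality in the Cauchy–Schwarz inequality would make u and v dependent.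
  have h4 : inner ℝ u u * inner ℝ v v - inner ℝ u v ^ 2 ≠ 0 := by
    intro h0
    have h5 : |inner ℝ u v| = ‖u‖ * ‖v‖ := by
      rw [real_inner_self_eq_norm_sq, real_inner_self_eq_norm_sq] at h0
      rw [← abs_of_nonneg (mul_nonneg (norm_nonneg u) (norm_nonneg v)), ← sq_eq_sq_iff_abs_eq_abs]
      linarith
    have hu : u ≠ 0 := huv.ne_zero 0
    have hv : v ≠ 0 := huv.ne_zero 1
    obtain ⟨-, r, -, hr⟩ := (abs_real_inner_div_norm_mul_norm_eq_one_iff u v).mp (by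
      rw [abs_div, h5, abs_of_nonneg (mul_nonneg (norm_nonneg u) (norm_nonneg v)), div_self
        (mul_ne_zero (norm_ne_zero_iff.mpr hu) (norm_ne_zero_iff.mpr hv))])
    have := (LinearIndependent.pair_iff.mp huv r (-1) (by rw [hr]; simp)).2
    norm_num at this
  rw [sectionalCurvature, h1, mul_div_cancel_right₀ _ h4]

/-- Under the eigenvalue bound, the squared norm of an Einstein curvature tensor is subharmonic; where
its Laplacian vanishes, so does the covariant derivative of the curvature tensor, and under the
strict bound the curvature is that of a space form. -/
theorem laplacian_curvNormSq_rigidity [DecidableEq ι] (h : IsOrthonormalFrameOn e U) {c : ℝ}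
    (hE : ∀ (x : M) (u v : TangentSpace I x), ricci x u v = c * inner ℝ u v)
    (hι : 4 ≤ Fintype.card ι) {y : M} (hy : y ∈ U)
    (h4 : Fintype.card ι = 4 → 0 ≤ lowestEigenvalueSum I y 2)
    (h5 : 5 ≤ Fintype.card ι → 0 ≤ lowestEigenvalueSum I y ((Fintype.card ι - 1) / 2)) :
    0 ≤ ev y (h.toFrameConnection.laplacian ⟨curvNormSq I, h.smooth_curvNormSq⟩) ∧
    (ev y (h.toFrameConnection.laplacian ⟨curvNormSq I, h.smooth_curvNormSq⟩) = 0 →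
      (∀ m i j k l, ev y (h.toFrameConnection.nabla m h.toFrameConnection.curv i j k l) = 0) ∧
      ((Fintype.card ι = 4 → 0 < lowestEigenvalueSum I y 2) →
        (5 ≤ Fintype.card ι → 0 < lowestEigenvalueSum I y ((Fintype.card ι - 1) / 2)) →
        ∀ i j k l, h.curvAt y i j k l =
          c / ((Fintype.card ι : ℝ) - 1) * unitCurvature i j k l)) := by
  obtain ⟨N, lam, Ξ, hΞ, hmono, hlow, hlap⟩ := h.laplacian_curvNormSq hE hy
  have hι' : (4 : ℝ) ≤ Fintype.card ι := by exact_mod_cast hι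
  have hRic : ∀ j l, ∑ i, h.curvAt y i j i l =
      c / ((Fintype.card ι : ℝ) - 1) * ((Fintype.card ι : ℝ) - 1) * kron j l := fun j l ↦ by
    rw [h.sum_curvAt hE hy, div_mul_cancel₀ _ (by linarith)]
  rw [hlap]
  simp only [hlow] at h4 h5 ⊢
  have hen := hΞ.curvatureEnergy_nonneg hmono (h.curvAt_bianchi y) hRic hι h4 h5
  have hnab : ∀ m, 0 ≤ inner₄ (fun i j k l ↦
      ev y (h.toFrameConnection.nabla m h.toFrameConnection.curv i j k l)) (fun i j k l ↦
      ev y (h.toFrameConnection.nabla m h.toFrameConnection.curv i j k l)) := fun m ↦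
    inner₄_self_nonneg _
  have hsum := Finset.sum_nonneg fun m (_ : m ∈ Finset.univ) ↦ hnab m
  refine ⟨by linarith, fun h0 ↦ ⟨fun m ↦ eq_zero_of_inner₄_self_eq_zero ?_, fun h4' h5' ↦
    hΞ.eq_unitCurvature_of_pos hmono (h.curvAt_bianchi y) hRic hι h4' h5' (by linarith)⟩⟩
  exact (Finset.sum_eq_zero_iff_of_nonneg fun m _ ↦ hnab m).mp (by linarith) m (Finset.mem_univ m)

theorem laplacian_eq_zero_of_const (h : IsOrthonormalFrameOn e U) {f : smoothAlgebra I U} {a : ℝ}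
    (hf : ∀ y ∈ U, f.1 y = a) : h.toFrameConnection.laplacian f = 0 := by
  rw [h.laplacian_congr (g := algebraMap ℝ _ a) hf]
  simp [FrameConnection.laplacian, Derivation.map_algebraMap]

theorem covDerivRm_eq_zero (h : IsOrthonormalFrameOn e U) {y : M} (hy : y ∈ U)
    (h0 : ∀ m i j k l, ev y (h.toFrameConnection.nabla m h.toFrameConnection.curv i j k l) = 0)
    {V X Y Z W : Π x : M, TangentSpace I x}
    (hV : SmoothField U V) (hX : SmoothField U X) (hY : SmoothField U Y) (hZ : SmoothField U Z)
    (hW : SmoothField U W) : covDerivRm V X Y Z W y = 0 := by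
  rw [h.covDerivRm_eq hV hX hY hZ hW hy]
  simp [FrameConnection.eval₄, map_sum, map_mul, h0]

end IsOrthonormalFrameOn

end Rigidity

end RiemannianGeometry

end

/-! ### The rigidity theorem -/

theorem theoremB (n : ℕ) (hn : 4 ≤ n)
    {M : Type*} [TopologicalSpace M] [T2Space M] [CompactSpace M] [ConnectedSpace M]
    [ChartedSpace (EuclideanSpace ℝ (Fin n)) M] [IsManifold (𝓡 n) ∞ M]
    [RiemannianBundle (fun x : M ↦ TangentSpace (𝓡 n) x)]
    [IsContMDiffRiemannianBundle (𝓡 n) ∞ (EuclideanSpace ℝ (Fin n))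
      (fun x : M ↦ TangentSpace (𝓡 n) x)]
    (hEinstein : RiemannianGeometry.IsEinstein (𝓡 n) M)
    (h4 : n = 4 → ∀ x : M, 0 ≤ RiemannianGeometry.lowestEigenvalueSum (𝓡 n) x 2)
    (h5 : 5 ≤ n → ∀ x : M, 0 ≤ RiemannianGeometry.lowestEigenvalueSum (𝓡 n) x ((n - 1) / 2)) :
    RiemannianGeometry.HasParallelCurvature (𝓡 n) M ∧
      ((n = 4 → ∀ x : M, 0 < RiemannianGeometry.lowestEigenvalueSum (𝓡 n) x 2) →
        (5 ≤ n → ∀ x : M, 0 < RiemannianGeometry.lowestEigenvalueSum (𝓡 n) x ((n - 1) / 2)) →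
        RiemannianGeometry.HasConstantSectionalCurvature (𝓡 n) M) := by
  open RiemannianGeometry in
  obtain ⟨c, hE⟩ := hEinstein
  have hdim : Module.finrank ℝ (EuclideanSpace ℝ (Fin n)) = n := finrank_euclideanSpace_fin
  have hcard : Fintype.card (Fin (Module.finrank ℝ (EuclideanSpace ℝ (Fin n)))) = n := by
    rw [Fintype.card_fin, hdim]
  have : Nonempty (Fin (Module.finrank ℝ (EuclideanSpace ℝ (Fin n)))) :=
    Fintype.card_pos_iff.mp (by rw [hcard]; linarith)
  have key {U : Set M} {e : Fin (Module.finrank ℝ (EuclideanSpace ℝ (Fin n))) →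
      Π x : M, TangentSpace (𝓡 n) x} (h : IsOrthonormalFrameOn e U) {y : M} (hy : y ∈ U) :=
    h.laplacian_curvNormSq_rigidity hE (by rwa [hcard]) hy (by rw [hcard]; exact fun H ↦ h4 H y)
      (by rw [hcard]; exact fun H ↦ h5 H y)
  -- Constancy of |Rm|² makes its Laplacian vanish at every point, which activates the equality case
  -- of `key`.
  have hconst := eq_of_subharmonic (f := (curvNormSq (𝓡 n) : M → ℝ)) contMDiff_curvNormSq
    fun h y hy ↦ (key h hy).1
  have hrigid {U : Set M} {e : Fin (Module.finrank ℝ (EuclideanSpace ℝ (Fin n))) →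
      Π x : M, TangentSpace (𝓡 n) x} (h : IsOrthonormalFrameOn e U) {y : M} (hy : y ∈ U) :=
    (key h hy).2 (by
      rw [h.laplacian_eq_zero_of_const fun z _ ↦ hconst z y, map_zero])
  -- In constant curvature κ the Ricci tensor is (n-1)κ g, so κ = c/(n-1), the same constant at
  -- every point.
  refine ⟨fun V X Y Z W hV hX hY hZ hW x ↦ ?_, fun h4' h5' ↦
    ⟨c / ((n : ℝ) - 1), fun x u v huv ↦ ?_⟩⟩
  · obtain ⟨U, e, hx, h⟩ := exists_isOrthonormalFrameOn (𝓡 n) x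
    exact h.covDerivRm_eq_zero hx (hrigid h hx).1 (fun y _ ↦ hV y) (fun y _ ↦ hX y)
      (fun y _ ↦ hY y) (fun y _ ↦ hZ y) (fun y _ ↦ hW y)
  · obtain ⟨U, e, hx, h⟩ := exists_isOrthonormalFrameOn (𝓡 n) x
    have h1 := (hrigid h hx).2 (by rw [hcard]; exact fun H ↦ h4' H x)
      (by rw [hcard]; exact fun H ↦ h5' H x)
    rw [hcard] at h1
    exact h.sectionalCurvature_eq hx h1 huv
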